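/- **Setting.** Let $\mathcal C$ be the unit circle of $\mathbb R^2=\mathbb C$ with geodesic distance $d\in[0,\pi]$, let $\mathcal O$ be the orthogonal group of $\mathbb R^2$, and write $Q\mathbf x=(Qx_1,\dots,Qx_n)$ and $d_\infty(\mathbf x,\mathbf y)=\max_i d(x_i,y_i)$. For $N\ge 1$ let $\mathcal C_N=\{e^{2i\pi k/N}:0\le k<N\}$; let $\boldsymbol\Pi_N$ be the set of tuples $(e^{2i\pi\sigma(j)/N})_{1\le j\le N}$ with $\sigma$ a permutation, and $d_\infty(\mathbf x,\boldsymbol\Pi_N)=\min_{\mathbf y\in\boldsymbol\Pi_N}d_\infty(\mathbf x,\mathbf y)$. For $\mathbf x^*\in\mathcal C^n$, $f:\mathcal C^2\to[0,1]$ and a matrix $F$, $(\mathbf x^*,f)\in\mathcal R[F,c_l,c_L,c_e]$ means that $F_{ij}=f(x_i^*,x_j^*)$ for $i<j$, that $f$ is symmetric, and that for all $x,y,y'\in\mathcal C$, with $\varepsilon_n=c_e\sqrt{\log(n)/n}$, $$|f(x,y)-f(x,y')|\le c_L d(y,y')+\varepsilon_n,\qquad f(x,y')-f(x,y)\ge c_l\,(d(x,y)-d(x,y'))-\varepsilon_n\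 \text{ if } d(x,y)\ge d(x,y').$$ The observation is a symmetric random matrix $A\in\mathbb R^{n\times n}$ with zero diagonal and mean $F=\mathbb E[A]$; the entries $E_{ij}=A_{ij}-F_{ij}$, $i<j$, are independent and subGaussian(1): for every $B\in\mathbb R^{n\times n}$ and $t\ge0$, $\mathbb P\big[\sum_{i<j}B_{ij}E_{ij}>t\,(\sum_{i<j}B_{ij}^2)^{1/2}\big]\le e^{-t^2/2}$. Let $\lambda_0^*\ge\dots\ge\lambda_{n-1}^*$ be the eigenvalues of $F$, $\Delta_1=\lambda_0^*-\lambda_1^*$ and $\Delta_2=\lambda_2^*-\lambda_3^*$. **Procedure.** Let $n$ be a multiple of $4$ and $n_0=n/4$. Independently of $A$, draw $S\subset[n]$ uniformly among the subsets of size $n_0$, then $S'\subset\overline S$ uniformly among the subsets of $\overline S$ of size $n_0$. *(Spectral localization.)* From $A_{SS}$, take orthonormal eigenvectors $\hat u,\hat v$ for its second and third largest eigenvalues, and let $z_i\in\mathcal C$ be the normalization of $\sqrt{n_0/2}\,(\hat u_i,\hat v_i)$ (an arbitrary point of $\mathcal C$ if this vector is $0$), for $i\in S$. Enumerate $S$ as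 $i_1,\dots,i_{n_0}$ so that $z_{i_1},\dots,z_{i_{n_0}}$ are in trigonometric order, choose $\hat k\in\arg\min_{1\le k\le n_0}\sum_{\ell}\|e^{2i\pi(k+\ell)/n_0}-z_{i_\ell}\|_1$ with $\|\cdot\|_1$ the $\ell^1$ norm of $\mathbb R^2$, and set $\tilde x^{(1)}_{i_\ell}=e^{2i\pi(\hat k+\ell)/n_0}$. The choices are made so that $\tilde{\mathbf x}^{(1)}_S$ is, for each $S$, a measurable function of $A_{SS}$. *(Refinement.)* For $i\in\overline S$ choose $\hat x_i^{(2)}\in\arg\min_{z\in\mathcal C_{n_0}}\sum_{j\in S}A_{ij}\,d(z,\tilde x^{(1)}_j)$. *(Merging.)* Compute $\hat x^{(2')}_i$, $i\in\overline{S'}$, in the same way from $S'$; choose $\hat Q\in\arg\min_{Q\in\mathcal O}\max_{i\in\overline S\cap\overline{S'}}d(\hat x_i^{(2)},Q\hat x_i^{(2')})$; set $\hat x_j=\hat x_j^{(2)}$ for $j\in\overline S$ and $\hat x_j=\hat Q\hat x_j^{(2')}$ for $j\in S$. **Theorem.** Let $c_a,c_b,c_e>0$ and $0<c_l\le c_L$.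 There is a constant $C>0$ depending only on $c_a,c_b,c_e,c_l,c_L$ such that the following holds for every multiple $n\ge16$ of $4$. Let $(\mathbf x^*,f)\in\mathcal R[F,c_l,c_L,c_e]$ with $f=g\circ d$ geometric, and assume $$d_\infty(\mathbf x^*,\boldsymbol\Pi_n)\le c_a\sqrt{\log(n)/n}\qquad\text{and}\qquad \min(\Delta_1,\Delta_2)\ge c_b\,n.$$ Then, with probability at least $1-9/n^2$, every output $\hat{\mathbf x}$ of the procedure satisfies $$\min_{Q\in\mathcal O}d_\infty(\hat{\mathbf x},Q\mathbf x^*)\le C\sqrt{\frac{\log n}{n}}.$$ -/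

import Mathlib

open MeasureTheory ProbabilityTheory

open scoped Matrix

noncomputable section

namespace SpectralSeriation

/-! ### The circle, its geodesic distance, and orthogonal transformations -/

/-- Geodesic distance `d` on the unit circle: the unoriented angle, with values in `[0, π]`. -/
def geoDist (x y : Circle) : ℝ := InnerProductGeometry.angle (x : ℂ) (y : ℂ)

/-- The maximum distance `d_∞` between two tuples of points of the circle. -/
def dInf {ι : Type*} (x y : ι → Circle) : ℝ := ⨆ i, geoDist (x i) (y i)

/-- An orthogonal transformation of the plane, acting on the unit circle. -/
def orthAct (Q : ℂ ≃ₗᵢ[ℝ] ℂ) (z : Circle) : Circle :=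
  ⟨Q z, by
    have h : ‖Q z‖ = 1 := by rw [Q.norm_map, Circle.norm_coe]
    simpa [Submonoid.unitSphere] using h⟩

/-- The point `e^{2 i π k / N}`. -/
def gridPoint (N k : ℕ) : Circle := Circle.exp (2 * Real.pi * k / N)

/-- The regular grid `{1, e^{2 i π / N}, …, e^{2 i π (N - 1) / N}}`. -/
def regularGrid (N : ℕ) : Set Circle := Set.range fun k : Fin N => gridPoint N k

/-- Distance `d_∞(x, Π_n)` of `x` to the regular positions, that is to the tuples
`(e^{2 i π σ(j) / n})_j` with `σ` a permutation; the infimum is over a finite set. -/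
def distToRegular {n : ℕ} (x : Fin n → Circle) : ℝ :=
  ⨅ σ : Equiv.Perm (Fin n), dInf x fun j => gridPoint n (σ j)

/-! ### The latent space model -/

/-- Real matrices carry the product sigma-algebra of their entries. -/
instance instMeasurableSpaceMatrix {m n : Type*} : MeasurableSpace (Matrix m n ℝ) :=
  inferInstanceAs (MeasurableSpace (m → n → ℝ))

/-- Bi-Lipschitz functions on the circle, with `ε_n = c_e √(log n / n)`. -/
structure BiLipschitz (n : ℕ) (cl cL ce : ℝ) (f : Circle → Circle → ℝ) : Prop where
  mem_Icc : ∀ x y, f x y ∈ Set.Icc (0 : ℝ) 1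
  symm : ∀ x y, f x y = f y x
  upper : ∀ x y y', |f x y - f x y'| ≤
    cL * geoDist y y' + ce * √(Real.log n / n)
  lower : ∀ x y y', geoDist x y' ≤ geoDist x y →
    cl * (geoDist x y - geoDist x y') - ce * √(Real.log n / n) ≤ f x y' - f x y

/-- The set `R[F, c_l, c_L, c_e]` of representations of `F`. -/
def representations {n : ℕ} (F : Matrix (Fin n) (Fin n) ℝ) (cl cL ce : ℝ) :
    Set ((Fin n → Circle) × (Circle → Circle → ℝ)) :=
  {p | BiLipschitz n cl cL ce p.2 ∧ ∀ i j, i < j → p.2 (p.1 i) (p.1 j) = F i j}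

/-- `f = g ∘ d` for some function `g` (only its values on `[0, π]` matter). -/
def IsGeometric (f : Circle → Circle → ℝ) : Prop :=
  ∃ g : ℝ → ℝ, ∀ x y, f x y = g (geoDist x y)

/-- The observations: `A` is a symmetric random matrix with zero diagonal and mean `F`; the
entries `E i j = A i j - F i j`, for `i < j`, are independent and subGaussian(1). -/
structure IsObservation {n : ℕ} {Ω : Type*} [MeasurableSpace Ω] (P : Measure Ω)
    (A : Ω → Matrix (Fin n) (Fin n) ℝ) (F : Matrix (Fin n) (Fin n) ℝ) : Prop where
  measurable : Measurable A
  symm : ∀ ω, (A ω).IsSymm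
  diag : ∀ ω i, A ω i i = 0
  integrable : ∀ i j, Integrable (fun ω => A ω i j) P
  mean : ∀ i j, ∫ ω, A ω i j ∂P = F i j
  indep : iIndepFun
    (fun (p : {p : Fin n × Fin n // p.1 < p.2}) ω => A ω p.1.1 p.1.2 - F p.1.1 p.1.2) P
  subGaussian : ∀ (B : Matrix (Fin n) (Fin n) ℝ) (t : ℝ), 0 ≤ t →
    P.real {ω | t * √(∑ i, ∑ j ∈ Finset.Ioi i, B i j ^ 2) <
      ∑ i, ∑ j ∈ Finset.Ioi i, B i j * (A ω i j - F i j)} ≤ Real.exp (-t ^ 2 / 2)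

/-- The pairs `(S, S')` of disjoint subsets of `Fin n` with `n / 4` elements each. Drawing `S`
uniformly among the subsets of size `n / 4`, and then `S'` uniformly among the subsets of size
`n / 4` of the complement of `S`, is the same as drawing such a pair uniformly. -/
def splitPairs (n : ℕ) : Set (Finset (Fin n) × Finset (Fin n)) :=
  {p | p.1.card = n / 4 ∧ p.2.card = n / 4 ∧ Disjoint p.1 p.2}

/-! ### Spectra -/

/-- The `k`-th largest eigenvalue (`k = 0, 1, …`, with multiplicity) of a real symmetric matrix;
by convention `0` if the matrix is not symmetric or `k` is too large. -/
def nthEigenvalue {ι : Type*} [Fintype ι] [DecidableEq ι] (M : Matrix ι ι ℝ) (k : ℕ) : ℝ :=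
  open scoped Classical in
  if h : M.IsHermitian ∧ k < Fintype.card ι then h.1.eigenvalues₀ ⟨k, h.2⟩ else 0

/-! ### The spectral Localize-and-Refine procedure

Ties in the minimizations, the orthonormal eigenvectors and the ordering permutation can be
chosen in several ways, so each step is a relation between its input and its possible outputs. -/

/-- `y` is a possible output of the vanilla spectral algorithm on `M`: its points are
`√(N/2) (u_i, v_i)`, where `u`, `v` are orthonormal eigenvectors associated with the second and
third largest eigenvalues. -/
def IsVanillaSpectral {ι : Type*} [Fintype ι] [DecidableEq ι] (M : Matrix ι ι ℝ)
    (y : ι → ℂ) : Prop :=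
  ∃ u v : ι → ℝ, M *ᵥ u = nthEigenvalue M 1 • u ∧ M *ᵥ v = nthEigenvalue M 2 • v ∧
    u ⬝ᵥ u = 1 ∧ v ⬝ᵥ v = 1 ∧ u ⬝ᵥ v = 0 ∧
    ∀ i, y i = ⟨√((Fintype.card ι : ℝ) / 2) * u i, √((Fintype.card ι : ℝ) / 2) * v i⟩

/-- The points `z 0, z 1, …` are met in this order when walking (at most) once around the circle
in the trigonometric direction. -/
def TrigonometricOrder {N : ℕ} (z : Fin N → Circle) : Prop :=
  ∃ θ : Fin N → ℝ, Monotone θ ∧ (∀ k l, θ l < θ k + 2 * Real.pi) ∧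
    ∀ l, z l = Circle.exp (θ l)

/-- The `ℓ¹` norm on `ℂ = ℝ²`. -/
def l1Norm (w : ℂ) : ℝ := |w.re| + |w.im|

/-- The criterion minimized over the shift `k` in the uniform approximation; the index
`l = 0, …, N - 1` stands for the rank `l + 1`. -/
def shiftCost {N : ℕ} (z : Fin N → Circle) (k : ℕ) : ℝ :=
  ∑ l : Fin N, l1Norm ((gridPoint N (k + (l + 1)) : ℂ) - (z l : ℂ))

/-- `x` is a possible output of the uniform approximation step on `y`. The `z i` are the
normalized points `y i / ‖y i‖` (any point of the circle is allowed when `y i = 0`), `σ` sorts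
them in trigonometric order, and `k` is an optimal shift. -/
def IsUniformApproximation {ι : Type*} [Fintype ι] (y : ι → ℂ) (x : ι → Circle) : Prop :=
  ∃ (z : ι → Circle) (σ : Fin (Fintype.card ι) ≃ ι) (k : ℕ),
    (∀ i, y i = ‖y i‖ * (z i : ℂ)) ∧
    TrigonometricOrder (fun l => z (σ l)) ∧
    k ∈ Set.Icc 1 (Fintype.card ι) ∧
    IsMinOn (shiftCost fun l => z (σ l)) (Set.Icc 1 (Fintype.card ι)) k ∧
    ∀ l : Fin (Fintype.card ι), x (σ l) = gridPoint (Fintype.card ι) (k + (l + 1))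

/-- `x` is a possible output of the spectral localization on the data matrix `M`. -/
def IsSpectralLocalization {ι : Type*} [Fintype ι] [DecidableEq ι] (M : Matrix ι ι ℝ)
    (x : ι → Circle) : Prop :=
  ∃ y : ι → ℂ, IsVanillaSpectral M y ∧ IsUniformApproximation y x

/-- The submatrix `A_{SS}`. -/
def subMatrix {n : ℕ} (A : Matrix (Fin n) (Fin n) ℝ) (S : Finset (Fin n)) : Matrix S S ℝ :=
  A.submatrix Subtype.val Subtype.val

/-- An implementation of the spectral localization: a measurable function of the data matrix
`A_{SS}`, for each `S` of size `n / 4`, that always returns one of the possible outputs. -/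
structure SpectralLocalizer (n : ℕ) where
  toFun : (S : Finset (Fin n)) → Matrix S S ℝ → S → Circle
  measurable : ∀ S : Finset (Fin n), S.card = n / 4 →
    Measurable fun M (i : S) => (toFun S M i : ℂ)
  spec : ∀ S : Finset (Fin n), S.card = n / 4 → ∀ M : Matrix S S ℝ, M.IsSymm →
    IsSpectralLocalization M (toFun S M)

/-- The criterion `⟨A_{i,S}, D(z, x_S)⟩` of the refinement step. -/
def refineCost {n : ℕ} (A : Matrix (Fin n) (Fin n) ℝ) (S : Finset (Fin n)) (x : S → Circle)
    (i : Fin n) (z : Circle) : ℝ :=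
  ∑ j : S, A i j * geoDist z (x j)

/-- `y i`, for `i ∉ S`, are possible refined positions computed from the initial positions
`x` of the points in `S` (the values `y i` for `i ∈ S` are irrelevant). -/
def IsRefinement {n : ℕ} (A : Matrix (Fin n) (Fin n) ℝ) (S : Finset (Fin n)) (x : S → Circle)
    (y : Fin n → Circle) : Prop :=
  ∀ i, i ∉ S → y i ∈ regularGrid (n / 4) ∧
    IsMinOn (refineCost A S x i) (regularGrid (n / 4)) (y i)

/-- `d_∞(y, Q y')` restricted to the points outside `S` and `S'`. -/
def mergeCost {n : ℕ} (S S' : Finset (Fin n)) (y y' : Fin n → Circle) (Q : ℂ ≃ₗᵢ[ℝ] ℂ) : ℝ :=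
  dInf (fun i : (Sᶜ ∩ S'ᶜ : Finset (Fin n)) => y i) (fun i => orthAct Q (y' i))

/-- `xhat` is a possible output of the spectral Localize-and-Refine procedure run on the data
matrix `A` with the subsets `S`, `S'`, where the initial positions of the points in `S` and in
`S'` are computed by the spectral localizers `loc` and `loc'`. -/
def IsLocalizeAndRefine {n : ℕ} (loc loc' : SpectralLocalizer n)
    (A : Matrix (Fin n) (Fin n) ℝ) (S S' : Finset (Fin n)) (xhat : Fin n → Circle) : Prop :=
  ∃ (y y' : Fin n → Circle) (Qhat : ℂ ≃ₗᵢ[ℝ] ℂ),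
    IsRefinement A S (loc.toFun S (subMatrix A S)) y ∧
    IsRefinement A S' (loc'.toFun S' (subMatrix A S')) y' ∧
    (∀ Q : ℂ ≃ₗᵢ[ℝ] ℂ, mergeCost S S' y y' Qhat ≤ mergeCost S S' y y' Q) ∧
    ∀ j, xhat j = if j ∈ S then orthAct Qhat (y' j) else y j

end SpectralSeriation

end

open MeasureTheory ProbabilityTheory

open scoped Matrix

noncomputable section

namespace SpectralSeriation

/-! ### Geometry of the circle -/

/-! On a regular grid a geometric affinity gives a circulant matrix, and the plane of its
frequency-one eigenvectors (cos, sin) is the grid itself, embedded in the circle. The argument shows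
that this plane is spectrally isolated, that sampling and noise move it little, and that refinement
turns an average error into a uniform one. Write m = n/4 and η = √(log n / n).

Isolation. The lower bi-Lipschitz bound makes the symbol, up to an error ε_n, a nonnegative
combination of indicators of arcs with weights at least 2π c_l / m (`exists_arcSum_approx`). The
eigenvalues of an arc are values of a Dirichlet kernel. For every arc, frequency 0 dominates
frequency ±1, which dominates the others; for arcs of length between m/8 and m/4 both gaps have
order m. About m/16 arcs have such a length, so the total gap has order c_l m
(`circEig_arcSum_gaps`).

Localization. A uniform subset S contains nearly a quarter of each initial segment of labels
(`card_not_wellSpread_le`), so ranking S labels it by a grid of size m with error O(η). Hence the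
block of F is within O(nη) of a circulant matrix in operator norm, and a net of integer vectors
bounds the noise in the same way. Perturbation of the isolated plane gives an ℓ² bound
(`vanilla_close`) and then, by Cauchy–Schwarz, a total ℓ¹ error O(nη). Sorting and shifting preserve
this order: cut the circle at a good place and use that the sorted matching is optimal on the line
(`uniformApproximation_close`).

Refinement. The initial positions depend on A only through its block on S, hence are independent of
the noise between S and an outside point. Moving a candidate by a distance t from the truth
increases the mean criterion by about c_l m t², while noise and localization error contribute at
most t times O(nη). Dividing by t yields t = O(η) for every point (`refinement_close`).

Merging. The complement of S ∪ S' contains two points that are far from collinear, and an isometry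
of the plane is stably determined by its values at two such points (`merging_close`). Hence the two
refined halves can be aligned at the cost of a constant factor. -/

lemma geoDist_nonneg (x y : Circle) : 0 ≤ geoDist x y := InnerProductGeometry.angle_nonneg _ _

lemma geoDist_le_pi (x y : Circle) : geoDist x y ≤ Real.pi := InnerProductGeometry.angle_le_pi _ _

lemma geoDist_comm (x y : Circle) : geoDist x y = geoDist y x := InnerProductGeometry.angle_comm _ _

lemma geoDist_self (x : Circle) : geoDist x x = 0 := InnerProductGeometry.angle_self (by simp)

lemma geoDist_triangle (x y z : Circle) : geoDist x z ≤ geoDist x y + geoDist y z :=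
  InnerProductGeometry.angle_le_angle_add_angle _ _ _

lemma abs_geoDist_sub_le (x y z : Circle) : |geoDist x z - geoDist y z| ≤ geoDist x y := by
  rw [abs_le]
  constructor
  · linarith [geoDist_triangle y x z, geoDist_comm x y]
  · linarith [geoDist_triangle x y z]

@[simp] lemma coe_orthAct (Q : ℂ ≃ₗᵢ[ℝ] ℂ) (z : Circle) : (orthAct Q z : ℂ) = Q z := rfl

lemma geoDist_orthAct (Q : ℂ ≃ₗᵢ[ℝ] ℂ) (x y : Circle) :
    geoDist (orthAct Q x) (orthAct Q y) = geoDist x y :=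
  LinearIsometry.angle_map Q.toLinearIsometry _ _

lemma orthAct_orthAct (Q Q' : ℂ ≃ₗᵢ[ℝ] ℂ) (z : Circle) :
    orthAct Q (orthAct Q' z) = orthAct (Q'.trans Q) z := by
  ext; simp

lemma orthAct_orthAct_symm (Q : ℂ ≃ₗᵢ[ℝ] ℂ) (z : Circle) : orthAct Q (orthAct Q.symm z) = z := by
  ext; simp

lemma norm_sub_le_geoDist (x y : Circle) : ‖(x : ℂ) - y‖ ≤ geoDist x y :=
  Complex.norm_sub_le_angle (Circle.norm_coe x) (Circle.norm_coe y)

lemma geoDist_le_norm_sub (x y : Circle) : geoDist x y ≤ Real.pi / 2 * ‖(x : ℂ) - y‖ :=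
  Complex.angle_le_mul_norm_sub (Circle.norm_coe x) (Circle.norm_coe y)

lemma geoDist_le_two_mul_norm_sub (x y : Circle) : geoDist x y ≤ 2 * ‖(x : ℂ) - y‖ := by
  have := geoDist_le_norm_sub x y
  have := Real.pi_le_four
  nlinarith [norm_nonneg ((x : ℂ) - y)]

lemma geoDist_exp (a b : ℝ) :
    geoDist (Circle.exp a) (Circle.exp b) =
      |toIocMod Real.two_pi_pos (-Real.pi) (a - b)| := by
  simp only [geoDist, Circle.coe_exp]
  exact Complex.angle_exp_exp a b

lemma geoDist_exp_eq_abs {a b : ℝ} (h : |a - b| ≤ Real.pi) :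
    geoDist (Circle.exp a) (Circle.exp b) = |a - b| := by
  wlog hab : b ≤ a generalizing a b
  · rw [geoDist_comm, abs_sub_comm]
    exact this (by rwa [abs_sub_comm]) (le_of_not_ge hab)
  rw [geoDist_exp, (toIocMod_eq_self Real.two_pi_pos).2]
  rw [abs_of_nonneg (by linarith)] at h
  have := Real.pi_pos
  constructor <;> linarith

lemma circle_exp_add_two_pi_mul (a : ℝ) (k : ℤ) :
    Circle.exp (a + k * (2 * Real.pi)) = Circle.exp a := by
  rw [Circle.exp_eq_exp]
  exact ⟨k, rfl⟩

lemma exists_int_geoDist_exp (a b : ℝ) :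
    ∃ k : ℤ, geoDist (Circle.exp a) (Circle.exp b) = |a - b - k * (2 * Real.pi)| := by
  refine ⟨toIocDiv Real.two_pi_pos (-Real.pi) (a - b), ?_⟩
  rw [geoDist_exp, toIocMod, zsmul_eq_mul]

lemma geoDist_exp_le (a b : ℝ) : geoDist (Circle.exp a) (Circle.exp b) ≤ |a - b| := by
  by_cases h : |a - b| ≤ Real.pi
  · exact (geoDist_exp_eq_abs h).le
  · exact (geoDist_le_pi _ _).trans (le_of_not_ge h)

lemma l1Norm_le (w : ℂ) : l1Norm w ≤ 2 * ‖w‖ := by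
  unfold l1Norm
  linarith [Complex.abs_re_le_norm w, Complex.abs_im_le_norm w]

lemma norm_le_l1Norm (w : ℂ) : ‖w‖ ≤ l1Norm w := Complex.norm_le_abs_re_add_abs_im w

/-! ### The regular grid -/

lemma gridPoint_eq_exp_int (N k : ℕ) : gridPoint N k = Circle.exp (2 * Real.pi * (k : ℤ) / N) := by
  simp [gridPoint]

lemma circle_exp_int_add {N : ℕ} (hN : N ≠ 0) (k l : ℤ) :
    Circle.exp (2 * Real.pi * (k + N * l : ℤ) / N) = Circle.exp (2 * Real.pi * k / N) := by
  rw [← circle_exp_add_two_pi_mul (2 * Real.pi * k / N) l]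
  congr 1
  have : (N : ℝ) ≠ 0 := by exact_mod_cast hN
  push_cast
  field_simp

lemma circle_exp_int_eq_of_modEq {N : ℕ} (hN : N ≠ 0) {k l : ℤ} (h : (k : ZMod N) = l) :
    Circle.exp (2 * Real.pi * k / N) = Circle.exp (2 * Real.pi * l / N) := by
  rw [ZMod.intCast_eq_intCast_iff_dvd_sub] at h
  obtain ⟨c, hc⟩ := h
  have : l = k + N * c := by linarith
  rw [this, circle_exp_int_add hN]

lemma gridPoint_eq_of_cast {N : ℕ} (hN : N ≠ 0) {k l : ℕ} (h : (k : ZMod N) = l) :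
    gridPoint N k = gridPoint N l := by
  rw [gridPoint_eq_exp_int, gridPoint_eq_exp_int]
  exact circle_exp_int_eq_of_modEq hN (by exact_mod_cast h)

lemma gridPoint_mod {N : ℕ} (hN : N ≠ 0) (k : ℕ) : gridPoint N (k % N) = gridPoint N k :=
  gridPoint_eq_of_cast hN (by simp)

lemma gridPoint_mem_regularGrid {N : ℕ} (hN : N ≠ 0) (k : ℕ) : gridPoint N k ∈ regularGrid N :=
  ⟨⟨k % N, Nat.mod_lt _ (Nat.pos_of_ne_zero hN)⟩, gridPoint_mod hN k⟩

lemma geoDist_gridPoint_le {N M : ℕ} (k l : ℕ) :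
    geoDist (gridPoint N k) (gridPoint M l) ≤ 2 * Real.pi * |(k : ℝ) / N - l / M| := by
  refine (geoDist_exp_le _ _).trans_eq ?_
  rw [← abs_of_pos Real.two_pi_pos, ← abs_mul, abs_of_pos Real.two_pi_pos]
  congr 1; ring

/-- The grid indexed by `ZMod N`. -/
def gridZ (N : ℕ) (a : ZMod N) : Circle := gridPoint N a.val

lemma gridZ_intCast {N : ℕ} [NeZero N] (k : ℤ) :
    gridZ N (k : ZMod N) = Circle.exp (2 * Real.pi * k / N) := by
  rw [gridZ, gridPoint_eq_exp_int]
  exact circle_exp_int_eq_of_modEq (NeZero.ne N) (by simp)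

lemma gridZ_natCast {N : ℕ} [NeZero N] (k : ℕ) : gridZ N (k : ZMod N) = gridPoint N k := by
  rw [gridZ]
  exact gridPoint_eq_of_cast (NeZero.ne N) (by simp)

lemma gridZ_mem_regularGrid {N : ℕ} [NeZero N] (a : ZMod N) : gridZ N a ∈ regularGrid N :=
  gridPoint_mem_regularGrid (NeZero.ne N) _

lemma exists_gridZ_of_mem {N : ℕ} [NeZero N] {z : Circle} (h : z ∈ regularGrid N) :
    ∃ a : ZMod N, z = gridZ N a := by
  obtain ⟨k, rfl⟩ := h
  exact ⟨(k : ℕ), (gridZ_natCast _).symm⟩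

lemma gridZ_add {N : ℕ} [NeZero N] (a b : ZMod N) : gridZ N (a + b) = gridZ N a * gridZ N b := by
  obtain ⟨k, rfl⟩ := ZMod.intCast_surjective a
  obtain ⟨l, rfl⟩ := ZMod.intCast_surjective b
  rw [← Int.cast_add, gridZ_intCast, gridZ_intCast, gridZ_intCast, ← Circle.exp_add]
  congr 1; push_cast; ring

lemma gridZ_zero {N : ℕ} [NeZero N] : gridZ N 0 = 1 := by
  have := gridZ_natCast (N := N) 0
  simpa [gridPoint] using this

lemma gridZ_neg {N : ℕ} [NeZero N] (a : ZMod N) : gridZ N (-a) = (gridZ N a)⁻¹ := by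
  rw [eq_inv_iff_mul_eq_one, ← gridZ_add, neg_add_cancel, gridZ_zero]

lemma geoDist_mul_left (a x y : Circle) : geoDist (a * x) (a * y) = geoDist x y := by
  simp only [geoDist, Circle.coe_mul]
  exact Complex.angle_mul_left (by simp) _ _

/-- The distance between two grid points depends on the index difference only. -/
lemma geoDist_gridZ {N : ℕ} [NeZero N] (a b : ZMod N) :
    geoDist (gridZ N a) (gridZ N b) = 2 * Real.pi / N * (a - b).valMinAbs.natAbs := by
  have h1 : gridZ N a = gridZ N b * gridZ N (a - b) := by rw [← gridZ_add]; congr 1; ring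
  have h2 : gridZ N b = gridZ N b * gridZ N 0 := by rw [gridZ_zero, mul_one]
  rw [h1]
  conv_lhs => rw [h2]
  rw [mul_assoc, geoDist_mul_left, ← gridZ_add, zero_add]
  have hN : (0 : ℝ) < N := by exact_mod_cast Nat.pos_of_ne_zero (NeZero.ne N)
  set c := (a - b).valMinAbs with hc
  have h3 : a - b = (c : ZMod N) := (ZMod.coe_valMinAbs _).symm
  rw [h3, show (0 : ZMod N) = ((0 : ℤ) : ZMod N) by simp, gridZ_intCast, gridZ_intCast]
  have h4 : (c.natAbs : ℝ) ≤ N / 2 := by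
    have := ZMod.natAbs_valMinAbs_le (a - b)
    rw [← hc] at this
    have h5 : ((N / 2 : ℕ) : ℝ) ≤ N / 2 := by simpa using Nat.cast_div_le (α := ℝ) (m := N) (n := 2)
    exact le_trans (by exact_mod_cast this) h5
  have h6 : |2 * Real.pi * (c : ℝ) / N - 2 * Real.pi * ((0 : ℤ) : ℝ) / N| =
      2 * Real.pi / N * c.natAbs := by
    rw [Nat.cast_natAbs, Int.cast_abs, show 2 * Real.pi * (c : ℝ) / N -
      2 * Real.pi * ((0 : ℤ) : ℝ) / N = 2 * Real.pi / N * c by push_cast; ring, abs_mul,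
      abs_of_pos (by positivity)]
  rw [geoDist_exp_eq_abs, h6]
  rw [h6]
  calc 2 * Real.pi / N * c.natAbs ≤ 2 * Real.pi / N * (N / 2) := by gcongr
    _ = Real.pi := by field_simp

/-- Every point of the circle is within `π / N` of the grid. -/
lemma exists_gridZ_near {N : ℕ} [NeZero N] (z : Circle) :
    ∃ a : ZMod N, geoDist z (gridZ N a) ≤ Real.pi / N := by
  obtain ⟨t, rfl⟩ : ∃ t, Circle.exp t = z := ⟨_, Circle.exp_arg z⟩
  have hN : (0 : ℝ) < N := by exact_mod_cast Nat.pos_of_ne_zero (NeZero.ne N)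
  refine ⟨((round (t * N / (2 * Real.pi)) : ℤ) : ZMod N), ?_⟩
  rw [gridZ_intCast]
  refine (geoDist_exp_le _ _).trans ?_
  have h := abs_sub_round (t * N / (2 * Real.pi))
  set r : ℝ := ((round (t * N / (2 * Real.pi)) : ℤ) : ℝ)
  have : t - 2 * Real.pi * r / N = 2 * Real.pi / N * (t * N / (2 * Real.pi) - r) := by
    have := Real.pi_pos.ne'
    field_simp
  rw [this, abs_mul, abs_of_pos (by have := Real.pi_pos; positivity)]
  calc 2 * Real.pi / N * |t * N / (2 * Real.pi) - r| ≤ 2 * Real.pi / N * (1 / 2) := by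
        have := Real.pi_pos
        gcongr
    _ = Real.pi / N := by ring

lemma dInf_le {ι : Type*} [Nonempty ι] {x y : ι → Circle} {C : ℝ}
    (h : ∀ i, geoDist (x i) (y i) ≤ C) : dInf x y ≤ C := ciSup_le h

lemma geoDist_le_dInf {ι : Type*} (x y : ι → Circle) (i : ι) : geoDist (x i) (y i) ≤ dInf x y :=
  le_ciSup (f := fun i => geoDist (x i) (y i))
    ⟨Real.pi, by rintro _ ⟨j, rfl⟩; exact geoDist_le_pi _ _⟩ i

/-! ### Dirichlet kernels -/

/-- This is the monotonicity of sin(Nx)/sin x while Nx ≤ π/2, cross-multiplied so that no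
denominator has to be nonzero. The addition formula gives an induction on N, since sin and cos have
constant sign and monotonicity on this range. -/
lemma sin_nat_mul_mul_sin_le {α φ : ℝ} (hα : 0 ≤ α) (h : α ≤ φ) (hφ : φ ≤ Real.pi / 2) (N : ℕ)
    (hN : N * φ ≤ Real.pi / 2) :
    Real.sin (N * φ) * Real.sin α ≤ Real.sin (N * α) * Real.sin φ := by
  have hpi := Real.pi_pos
  induction N with
  | zero => simp
  | succ N ih =>
    push_cast at hN ⊢
    have hNφ : (N : ℝ) * φ ≤ Real.pi / 2 := by nlinarith
    have hNα : (N : ℝ) * α ≤ N * φ := by gcongr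
    have ih := ih hNφ
    have s1 : 0 ≤ Real.sin α := Real.sin_nonneg_of_nonneg_of_le_pi hα (by linarith)
    have s2 : 0 ≤ Real.sin φ := Real.sin_nonneg_of_nonneg_of_le_pi (by linarith) (by linarith)
    have s3 : 0 ≤ Real.sin (N * α) :=
      Real.sin_nonneg_of_nonneg_of_le_pi (by positivity) (by linarith)
    have c1 : Real.cos φ ≤ Real.cos α := Real.cos_le_cos_of_nonneg_of_le_pi hα (by linarith) h
    have c2 : Real.cos (N * φ) ≤ Real.cos (N * α) :=
      Real.cos_le_cos_of_nonneg_of_le_pi (by positivity) (by linarith) hNα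
    have c3 : 0 ≤ Real.cos φ := Real.cos_nonneg_of_neg_pi_div_two_le_of_le (by linarith) hφ
    rw [add_mul, add_mul, one_mul, one_mul, Real.sin_add, Real.sin_add]
    have e1 := mul_le_mul_of_nonneg_right ih c3
    have e2 := mul_le_mul_of_nonneg_right c1 (mul_nonneg s3 s2)
    have e3 := mul_le_mul_of_nonneg_right c2 (mul_nonneg s1 s2)
    linarith

/-- Beyond Nφ = π/2 monotonicity is lost, but |sin(Nφ)| ≤ 1 is enough. The range of φ is symmetric
under φ ↦ π - φ, which preserves both sides and reduces to φ ≤ π/2. -/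
lemma abs_sin_nat_mul_mul_sin_le {α φ : ℝ} (hα : 0 < α) (h : α ≤ φ) (h' : φ ≤ Real.pi - α) (N : ℕ)
    (hN : N * α ≤ Real.pi / 2) :
    |Real.sin (N * φ)| * Real.sin α ≤ Real.sin (N * α) * Real.sin φ := by
  have hpi := Real.pi_pos
  wlog hφ : φ ≤ Real.pi / 2 generalizing φ
  · have := this (φ := Real.pi - φ) (by linarith) (by linarith) (by linarith)
    rw [Real.sin_pi_sub, mul_sub, Real.sin_nat_mul_pi_sub] at this
    simpa [abs_mul, abs_pow] using this
  rcases Nat.eq_zero_or_pos N with rfl | hN0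
  · simp
  have hN1 : (1 : ℝ) ≤ N := by exact_mod_cast hN0
  have hNn : (N : ℝ) ≠ 0 := by positivity
  have s1 : 0 ≤ Real.sin α := Real.sin_nonneg_of_nonneg_of_le_pi hα.le (by linarith)
  by_cases hNφ : N * φ ≤ Real.pi / 2
  · rw [abs_of_nonneg (Real.sin_nonneg_of_nonneg_of_le_pi (by nlinarith) (by linarith))]
    exact sin_nat_mul_mul_sin_le hα.le h hφ N hNφ
  · push Not at hNφ
    -- At β the numerator sin(Nβ) equals 1, its largest value, so the monotone range up to β
    -- controls all larger angles through sin β ≤ sin φ.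
    set β := Real.pi / 2 / N with hβ
    have hNβ : N * β = Real.pi / 2 := by rw [hβ]; field_simp
    have hαβ : α ≤ β := by rw [hβ, le_div_iff₀ (by positivity)]; linarith
    have hβφ : β ≤ φ := by rw [hβ, div_le_iff₀ (by positivity)]; linarith
    have key := sin_nat_mul_mul_sin_le hα.le hαβ (hβφ.trans hφ) N hNβ.le
    rw [hNβ, Real.sin_pi_div_two, one_mul] at key
    have s3 : 0 ≤ Real.sin (N * α) :=
      Real.sin_nonneg_of_nonneg_of_le_pi (by positivity) (by linarith)
    have s4 : Real.sin β ≤ Real.sin φ :=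
      Real.sin_le_sin_of_le_of_le_pi_div_two (by linarith) hφ hβφ
    calc |Real.sin (N * φ)| * Real.sin α ≤ 1 * Real.sin α := by
          gcongr; exact Real.abs_sin_le_one _
      _ ≤ Real.sin (N * α) * Real.sin β := by linarith
      _ ≤ _ := by gcongr

lemma abs_sin_nat_mul_le (x : ℝ) (N : ℕ) : |Real.sin (N * x)| ≤ N * |Real.sin x| := by
  induction N with
  | zero => simp
  | succ N ih =>
    push_cast
    rw [add_mul, add_mul, one_mul, one_mul, Real.sin_add]
    refine (abs_add_le _ _).trans ?_
    rw [abs_mul, abs_mul]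
    have h1 := mul_le_mul_of_nonneg_left (Real.abs_cos_le_one x) (abs_nonneg (Real.sin (N * x)))
    have h2 := mul_le_mul_of_nonneg_right (Real.abs_cos_le_one (N * x)) (abs_nonneg (Real.sin x))
    linarith

/-! ### Discrete Fourier analysis on `ZMod m` -/

variable {m : ℕ}

/-- `cos (2 π x / m)` for `x` in `ZMod m`. -/
def cosZ (x : ZMod m) : ℝ := (gridZ m x : ℂ).re

/-- `sin (2 π x / m)` for `x` in `ZMod m`. -/
def sinZ (x : ZMod m) : ℝ := (gridZ m x : ℂ).im

lemma cosZ_eq [NeZero m] (x : ZMod m) : cosZ x = Real.cos (2 * Real.pi * x.val / m) := by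
  simp only [cosZ, gridZ, gridPoint, Circle.coe_exp, Complex.exp_ofReal_mul_I_re]

lemma cosZ_natCast [NeZero m] (x : ℕ) :
    cosZ (x : ZMod m) = Real.cos (2 * Real.pi * x / m) := by
  simp only [cosZ, gridZ_natCast, gridPoint, Circle.coe_exp, Complex.exp_ofReal_mul_I_re]

lemma cosZ_zero [NeZero m] : cosZ (0 : ZMod m) = 1 := by simp [cosZ, gridZ_zero]
lemma sinZ_zero [NeZero m] : sinZ (0 : ZMod m) = 0 := by simp [sinZ, gridZ_zero]

lemma cosZ_le_one [NeZero m] (x : ZMod m) : cosZ x ≤ 1 := by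
  rw [cosZ_eq]; exact Real.cos_le_one _

lemma cosZ_neg [NeZero m] (x : ZMod m) : cosZ (-x) = cosZ x := by
  simp [cosZ, gridZ_neg]

lemma sinZ_neg [NeZero m] (x : ZMod m) : sinZ (-x) = - sinZ x := by
  simp [sinZ, gridZ_neg]

lemma cosZ_add [NeZero m] (x y : ZMod m) : cosZ (x + y) = cosZ x * cosZ y - sinZ x * sinZ y := by
  simp [cosZ, sinZ, gridZ_add]

lemma sinZ_add [NeZero m] (x y : ZMod m) : sinZ (x + y) = cosZ x * sinZ y + sinZ x * cosZ y := by
  simp [cosZ, sinZ, gridZ_add]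

lemma cosZ_sub [NeZero m] (x y : ZMod m) : cosZ (x - y) = cosZ x * cosZ y + sinZ x * sinZ y := by
  rw [sub_eq_add_neg, cosZ_add, cosZ_neg, sinZ_neg]; ring

lemma sinZ_sub [NeZero m] (x y : ZMod m) : sinZ (x - y) = sinZ x * cosZ y - cosZ x * sinZ y := by
  rw [sub_eq_add_neg, sinZ_add, cosZ_neg, sinZ_neg]; ring

lemma cosZ_sq_add_sinZ_sq [NeZero m] (x : ZMod m) : cosZ x ^ 2 + sinZ x ^ 2 = 1 := by
  have := cosZ_sub x x
  rw [sub_self, cosZ_zero] at this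
  linarith

lemma gridZ_ne_one [NeZero m] {d : ZMod m} (hd : d ≠ 0) : gridZ m d ≠ 1 := by
  intro h
  have h1 := geoDist_gridZ d 0
  rw [gridZ_zero, h, geoDist_self, sub_zero] at h1
  have hm : (0 : ℝ) < m := by exact_mod_cast Nat.pos_of_ne_zero (NeZero.ne m)
  have := Real.pi_pos
  rcases mul_eq_zero.1 h1.symm with h2 | h2
  · have : (0 : ℝ) < 2 * Real.pi / m := by positivity
    linarith
  · have : d.valMinAbs.natAbs = 0 := by exact_mod_cast h2
    rw [Int.natAbs_eq_zero, ZMod.valMinAbs_eq_zero] at this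
    exact hd this

/-- Translating k by 1 multiplies the sum by the root of unity `gridZ m d`, which differs from 1. -/
lemma sum_gridZ_mul [NeZero m] {d : ZMod m} (hd : d ≠ 0) : ∑ k : ZMod m, (gridZ m (k * d) : ℂ) = 0 := by
  have h : ∑ k : ZMod m, (gridZ m (k * d) : ℂ) = gridZ m d * ∑ k : ZMod m, (gridZ m (k * d) : ℂ) := by
    conv_lhs => rw [← Equiv.sum_comp (Equiv.addRight (1 : ZMod m))]
    rw [Finset.mul_sum]
    refine Finset.sum_congr rfl fun k _ => ?_
    rw [← Circle.coe_mul, ← gridZ_add]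
    congr 2
    simp; ring
  have h2 : (1 - (gridZ m d : ℂ)) * ∑ k : ZMod m, (gridZ m (k * d) : ℂ) = 0 := by
    rw [sub_mul, one_mul, ← h, sub_self]
  rcases mul_eq_zero.1 h2 with h3 | h3
  · exact absurd (Circle.ext (sub_eq_zero.1 h3).symm) (gridZ_ne_one hd)
  · exact h3

lemma sum_cosZ_mul [NeZero m] (d : ZMod m) :
    ∑ k : ZMod m, cosZ (k * d) = if d = 0 then (m : ℝ) else 0 := by
  split_ifs with hd
  · simp [hd, cosZ_zero, ZMod.card]
  · have := congrArg Complex.re (sum_gridZ_mul hd)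
    simpa [cosZ] using this

lemma sum_sinZ_mul [NeZero m] (d : ZMod m) : ∑ k : ZMod m, sinZ (k * d) = 0 := by
  by_cases hd : d = 0
  · simp [hd, sinZ_zero]
  · have := congrArg Complex.im (sum_gridZ_mul hd)
    simpa [sinZ] using this

/-- The eigenvalue of the circulant matrix with symbol `γ` at the frequency `k`. -/
def circEig [NeZero m] (γ : ZMod m → ℝ) (k : ZMod m) : ℝ := ∑ j, γ j * cosZ (k * j)

/-- Evenness of γ allows cosines alone: the product formula produces spikes at j = d and at j = -d,
where γ takes the same value. -/
lemma fourier_inversion [NeZero m] {γ : ZMod m → ℝ} (hγ : ∀ j, γ (-j) = γ j) (d : ZMod m) :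
    ∑ k, circEig γ k * cosZ (k * d) = m * γ d := by
  have h1 : ∀ k j : ZMod m, cosZ (k * j) * cosZ (k * d) =
      (cosZ (k * (j + d)) + cosZ (k * (j - d))) / 2 := by
    intro k j
    rw [mul_add, mul_sub, cosZ_add, cosZ_sub]; ring
  calc ∑ k, circEig γ k * cosZ (k * d)
      = ∑ k : ZMod m, ∑ j, γ j * ((cosZ (k * (j + d)) + cosZ (k * (j - d))) / 2) := by
        refine Finset.sum_congr rfl fun k _ => ?_
        rw [circEig, Finset.sum_mul]
        refine Finset.sum_congr rfl fun j _ => ?_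
        rw [mul_assoc, h1]
    _ = ∑ j, γ j * (((if j + d = 0 then (m : ℝ) else 0) + if j - d = 0 then (m : ℝ) else 0) / 2) := by
        rw [Finset.sum_comm]
        refine Finset.sum_congr rfl fun j _ => ?_
        rw [← Finset.mul_sum, ← Finset.sum_div, Finset.sum_add_distrib, sum_cosZ_mul, sum_cosZ_mul]
    _ = m * γ d := by
        simp only [add_eq_zero_iff_eq_neg, sub_eq_zero, add_div, mul_add, ite_div, zero_div, mul_ite,
          mul_zero, Finset.sum_add_distrib, Finset.sum_ite_eq', Finset.mem_univ, if_true, hγ]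
        ring

/-- The squared modulus of the Fourier coefficient of `u` at the frequency `k`. -/
def fourierSq [NeZero m] (u : ZMod m → ℝ) (k : ZMod m) : ℝ :=
  (∑ a, cosZ (k * a) * u a) ^ 2 + (∑ a, sinZ (k * a) * u a) ^ 2

lemma fourierSq_nonneg [NeZero m] (u : ZMod m → ℝ) (k : ZMod m) : 0 ≤ fourierSq u k := by
  unfold fourierSq; positivity

/-- The real Fourier basis diagonalizes circulant forms. Bounds on eigenvalues thus become bounds on
quadratic forms, term by term over the frequencies. -/
lemma circulant_quadratic [NeZero m] {γ : ZMod m → ℝ} (hγ : ∀ j, γ (-j) = γ j) (u : ZMod m → ℝ) :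
    ∑ k, circEig γ k * fourierSq u k = m * ∑ a, ∑ b, γ (a - b) * u a * u b := by
  have h1 : ∀ k, fourierSq u k = ∑ a, ∑ b, cosZ (k * (a - b)) * u a * u b := by
    intro k
    rw [fourierSq, sq, sq, Finset.sum_mul_sum, Finset.sum_mul_sum, ← Finset.sum_add_distrib]
    refine Finset.sum_congr rfl fun a _ => ?_
    rw [← Finset.sum_add_distrib]
    refine Finset.sum_congr rfl fun b _ => ?_
    rw [mul_sub, cosZ_sub]; ring
  simp_rw [h1, Finset.mul_sum]
  rw [Finset.sum_comm]
  refine Finset.sum_congr rfl fun a _ => ?_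
  rw [Finset.sum_comm]
  refine Finset.sum_congr rfl fun b _ => ?_
  rw [← mul_assoc, ← mul_assoc, ← fourier_inversion hγ, Finset.sum_mul, Finset.sum_mul]
  refine Finset.sum_congr rfl fun k _ => ?_
  ring

/-- Parseval's identity is the case of the identity matrix, whose symbol is the point mass at 0. -/
lemma sum_fourierSq [NeZero m] (u : ZMod m → ℝ) : ∑ k, fourierSq u k = m * ∑ a, u a ^ 2 := by
  have h := circulant_quadratic (γ := fun j : ZMod m => if j = 0 then 1 else 0)
    (by simp) u
  have h1 : ∀ k : ZMod m, circEig (fun j : ZMod m => if j = 0 then 1 else 0) k = 1 := by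
    intro k; simp [circEig, cosZ_zero]
  simp only [h1, one_mul] at h
  rw [h]
  congr 1
  refine Finset.sum_congr rfl fun a _ => ?_
  simp [sub_eq_zero, sq]

/-- The sine coefficient of an even symbol vanishes, so the cosine and the sine are separately
eigenvectors for the same eigenvalue. -/
lemma sum_circulant_cosZ [NeZero m] {γ : ZMod m → ℝ} (hγ : ∀ j, γ (-j) = γ j) (a : ZMod m) :
    ∑ b, γ (a - b) * cosZ b = circEig γ 1 * cosZ a := by
  have hs : ∑ j, γ j * sinZ j = 0 := by
    have : ∑ j, γ j * sinZ j = ∑ j, γ (-j) * sinZ (-j) :=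
      (Equiv.sum_comp (Equiv.neg (ZMod m)) fun j => γ j * sinZ j).symm
    simp only [hγ, sinZ_neg, mul_neg, Finset.sum_neg_distrib] at this
    linarith
  rw [← Equiv.sum_comp (Equiv.subLeft a)]
  simp only [Equiv.subLeft_apply, sub_sub_cancel, cosZ_sub, circEig, one_mul]
  calc ∑ j, γ j * (cosZ a * cosZ j + sinZ a * sinZ j)
      = cosZ a * ∑ j, γ j * cosZ j + sinZ a * ∑ j, γ j * sinZ j := by
        rw [Finset.mul_sum, Finset.mul_sum, ← Finset.sum_add_distrib]
        exact Finset.sum_congr rfl fun j _ => by ring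
    _ = _ := by rw [hs]; ring

lemma sum_circulant_sinZ [NeZero m] {γ : ZMod m → ℝ} (hγ : ∀ j, γ (-j) = γ j) (a : ZMod m) :
    ∑ b, γ (a - b) * sinZ b = circEig γ 1 * sinZ a := by
  have hs : ∑ j, γ j * sinZ j = 0 := by
    have : ∑ j, γ j * sinZ j = ∑ j, γ (-j) * sinZ (-j) :=
      (Equiv.sum_comp (Equiv.neg (ZMod m)) fun j => γ j * sinZ j).symm
    simp only [hγ, sinZ_neg, mul_neg, Finset.sum_neg_distrib] at this
    linarith
  rw [← Equiv.sum_comp (Equiv.subLeft a)]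
  simp only [Equiv.subLeft_apply, sub_sub_cancel, sinZ_sub, circEig, one_mul]
  calc ∑ j, γ j * (sinZ a * cosZ j - cosZ a * sinZ j)
      = sinZ a * ∑ j, γ j * cosZ j - cosZ a * ∑ j, γ j * sinZ j := by
        rw [Finset.mul_sum, Finset.mul_sum, ← Finset.sum_sub_distrib]
        exact Finset.sum_congr rfl fun j _ => by ring
    _ = _ := by rw [hs]; ring

lemma sum_circulant_one [NeZero m] (γ : ZMod m → ℝ) (a : ZMod m) :
    ∑ b, γ (a - b) = circEig γ 0 := by
  rw [← Equiv.sum_comp (Equiv.subLeft a)]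
  simp [circEig, cosZ_zero]

/-! ### Eigenvalues of arcs -/

/-- The indicator function of the arc of radius `r`. -/
def arcInd (r : ℕ) (j : ZMod m) : ℝ := if j.valMinAbs.natAbs ≤ r then 1 else 0

lemma natAbs_valMinAbs_eq_iff [NeZero m] {s : ℕ} (hs : 2 * s < m) (j : ZMod m) :
    j.valMinAbs.natAbs = s ↔ j = s ∨ j = -s := by
  constructor
  · intro h
    rcases Int.natAbs_eq j.valMinAbs with h1 | h1
    · left; rw [← ZMod.coe_valMinAbs j, h1, h]; simp
    · right; rw [← ZMod.coe_valMinAbs j, h1, h]; simp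
  · have h2 : ((s : ℕ) : ZMod m).valMinAbs.natAbs = s := by
      rw [ZMod.valMinAbs_natCast_of_le_half (by omega)]; simp
    rintro (rfl | rfl)
    · exact h2
    · rw [ZMod.natAbs_valMinAbs_neg, h2]

lemma circEig_arcInd_succ [NeZero m] {r : ℕ} (hr : 2 * (r + 1) < m) (k : ZMod m) :
    circEig (arcInd (r + 1)) k = circEig (arcInd r) k + 2 * cosZ (k * ((r + 1 : ℕ) : ZMod m)) := by
  have h1 : ∀ j : ZMod m, arcInd (r + 1) j = arcInd r j +
      ((if j = (r + 1 : ℕ) then 1 else 0) + if j = -((r + 1 : ℕ) : ZMod m) then 1 else 0) := by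
    intro j
    have h2 := natAbs_valMinAbs_eq_iff hr j
    have h3 : ((r + 1 : ℕ) : ZMod m) ≠ -((r + 1 : ℕ) : ZMod m) := by
      intro h
      have h5 : ((2 * (r + 1) : ℕ) : ZMod m) = 0 := by
        push_cast at h ⊢; linear_combination h
      rw [ZMod.natCast_eq_zero_iff] at h5
      exact absurd (Nat.le_of_dvd (by omega) h5) (by omega)
    unfold arcInd
    by_cases h4 : j.valMinAbs.natAbs = r + 1
    · rw [if_pos (by omega), if_neg (by omega)]
      rcases h2.1 h4 with h | h
      · rw [if_pos h, if_neg (by rw [h]; exact h3)]; norm_num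
      · rw [if_pos h, if_neg (by rw [h]; exact h3.symm)]; norm_num
    · rw [h2, not_or] at h4
      rw [if_neg h4.1, if_neg h4.2]
      rw [← not_or, ← h2] at h4
      · simp only [add_zero]
        split_ifs <;> first | rfl | omega
  simp only [circEig, h1, add_mul, Finset.sum_add_distrib, ite_mul, one_mul, zero_mul,
    Finset.sum_ite_eq', Finset.mem_univ, if_true, mul_neg, cosZ_neg]
  ring

lemma circEig_arcInd_zero [NeZero m] (k : ZMod m) : circEig (arcInd 0) k = 1 := by
  simp [circEig, arcInd, cosZ_zero]

/-- Closed form of the Dirichlet kernel by telescoping: enlarging the radius adds the two points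
±(r+1), and 2 sin φ cos(2(r+1)φ) is the difference of consecutive right-hand sides. -/
lemma sin_mul_circEig_arcInd [NeZero m] {r : ℕ} (hr : 2 * r < m) (k : ZMod m) :
    Real.sin (Real.pi * k.val / m) * circEig (arcInd r) k =
      Real.sin ((2 * r + 1 : ℕ) * (Real.pi * k.val / m)) := by
  induction r with
  | zero => simp [circEig_arcInd_zero]
  | succ r ih =>
    rw [circEig_arcInd_succ hr, mul_add, ih (by omega)]
    have : k * ((r + 1 : ℕ) : ZMod m) = ((k.val * (r + 1) : ℕ) : ZMod m) := by simp
    rw [this, cosZ_natCast]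
    set φ := Real.pi * k.val / m with hφ
    have h1 : 2 * Real.pi * (k.val * (r + 1) : ℕ) / m = 2 * (r + 1) * φ := by
      rw [hφ]; push_cast; ring
    rw [h1]
    have h2 : ((2 * (r + 1) + 1 : ℕ) : ℝ) * φ = 2 * (r + 1) * φ + φ := by push_cast; ring
    have h3 : ((2 * r + 1 : ℕ) : ℝ) * φ = 2 * (r + 1) * φ - φ := by push_cast; ring
    rw [h2, h3, Real.sin_add, Real.sin_sub]; ring

lemma circEig_arcInd_zero_freq [NeZero m] {r : ℕ} (hr : 2 * r < m) :
    circEig (arcInd r) (0 : ZMod m) = 2 * r + 1 := by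
  induction r with
  | zero => simp [circEig_arcInd_zero]
  | succ r ih => rw [circEig_arcInd_succ hr, ih (by omega), zero_mul, cosZ_zero]; push_cast; ring

/-- The largest arc is the whole group. It is treated apart because for even m it escapes the
condition 2r < m of the closed form. -/
lemma circEig_arcInd_half [NeZero m] {k : ZMod m} (hk : k ≠ 0) :
    circEig (arcInd (m / 2)) k = 0 := by
  have h : ∀ j : ZMod m, arcInd (m / 2) j = 1 := fun j => if_pos (ZMod.natAbs_valMinAbs_le j)
  simp only [circEig, h, one_mul, mul_comm k, sum_cosZ_mul, if_neg hk]

lemma circEig_arcInd_le_zero_freq [NeZero m] (r : ℕ) (k : ZMod m) :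
    circEig (arcInd r) k ≤ circEig (arcInd r) (0 : ZMod m) := by
  refine Finset.sum_le_sum fun j _ => ?_
  rw [zero_mul, cosZ_zero]
  have : 0 ≤ arcInd r j := by unfold arcInd; split_ifs <;> norm_num
  exact mul_le_mul_of_nonneg_left (cosZ_le_one _) this

lemma val_one_of_two_le [NeZero m] (hm : 2 ≤ m) : (1 : ZMod m).val = 1 := by
  have : Fact (1 < m) := ⟨hm⟩
  exact ZMod.val_one m

lemma sin_pi_mul_val_div_pos [NeZero m] {k : ZMod m} (hk : k ≠ 0) :
    0 < Real.sin (Real.pi * k.val / m) := by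
  have hm : (0 : ℝ) < m := by exact_mod_cast Nat.pos_of_ne_zero (NeZero.ne m)
  have h1 : (0 : ℝ) < k.val := by
    exact_mod_cast Nat.pos_of_ne_zero (by rwa [Ne, ZMod.val_eq_zero])
  have h2 : (k.val : ℝ) < m := by exact_mod_cast ZMod.val_lt k
  have := Real.pi_pos
  apply Real.sin_pos_of_pos_of_lt_pi
  · positivity
  · rw [div_lt_iff₀ hm]; gcongr

/-- Among the nonzero frequencies, the first one maximizes the Dirichlet kernel. -/
lemma circEig_arcInd_le [NeZero m] (hm : 2 ≤ m) {r : ℕ} (hr : 2 * r < m) {k : ZMod m} (hk : k ≠ 0) :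
    circEig (arcInd r) k ≤ circEig (arcInd r) (1 : ZMod m) := by
  have : Fact (1 < m) := ⟨hm⟩
  have hm0 : (0 : ℝ) < m := by exact_mod_cast (by omega : 0 < m)
  have hpi := Real.pi_pos
  have e1 := sin_mul_circEig_arcInd hr k
  have e2 := sin_mul_circEig_arcInd hr (1 : ZMod m)
  have p1 := sin_pi_mul_val_div_pos hk
  have p2 := sin_pi_mul_val_div_pos (one_ne_zero : (1 : ZMod m) ≠ 0)
  rw [val_one_of_two_le hm, Nat.cast_one, mul_one] at e2 p2
  set θ := Real.pi / m with hθ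
  set φ := Real.pi * k.val / m with hφ
  have hθ0 : 0 < θ := by positivity
  have hmθ : m * θ = Real.pi := by rw [hθ]; field_simp
  have hmφ : m * φ = k.val * Real.pi := by rw [hφ]; field_simp
  have hφθ : φ = k.val * θ := by rw [hφ, hθ]; ring
  have hk1 : (1 : ℝ) ≤ k.val := by
    exact_mod_cast Nat.pos_of_ne_zero (by rwa [Ne, ZMod.val_eq_zero])
  have hk2 : (k.val : ℝ) + 1 ≤ m := by exact_mod_cast ZMod.val_lt k
  have h1 : θ ≤ φ := by rw [hφθ]; nlinarith
  have h2 : φ ≤ Real.pi - θ := by rw [hφθ, ← hmθ]; nlinarith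
  have key : |Real.sin ((2 * r + 1 : ℕ) * φ)| * Real.sin θ ≤
      Real.sin ((2 * r + 1 : ℕ) * θ) * Real.sin φ := by
    by_cases hN : (2 * r + 1 : ℕ) * θ ≤ Real.pi / 2
    · exact abs_sin_nat_mul_mul_sin_le hθ0 h1 h2 _ hN
    -- A long arc is replaced by its complement, with N' = m - (2r+1) points. Since mθ and mφ are
    -- multiples of π, this leaves the absolute values of the sines unchanged and brings N'θ below
    -- π/2.
    · obtain ⟨N', hN'⟩ : ∃ N', m = (2 * r + 1) + N' := ⟨m - (2 * r + 1), by omega⟩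
      have hN'' : (m : ℝ) = (2 * r + 1 : ℕ) + N' := by exact_mod_cast hN'
      have a1 : ((2 * r + 1 : ℕ) : ℝ) * θ = Real.pi - N' * θ := by rw [← hmθ, hN'']; ring
      have a2 : ((2 * r + 1 : ℕ) : ℝ) * φ = k.val * Real.pi - N' * φ := by
        rw [← hmφ, hN'']; ring
      rw [a1, a2, Real.sin_pi_sub, Real.sin_nat_mul_pi_sub]
      have := abs_sin_nat_mul_mul_sin_le hθ0 h1 h2 N' (by linarith)
      simpa [abs_mul, abs_pow] using this
  have h3 := le_abs_self (Real.sin ((2 * r + 1 : ℕ) * φ))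
  rw [← e1, ← e2] at key
  rw [← e1] at h3
  have h4 := (mul_le_mul_of_nonneg_right ((le_abs_self _)) p2.le).trans key
  have h5 : 0 < Real.sin φ * Real.sin θ := mul_pos p1 p2
  by_contra hcon
  push Not at hcon
  nlinarith [mul_lt_mul_of_pos_left hcon h5]

lemma cos_sub_cos_ge {x y : ℝ} (hy : |y| ≤ Real.pi) :
    2 / Real.pi ^ 2 * y ^ 2 - x ^ 2 / 2 ≤ Real.cos x - Real.cos y := by
  have h1 := Real.one_sub_sq_div_two_le_cos (x := x)
  have h2 := Real.cos_le_one_sub_mul_cos_sq hy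
  linarith

/-- The spectral gap of an arc of moderate length, between the first frequency and the next. -/
lemma circEig_arcInd_gap [NeZero m] (hm : 100 ≤ m) {r : ℕ} (hr1 : m ≤ 8 * (2 * r + 1))
    (hr2 : 4 * (2 * r + 1) ≤ m) {k : ZMod m} (hk : k ≠ 0) (hk1 : k ≠ 1) (hk2 : k ≠ -1) :
    circEig (arcInd r) k + m / 1000 ≤ circEig (arcInd r) (1 : ZMod m) := by
  have : Fact (1 < m) := ⟨by omega⟩
  have hm0 : (100 : ℝ) ≤ m := by exact_mod_cast hm
  have hpi := Real.pi_pos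
  have hpi3 := Real.pi_gt_three
  have hpi4 := Real.pi_le_four
  have hmono := circEig_arcInd_le (r := r) (by omega) (by omega) hk
  have e1 := sin_mul_circEig_arcInd (r := r) (by omega) k
  have e2 := sin_mul_circEig_arcInd (r := r) (by omega) (1 : ZMod m)
  have p1 := sin_pi_mul_val_div_pos hk
  have p2 := sin_pi_mul_val_div_pos (one_ne_zero : (1 : ZMod m) ≠ 0)
  rw [val_one_of_two_le (by omega), Nat.cast_one, mul_one] at e2 p2
  have hNR1 : (m : ℝ) ≤ 8 * (2 * r + 1 : ℕ) := by exact_mod_cast hr1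
  have hNR2 : 4 * ((2 * r + 1 : ℕ) : ℝ) ≤ m := by exact_mod_cast hr2
  set N := 2 * r + 1 with hN
  set θ := Real.pi / m with hθ
  set φ := Real.pi * k.val / m with hφ
  have hθ0 : 0 < θ := by positivity
  have hmθ : m * θ = Real.pi := by rw [hθ]; field_simp
  have hφθ : φ = k.val * θ := by rw [hφ, hθ]; ring
  have hθsmall : θ ≤ 4 / 100 := by
    rw [hθ]; exact div_le_div₀ (by norm_num) hpi4 (by norm_num) hm0
  have hv0 : k.val ≠ 0 := by rwa [Ne, ZMod.val_eq_zero]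
  have hv1 : k.val ≠ 1 := fun h => hk1 (by rw [← ZMod.natCast_zmod_val k, h, Nat.cast_one])
  have hvm : k.val + 1 ≠ m := fun h => hk2 (by
    rw [eq_neg_iff_add_eq_zero, ← ZMod.natCast_zmod_val k, ← Nat.cast_one, ← Nat.cast_add, h,
      ZMod.natCast_self])
  have hvlt := ZMod.val_lt k
  have hkR1 : (2 : ℝ) ≤ k.val := by exact_mod_cast (by omega : 2 ≤ k.val)
  have hkR2 : (k.val : ℝ) + 2 ≤ m := by exact_mod_cast (by omega : k.val + 2 ≤ m)
  have h1 : 2 * θ ≤ φ := by rw [hφθ]; nlinarith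
  have h2 : φ ≤ Real.pi - 2 * θ := by rw [hφθ, ← hmθ]; nlinarith
  have hNθ1 : Real.pi / 8 ≤ N * θ := by rw [← hmθ]; nlinarith
  have hNθ2 : N * θ ≤ Real.pi / 4 := by rw [← hmθ]; nlinarith
  -- Excluding the frequencies 0 and ±1 leaves φ in [2θ, π - 2θ], so the comparison applies with α =
  -- 2θ, and 4N ≤ m gives 2Nθ ≤ π/2. The double-angle formulas then yield D cos θ ≤ D1 cos(Nθ),
  -- where cos θ - cos(Nθ) is bounded below.
  have key := abs_sin_nat_mul_mul_sin_le (by positivity) h1 h2 N (by linarith)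
  have h3 := (mul_le_mul_of_nonneg_right (le_abs_self (Real.sin (N * φ)))
    (Real.sin_nonneg_of_nonneg_of_le_pi (by linarith : 0 ≤ 2 * θ) (by linarith))).trans key
  rw [← e1, show (N : ℝ) * (2 * θ) = 2 * (N * θ) by ring, Real.sin_two_mul, Real.sin_two_mul,
    ← e2] at h3
  set D := circEig (arcInd r) k
  set D1 := circEig (arcInd r) (1 : ZMod m)
  have h4 : D * Real.cos θ ≤ D1 * Real.cos (N * θ) := by
    have h5 : (0 : ℝ) < 2 * Real.sin φ * Real.sin θ := by positivity
    refine le_of_mul_le_mul_left ?_ h5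
    linarith
  have hD1 : m / (4 * Real.pi) ≤ D1 := by
    have h5 : 1 / 4 ≤ Real.sin (N * θ) := by
      have h6 := Real.mul_le_sin (x := N * θ) (by positivity) (by linarith)
      have h7 : 2 / Real.pi * (Real.pi / 8) ≤ 2 / Real.pi * (N * θ) := by gcongr
      have h8 : 2 / Real.pi * (Real.pi / 8) = 1 / 4 := by field_simp; norm_num
      linarith
    have h9 : Real.sin θ ≤ θ := Real.sin_le hθ0.le
    have h10 : 0 < D1 := by
      by_contra hc
      push Not at hc
      nlinarith
    have h11 : 1 / 4 ≤ θ * D1 := by nlinarith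
    rw [div_le_iff₀ (by positivity)]
    have : (m : ℝ) * (1 / 4) ≤ m * (θ * D1) := by gcongr
    rw [← mul_assoc, hmθ] at this
    linarith
  have hc : 1 / 64 ≤ Real.cos θ - Real.cos (N * θ) := by
    have h5 := cos_sub_cos_ge (x := θ) (y := N * θ) (by rw [abs_of_nonneg (by positivity)]; linarith)
    have h6 : 2 / Real.pi ^ 2 * (Real.pi / 8) ^ 2 ≤ 2 / Real.pi ^ 2 * (N * θ) ^ 2 := by gcongr
    have h7 : 2 / Real.pi ^ 2 * (Real.pi / 8) ^ 2 = 1 / 32 := by field_simp; norm_num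
    have h8 : θ ^ 2 ≤ (4 / 100) ^ 2 := by gcongr
    linarith
  have h5 : (D1 - D) * Real.cos θ ≤ D1 - D :=
    mul_le_of_le_one_right (by linarith) (Real.cos_le_one θ)
  have h6 : (m : ℝ) / 1000 ≤ m / (4 * Real.pi) * (1 / 64) := by
    have h9 : 4 * Real.pi * 64 ≤ 1000 := by linarith [Real.pi_lt_d2]
    rw [div_mul_div_comm, mul_one]
    gcongr
  have h7 : m / (4 * Real.pi) * (1 / 64) ≤ D1 * (Real.cos θ - Real.cos (N * θ)) := by
    gcongr
    exact le_trans (by positivity) hD1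
  rw [mul_sub] at h7
  rw [sub_mul] at h5
  linarith

/-- The spectral gap of an arc of moderate length, between the constants and the first frequency. -/
lemma circEig_arcInd_gap_zero [NeZero m] (hm : 100 ≤ m) {r : ℕ} (hr1 : m ≤ 8 * (2 * r + 1))
    (hr2 : 4 * (2 * r + 1) ≤ m) :
    circEig (arcInd r) (1 : ZMod m) + m / 2048 ≤ circEig (arcInd r) (0 : ZMod m) := by
  have : Fact (1 < m) := ⟨by omega⟩
  have hm0 : (100 : ℝ) ≤ m := by exact_mod_cast hm
  have hpi := Real.pi_pos
  have hpi4 := Real.pi_le_four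
  have hmono := circEig_arcInd_le_zero_freq r (1 : ZMod m)
  have e2 := sin_mul_circEig_arcInd (r := r) (by omega) (1 : ZMod m)
  have p2 := sin_pi_mul_val_div_pos (one_ne_zero : (1 : ZMod m) ≠ 0)
  rw [val_one_of_two_le (by omega), Nat.cast_one, mul_one] at e2 p2
  have e0 : circEig (arcInd r) (0 : ZMod m) = (2 * r + 1 : ℕ) := by
    rw [circEig_arcInd_zero_freq (by omega)]; push_cast; ring
  have hNR1 : (m : ℝ) ≤ 8 * (2 * r + 1 : ℕ) := by exact_mod_cast hr1
  have hNR2 : 4 * ((2 * r + 1 : ℕ) : ℝ) ≤ m := by exact_mod_cast hr2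
  rw [e0] at hmono ⊢
  set N := 2 * r + 1 with hN
  set θ := Real.pi / m with hθ
  have hθ0 : 0 < θ := by positivity
  have hmθ : m * θ = Real.pi := by rw [hθ]; field_simp
  have hθsmall : θ ≤ 4 / 100 := by
    rw [hθ]; exact div_le_div₀ (by norm_num) hpi4 (by norm_num) hm0
  have hNθ1 : Real.pi / 8 ≤ N * θ := by rw [← hmθ]; nlinarith
  have hNθ2 : N * θ ≤ Real.pi / 4 := by rw [← hmθ]; nlinarith
  set D1 := circEig (arcInd r) (1 : ZMod m)
  have s0 : 0 < Real.sin (θ / 2) := Real.sin_pos_of_pos_of_lt_pi (by positivity) (by linarith [Real.pi_gt_three])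
  -- Halving the angles gives sin(Nθ) = 2 sin(Nθ/2) cos(Nθ/2) ≤ 2N sin(θ/2) cos(Nθ/2). The retained
  -- factor cos(Nθ/2) is what separates D1 from N.
  have h4 : D1 * Real.cos (θ / 2) ≤ N * Real.cos (N * (θ / 2)) := by
    have h5 := abs_sin_nat_mul_le (θ / 2) N
    have h6 : 0 ≤ Real.cos (N * (θ / 2)) :=
      Real.cos_nonneg_of_neg_pi_div_two_le_of_le (by nlinarith) (by nlinarith)
    have h7 : θ = 2 * (θ / 2) := by ring
    have h8 : N * θ = 2 * (N * (θ / 2)) := by ring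
    rw [h8, Real.sin_two_mul] at e2
    rw [show Real.sin θ = 2 * Real.sin (θ / 2) * Real.cos (θ / 2) by
      rw [← Real.sin_two_mul, ← h7]] at e2
    rw [abs_of_pos s0] at h5
    have h9 := mul_le_mul_of_nonneg_right ((le_abs_self _).trans h5) h6
    refine le_of_mul_le_mul_left ?_ s0
    linarith
  have hc : 1 / 256 ≤ Real.cos (θ / 2) - Real.cos (N * (θ / 2)) := by
    have h5 := cos_sub_cos_ge (x := θ / 2) (y := N * (θ / 2))
      (by rw [abs_of_nonneg (by positivity)]; linarith)
    have h6 : 2 / Real.pi ^ 2 * (Real.pi / 16) ^ 2 ≤ 2 / Real.pi ^ 2 * (N * (θ / 2)) ^ 2 := by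
      gcongr; linarith
    have h7 : 2 / Real.pi ^ 2 * (Real.pi / 16) ^ 2 = 1 / 128 := by field_simp; norm_num
    nlinarith
  have h5 : (N - D1) * Real.cos (θ / 2) ≤ N - D1 :=
    mul_le_of_le_one_right (by linarith) (Real.cos_le_one _)
  have h7 : (N : ℝ) * (1 / 256) ≤ N * (Real.cos (θ / 2) - Real.cos (N * (θ / 2))) := by
    gcongr
  nlinarith

/-! ### Circulant matrices with a decreasing symbol -/

/-- The nonnegative combination of indicator functions of arcs with weights `w`. -/
def arcSum (m : ℕ) (w : ℕ → ℝ) (j : ZMod m) : ℝ :=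
  ∑ r ∈ Finset.range (m / 2 + 1), w r * arcInd r j

lemma arcSum_neg [NeZero m] (w : ℕ → ℝ) (j : ZMod m) : arcSum m w (-j) = arcSum m w j := by
  simp only [arcSum, arcInd, ZMod.natAbs_valMinAbs_neg]

lemma circEig_arcSum [NeZero m] (w : ℕ → ℝ) (k : ZMod m) :
    circEig (arcSum m w) k = ∑ r ∈ Finset.range (m / 2 + 1), w r * circEig (arcInd r) k := by
  simp only [circEig, arcSum, Finset.sum_mul, Finset.mul_sum]
  rw [Finset.sum_comm]
  simp only [mul_assoc]

lemma sum_range_ge_of_block {R a b : ℕ} (hb : b ≤ R) {g : ℕ → ℝ} {x : ℝ}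
    (h0 : ∀ r < R, 0 ≤ g r) (hx : ∀ r, a ≤ r → r < b → x ≤ g r) :
    ((b - a : ℕ) : ℝ) * x ≤ ∑ r ∈ Finset.range R, g r := by
  calc ((b - a : ℕ) : ℝ) * x = ∑ r ∈ Finset.Ico a b, x := by simp
    _ ≤ ∑ r ∈ Finset.Ico a b, g r :=
        Finset.sum_le_sum fun r hr => hx r (Finset.mem_Ico.1 hr).1 (Finset.mem_Ico.1 hr).2
    _ ≤ ∑ r ∈ Finset.range R, g r := by
        refine Finset.sum_le_sum_of_subset_of_nonneg ?_ ?_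
        · intro r hr
          simp only [Finset.mem_Ico, Finset.mem_range] at hr ⊢
          omega
        · intro r hr _
          exact h0 r (Finset.mem_range.1 hr)

/-- Every arc contributes a nonnegative difference, so it suffices to keep the radii in [m/16 + 1,
m/8), whose lengths are between m/8 and m/4. There are at least m/36 of them, each with weight at
least 2πc/m and gap at least my, and 2π/36 ≥ 1/6. -/
lemma arcSum_gap_aux [NeZero m] (hm : 100 ≤ m) {c y : ℝ} (hc : 0 ≤ c) (hy : 0 ≤ y) {w : ℕ → ℝ}
    (hw : ∀ r < m / 2, c * (2 * Real.pi / m) ≤ w r) (hw' : 0 ≤ w (m / 2)) {k l : ZMod m}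
    (h0 : ∀ r ≤ m / 2, circEig (arcInd r) k ≤ circEig (arcInd r) l)
    (h1 : ∀ r, m ≤ 8 * (2 * r + 1) → 4 * (2 * r + 1) ≤ m →
      circEig (arcInd r) k + m * y ≤ circEig (arcInd r) l) :
    circEig (arcSum m w) k + c * m * (y / 6) ≤ circEig (arcSum m w) l := by
  have hm0 : (0 : ℝ) < m := by exact_mod_cast (by omega : 0 < m)
  have hpi := Real.pi_gt_three
  have hκ : 0 ≤ c * (2 * Real.pi / m) := by positivity
  rw [circEig_arcSum, circEig_arcSum, Finset.sum_range_succ, Finset.sum_range_succ]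
  have h2 := mul_le_mul_of_nonneg_left (h0 (m / 2) le_rfl) hw'
  have h3 := sum_range_ge_of_block (R := m / 2) (a := m / 16 + 1) (b := m / 8) (by omega)
    (g := fun r => w r * circEig (arcInd r) l - w r * circEig (arcInd r) k)
    (x := c * (2 * Real.pi / m) * (m * y))
    (fun r hr => by
      rw [← mul_sub]
      exact mul_nonneg (hκ.trans (hw r hr)) (sub_nonneg.2 (h0 r hr.le)))
    (fun r hr hr' => by
      rw [← mul_sub]
      have := h1 r (by omega) (by omega)
      exact mul_le_mul (hw r (by omega)) (by linarith) (by positivity)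
        (hκ.trans (hw r (by omega))))
  rw [Finset.sum_sub_distrib] at h3
  have h4 : (m : ℝ) / 36 ≤ ((m / 8 - (m / 16 + 1) : ℕ) : ℝ) := by
    rw [div_le_iff₀ (by norm_num)]
    exact_mod_cast (by omega : m ≤ (m / 8 - (m / 16 + 1)) * 36)
  have h5 : c * (2 * Real.pi / m) * (m * y) = c * y * (2 * Real.pi) := by field_simp
  rw [h5] at h3
  have h6 : (m : ℝ) / 36 * (c * y * (2 * 3)) ≤
      ((m / 8 - (m / 16 + 1) : ℕ) : ℝ) * (c * y * (2 * Real.pi)) := by gcongr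
  linarith

/-- The three eigenvalue comparisons for circulant matrices with a decreasing symbol. -/
theorem circEig_arcSum_gaps [NeZero m] (hm : 100 ≤ m) {c : ℝ} (hc : 0 ≤ c) {w : ℕ → ℝ}
    (hw : ∀ r < m / 2, c * (2 * Real.pi / m) ≤ w r) (hw' : 0 ≤ w (m / 2)) :
    (∀ k : ZMod m, k ≠ 0 → circEig (arcSum m w) k ≤ circEig (arcSum m w) 1) ∧
    (∀ k : ZMod m, k ≠ 0 → k ≠ 1 → k ≠ -1 →
      circEig (arcSum m w) k + c * m / 20000 ≤ circEig (arcSum m w) 1) ∧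
    circEig (arcSum m w) 1 + c * m / 20000 ≤ circEig (arcSum m w) 0 := by
  have : Fact (1 < m) := ⟨by omega⟩
  have hcm : 0 ≤ c * m := by positivity
  have hle : ∀ k : ZMod m, k ≠ 0 → ∀ r ≤ m / 2,
      circEig (arcInd r) k ≤ circEig (arcInd r) (1 : ZMod m) := by
    intro k hk r hr
    rcases lt_or_ge (2 * r) m with h | h
    · exact circEig_arcInd_le (by omega) h hk
    · have : r = m / 2 := by omega
      rw [this, circEig_arcInd_half hk, circEig_arcInd_half one_ne_zero]
  refine ⟨fun k hk => ?_, fun k hk hk1 hk2 => ?_, ?_⟩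
  · rw [circEig_arcSum, circEig_arcSum]
    refine Finset.sum_le_sum fun r hr => mul_le_mul_of_nonneg_left
      (hle k hk r (by rw [Finset.mem_range] at hr; omega)) ?_
    rcases Nat.lt_or_ge r (m / 2) with h | h
    · exact le_trans (by have := Real.pi_pos; positivity) (hw r h)
    · have : r = m / 2 := by rw [Finset.mem_range] at hr; omega
      rw [this]; exact hw'
  · have := arcSum_gap_aux hm hc (by norm_num : (0 : ℝ) ≤ 1 / 1000) hw hw' (hle k hk)
      (fun r h1 h2 => by
        have := circEig_arcInd_gap hm h1 h2 hk hk1 hk2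
        linarith)
    linarith
  · have := arcSum_gap_aux hm hc (by norm_num : (0 : ℝ) ≤ 1 / 2048) hw hw'
      (k := 1) (l := 0) (fun r _ => circEig_arcInd_le_zero_freq r 1)
      (fun r h1 h2 => by
        have := circEig_arcInd_gap_zero hm h1 h2
        linarith)
    linarith

/-! ### Approximation of a geometric bi-Lipschitz function by a decreasing symbol -/

lemma sum_range_telescope_of_le (T : ℕ → ℝ) {c K : ℕ} (h : c ≤ K) :
    ∑ r ∈ Finset.range K, (if c ≤ r then T r - T (r + 1) else 0) = T c - T K := by
  induction K, h using Nat.le_induction with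
  | base =>
    rw [sub_self]
    exact Finset.sum_eq_zero fun r hr => if_neg (by rw [Finset.mem_range] at hr; omega)
  | succ K hK ih => rw [Finset.sum_range_succ, ih, if_pos hK]; ring

/-- The values on the grid of a geometric bi-Lipschitz function are approximated by a nonnegative
combination of arcs, with weights bounded below. -/
theorem exists_arcSum_approx {n : ℕ} {cl cL ce : ℝ} {f : Circle → Circle → ℝ}
    (hf : BiLipschitz n cl cL ce f) (hg : IsGeometric f) {m : ℕ} [NeZero m] :
    ∃ w : ℕ → ℝ, (∀ r < m / 2, cl * (2 * Real.pi / m) ≤ w r) ∧ 0 ≤ w (m / 2) ∧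
      ∀ a b : ZMod m, |f (gridZ m a) (gridZ m b) - arcSum m w (a - b)| ≤
        ce * √(Real.log n / n) := by
  obtain ⟨g, hg⟩ := hg
  set ε := ce * √(Real.log n / n) with hε
  set R := m / 2 with hR
  set κ := cl * (2 * Real.pi / m) with hκ
  have hm : (0 : ℝ) < m := by exact_mod_cast Nat.pos_of_ne_zero (NeZero.ne m)
  set gv : ℕ → ℝ := fun r => g (2 * Real.pi / m * r) with hgv
  -- By the lower bi-Lipschitz bound, g decreases at slope at least c_l up to ε. After compensating
  -- that slope, h is nonincreasing up to ε.
  set h : ℕ → ℝ := fun r => gv r + κ * r with hh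
  have hd : ∀ r ≤ R, geoDist 1 (gridPoint m r) = 2 * Real.pi / m * r := by
    intro r hr
    rw [← gridZ_natCast, ← gridZ_zero (N := m), geoDist_gridZ, zero_sub, ZMod.natAbs_valMinAbs_neg,
      ZMod.valMinAbs_natCast_of_le_half (by omega)]
    simp
  have hgf : ∀ r ≤ R, gv r = f 1 (gridPoint m r) := by
    intro r hr
    rw [hg, hd r hr]
  have hmon : ∀ c t, c ≤ t → t ≤ R → h t ≤ h c + ε := by
    intro c t hct ht
    have h1 := hf.lower 1 (gridPoint m t) (gridPoint m c) (by
      rw [hd t ht, hd c (hct.trans ht)]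
      have := Real.pi_pos
      gcongr)
    rw [hd t ht, hd c (hct.trans ht), ← hgf t ht, ← hgf c (hct.trans ht), ← hε] at h1
    simp only [hh, hκ]
    linarith
  have hne : (Finset.range (R + 1)).Nonempty := ⟨0, by simp⟩
  -- For c ≤ R this is the supremum of h over [c, R], the least nonincreasing majorant; it lies
  -- between h and h + ε.
  set H : ℕ → ℝ := fun c => (Finset.range (R + 1)).sup' hne fun r => h (max c r) with hH
  have hH1 : ∀ c, h c ≤ H c := by
    intro c
    have := Finset.le_sup' (s := Finset.range (R + 1)) (fun r => h (max c r))
      (show 0 ∈ Finset.range (R + 1) by simp)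
    simpa using this
  have hH2 : ∀ c ≤ R, H c ≤ h c + ε := by
    intro c hc
    refine Finset.sup'_le _ _ fun r hr => hmon _ _ (le_max_left _ _) ?_
    rw [Finset.mem_range] at hr
    omega
  have hH3 : ∀ c < R, H (c + 1) ≤ H c := by
    intro c hc
    refine Finset.sup'_le _ _ fun r hr => ?_
    rw [Finset.mem_range] at hr
    have := Finset.le_sup' (s := Finset.range (R + 1)) (fun r => h (max c r))
      (show max (c + 1) r ∈ Finset.range (R + 1) by rw [Finset.mem_range]; omega)
    rwa [show max c (max (c + 1) r) = max (c + 1) r by omega] at this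
  have hHR : H R = h R := by
    refine le_antisymm (Finset.sup'_le _ _ fun r hr => ?_) (hH1 R)
    rw [Finset.mem_range] at hr
    rw [max_eq_left (by omega)]
  set T : ℕ → ℝ := fun r => H r - κ * r with hT
  -- Layer-cake weights: T = H - κr drops by at least κ at each step. The last weight T R equals g
  -- at the largest radius, which is nonnegative because f ≥ 0.
  set w : ℕ → ℝ := fun r => if r < R then T r - T (r + 1) else T R with hw
  refine ⟨w, fun r hr => ?_, ?_, fun a b => ?_⟩
  · simp only [hw, if_pos hr, hT]
    have := hH3 r hr
    push_cast
    linarith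
  · simp only [hw, lt_irrefl, if_false, hT, hHR, hh]
    have := (hf.mem_Icc 1 (gridPoint m R)).1
    rw [← hgf R le_rfl] at this
    linarith
  · set c := (a - b).valMinAbs.natAbs with hc
    have hcR : c ≤ R := ZMod.natAbs_valMinAbs_le _
    have e1 : f (gridZ m a) (gridZ m b) = gv c := by rw [hg, geoDist_gridZ]
    have e2 : arcSum m w (a - b) = T c := by
      rw [arcSum, Finset.sum_range_succ]
      have : ∀ r ∈ Finset.range (m / 2), w r * arcInd r (a - b) =
          if c ≤ r then T r - T (r + 1) else 0 := by
        intro r hr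
        rw [Finset.mem_range] at hr
        simp only [hw, arcInd, ← hc, if_pos (show r < R from hr), mul_ite, mul_one, mul_zero]
      rw [Finset.sum_congr rfl this, sum_range_telescope_of_le T hcR]
      simp only [hw, arcInd, ← hc, ← hR, if_pos hcR, lt_irrefl, if_false]
      ring
    rw [e1, e2, abs_le]
    have h1 := hH1 c
    have h2 := hH2 c hcR
    simp only [hh, hT] at *
    constructor <;> linarith

/-! ### Variational bounds for the eigenvalues -/

section Eigen

variable {ι : Type*} [Fintype ι] [DecidableEq ι]

/-- Spectral decomposition with sorted eigenvalues, in terms of dot products. -/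
lemma exists_sorted_eigenbasis {M : Matrix ι ι ℝ} (hM : M.IsSymm) :
    ∃ e : Fin (Fintype.card ι) → ι → ℝ,
      (∀ k l, e k ⬝ᵥ e l = if k = l then 1 else 0) ∧
      (∀ v, v ⬝ᵥ v = ∑ k, (e k ⬝ᵥ v) ^ 2) ∧
      (∀ v, v ⬝ᵥ M *ᵥ v = ∑ k : Fin (Fintype.card ι), nthEigenvalue M k * (e k ⬝ᵥ v) ^ 2) ∧
      ∀ k l : Fin (Fintype.card ι), k ≤ l → nthEigenvalue M l ≤ nthEigenvalue M k := by
  have hH : M.IsHermitian := by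
    rw [Matrix.IsHermitian, Matrix.conjTranspose_eq_transpose_of_trivial]; exact hM
  have hev : ∀ k : Fin (Fintype.card ι), nthEigenvalue M k = hH.eigenvalues₀ k := by
    intro k
    rw [nthEigenvalue, dif_pos ⟨hH, k.2⟩]
  set φ : Fin (Fintype.card ι) ≃ ι := Fintype.equivOfCardEq (Fintype.card_fin _) with hφ
  set b := hH.eigenvectorBasis with hb
  have hdot : ∀ v w : EuclideanSpace ℝ ι, inner ℝ v w = v.ofLp ⬝ᵥ w.ofLp := by
    intro v w
    rw [EuclideanSpace.inner_eq_star_dotProduct, dotProduct_comm]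
    simp
  have hpars : ∀ v w : ι → ℝ, v ⬝ᵥ w = ∑ k, ((b (φ k)).ofLp ⬝ᵥ v) * ((b (φ k)).ofLp ⬝ᵥ w) := by
    intro v w
    have := b.sum_inner_mul_inner (WithLp.toLp 2 v) (WithLp.toLp 2 w)
    simp only [hdot] at this
    rw [← this, ← Equiv.sum_comp φ]
    refine Finset.sum_congr rfl fun k _ => ?_
    rw [dotProduct_comm v]
  refine ⟨fun k => (b (φ k)).ofLp, fun k l => ?_, fun v => ?_, fun v => ?_, fun k l hkl => ?_⟩
  · rw [← hdot, orthonormal_iff_ite.1 b.orthonormal]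
    simp
  · rw [hpars]; simp only [sq]
  · rw [hpars]
    refine Finset.sum_congr rfl fun k _ => ?_
    have h1 := hH.mulVec_eigenvectorBasis (φ k)
    rw [Matrix.dotProduct_mulVec, ← Matrix.mulVec_transpose, hM.eq, h1, smul_dotProduct, hev,
      Matrix.IsHermitian.eigenvalues, Equiv.symm_apply_apply]
    simp only [smul_eq_mul]
    ring
  · rw [hev, hev]; exact hH.eigenvalues₀_antitone hkl

/-- If the quadratic form is at least `t` on the span of three independent vectors, then the third
largest eigenvalue is at least `t`. -/
lemma le_nthEigenvalue_two {M : Matrix ι ι ℝ} (hM : M.IsSymm) (hcard : 3 ≤ Fintype.card ι)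
    (V : Fin 3 → ι → ℝ) {t : ℝ}
    (hpos : ∀ p : Fin 3 → ℝ, p ≠ 0 → 0 < (∑ i, p i • V i) ⬝ᵥ (∑ i, p i • V i))
    (h : ∀ p : Fin 3 → ℝ, t * ((∑ i, p i • V i) ⬝ᵥ (∑ i, p i • V i)) ≤
      (∑ i, p i • V i) ⬝ᵥ M *ᵥ (∑ i, p i • V i)) : t ≤ nthEigenvalue M 2 := by
  obtain ⟨e, -, h2, h3, h4⟩ := exists_sorted_eigenbasis hM
  -- Orthogonality to the two leading eigenvectors imposes two linear conditions on three
  -- coefficients, so some nonzero combination only sees the eigenvalues from the third on.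
  let L : (Fin 3 → ℝ) →ₗ[ℝ] (Fin 2 → ℝ) :=
    LinearMap.pi fun k : Fin 2 => ∑ i : Fin 3,
      (e ⟨k, by omega⟩ ⬝ᵥ V i) • LinearMap.proj i
  have hker : LinearMap.ker L ≠ ⊥ := LinearMap.ker_ne_bot_of_finrank_lt (by simp)
  obtain ⟨p, hp, hp0⟩ := Submodule.exists_mem_ne_zero_of_ne_bot hker
  set v := ∑ i, p i • V i with hv
  have hev : ∀ k : Fin (Fintype.card ι), (k : ℕ) < 2 → e k ⬝ᵥ v = 0 := by
    intro k hk
    have := congrFun (LinearMap.mem_ker.1 hp) ⟨k, hk⟩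
    simp only [L, LinearMap.pi_apply, LinearMap.sum_apply, LinearMap.smul_apply,
      LinearMap.proj_apply, smul_eq_mul, Pi.zero_apply] at this
    rw [hv, dotProduct_sum]
    simp only [dotProduct_smul, smul_eq_mul]
    rw [← this]
    exact Finset.sum_congr rfl fun i _ => mul_comm _ _
  have hvv := hpos p hp0
  have h5 := h p
  rw [← hv] at hvv h5
  have h6 : v ⬝ᵥ M *ᵥ v ≤ nthEigenvalue M 2 * (v ⬝ᵥ v) := by
    rw [h3, h2, Finset.mul_sum]
    refine Finset.sum_le_sum fun k _ => ?_
    by_cases hk : (k : ℕ) < 2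
    · simp [hev k hk]
    · exact mul_le_mul_of_nonneg_right (h4 ⟨2, by omega⟩ k (by
        rw [Fin.le_def]; simp; omega)) (sq_nonneg _)
  exact le_of_mul_le_mul_right (h5.trans h6) hvv

/-- If the quadratic form is at most `t` on a hyperplane, then the second largest eigenvalue is at
most `t`. -/
lemma nthEigenvalue_one_le {M : Matrix ι ι ℝ} (hM : M.IsSymm) (hcard : 2 ≤ Fintype.card ι)
    (o : ι → ℝ) {t : ℝ} (h : ∀ v : ι → ℝ, o ⬝ᵥ v = 0 → v ⬝ᵥ M *ᵥ v ≤ t * (v ⬝ᵥ v)) :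
    nthEigenvalue M 1 ≤ t := by
  obtain ⟨e, h1, h2, h3, h4⟩ := exists_sorted_eigenbasis hM
  set k0 : Fin (Fintype.card ι) := ⟨0, by omega⟩ with hk0
  set k1 : Fin (Fintype.card ι) := ⟨1, by omega⟩ with hk1
  have h01 : k0 ≠ k1 := by simp [hk0, hk1]
  -- Conversely, the span of the two leading eigenvectors meets every hyperplane in a nonzero
  -- vector, on which the form is at least the second eigenvalue.
  obtain ⟨x, y, hxy, hne⟩ : ∃ x y : ℝ, x * (o ⬝ᵥ e k0) + y * (o ⬝ᵥ e k1) = 0 ∧ 0 < x ^ 2 + y ^ 2 := by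
    by_cases hz : o ⬝ᵥ e k0 = 0
    · exact ⟨1, 0, by simp [hz], by norm_num⟩
    · exact ⟨o ⬝ᵥ e k1, -(o ⬝ᵥ e k0), by ring,
        add_pos_of_nonneg_of_pos (sq_nonneg _) (by rw [neg_sq]; positivity)⟩
  set v := x • e k0 + y • e k1 with hv
  have hek : ∀ k, e k ⬝ᵥ v = x * (if k = k0 then 1 else 0) + y * (if k = k1 then 1 else 0) := by
    intro k
    rw [hv, dotProduct_add, dotProduct_smul, dotProduct_smul, h1, h1, smul_eq_mul, smul_eq_mul]
  have hov : o ⬝ᵥ v = 0 := by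
    rw [hv, dotProduct_add, dotProduct_smul, dotProduct_smul, smul_eq_mul, smul_eq_mul, hxy]
  have hsum : ∀ a : Fin (Fintype.card ι) → ℝ, ∑ k, a k * (e k ⬝ᵥ v) ^ 2 =
      a k0 * x ^ 2 + a k1 * y ^ 2 := by
    intro a
    have : ∀ k, a k * (e k ⬝ᵥ v) ^ 2 =
        (if k = k0 then a k * x ^ 2 else 0) + (if k = k1 then a k * y ^ 2 else 0) := by
      intro k
      rw [hek]
      by_cases hA : k = k0
      · have hB : k ≠ k1 := hA ▸ h01
        simp [hA, h01]
      · simp [hA]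
    simp [this, Finset.sum_add_distrib]
  have h5 := h v hov
  have h6 : v ⬝ᵥ v = x ^ 2 + y ^ 2 := by
    rw [h2]
    have := hsum fun _ => 1
    simpa using this
  rw [h3, hsum fun k => nthEigenvalue M k, h6] at h5
  have h7 := h4 k0 k1 (by simp [hk0, hk1, Fin.le_def])
  have h8 : nthEigenvalue M k1 * (x ^ 2 + y ^ 2) ≤ t * (x ^ 2 + y ^ 2) := by
    nlinarith [mul_le_mul_of_nonneg_right h7 (sq_nonneg x)]
  exact le_of_mul_le_mul_right h8 hne

lemma nthEigenvalue_two_le_one {M : Matrix ι ι ℝ} (hM : M.IsSymm) (hcard : 3 ≤ Fintype.card ι) :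
    nthEigenvalue M 2 ≤ nthEigenvalue M 1 := by
  obtain ⟨e, -, -, -, h4⟩ := exists_sorted_eigenbasis hM
  exact h4 ⟨1, by omega⟩ ⟨2, by omega⟩ (by simp [Fin.le_def])

end Eigen

/-! ### Perturbation of an invariant plane -/

section Perturbation

variable {ι : Type*} [Fintype ι]

lemma dotProduct_self_nonneg' (v : ι → ℝ) : 0 ≤ v ⬝ᵥ v :=
  Finset.sum_nonneg fun i _ => mul_self_nonneg (v i)

lemma dotProduct_sq_le (u v : ι → ℝ) : (u ⬝ᵥ v) ^ 2 ≤ (u ⬝ᵥ u) * (v ⬝ᵥ v) := by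
  have := Finset.sum_mul_sq_le_sq_mul_sq Finset.univ u v
  simpa only [dotProduct, sq] using this

/-- The matrix `Γ` leaves the line of `o` and the plane of `c` and `s` invariant, with spectral gap
`g` around the eigenvalue `μ` of the plane. -/
structure HasPlaneGap (Γ : Matrix ι ι ℝ) (o c s : ι → ℝ) (ν μ g : ℝ) : Prop where
  symm : Γ.IsSymm
  eig_o : Γ *ᵥ o = ν • o
  eig_c : Γ *ᵥ c = μ • c
  eig_s : Γ *ᵥ s = μ • s
  o_pos : 0 < o ⬝ᵥ o
  c_pos : 0 < c ⬝ᵥ c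
  norm_s : s ⬝ᵥ s = c ⬝ᵥ c
  oc : o ⬝ᵥ c = 0
  os : o ⬝ᵥ s = 0
  cs : c ⬝ᵥ s = 0
  g_pos : 0 < g
  gap_o : μ + g ≤ ν
  form_le : ∀ v, o ⬝ᵥ v = 0 → v ⬝ᵥ Γ *ᵥ v ≤ μ * (v ⬝ᵥ v)
  form_gap : ∀ v, o ⬝ᵥ v = 0 → c ⬝ᵥ v = 0 → s ⬝ᵥ v = 0 → v ⬝ᵥ Γ *ᵥ v ≤ (μ - g) * (v ⬝ᵥ v)

/-- A bound `ρ` for the operator norm, in bilinear form. -/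
def OpBound (W : Matrix ι ι ℝ) (ρ : ℝ) : Prop :=
  ∀ u v : ι → ℝ, |u ⬝ᵥ W *ᵥ v| ≤ ρ * (√(u ⬝ᵥ u) * √(v ⬝ᵥ v))

variable {Γ M : Matrix ι ι ℝ} {o c s : ι → ℝ} {ν μ g ρ : ℝ}

lemma OpBound.form (hW : OpBound (M - Γ) ρ) (v : ι → ℝ) :
    |v ⬝ᵥ M *ᵥ v - v ⬝ᵥ Γ *ᵥ v| ≤ ρ * (v ⬝ᵥ v) := by
  have := hW v v
  rwa [Matrix.sub_mulVec, dotProduct_sub, Real.mul_self_sqrt (dotProduct_self_nonneg' v)] at this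

lemma dotProduct_mulVec_symm {Γ : Matrix ι ι ℝ} (h : Γ.IsSymm) (u v : ι → ℝ) :
    u ⬝ᵥ Γ *ᵥ v = (Γ *ᵥ u) ⬝ᵥ v := by
  rw [Matrix.dotProduct_mulVec, ← Matrix.mulVec_transpose, h.eq]

/-- Weyl's inequality for the two relevant eigenvalues. The test space spanned by o, c, s gives the
lower bound because ν ≥ μ there, and the hyperplane orthogonal to o gives the upper bound. -/
lemma HasPlaneGap.eigenvalue_bounds [DecidableEq ι] (hΓ : HasPlaneGap Γ o c s ν μ g)
    (hM : M.IsSymm) (hcard : 3 ≤ Fintype.card ι) (hW : OpBound (M - Γ) ρ) :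
    μ - ρ ≤ nthEigenvalue M 2 ∧ nthEigenvalue M 1 ≤ μ + ρ := by
  constructor
  · have hv' : ∀ p : Fin 3 → ℝ, ∑ i, p i • ![o, c, s] i = p 0 • o + p 1 • c + p 2 • s := by
      intro p; rw [Fin.sum_univ_three]; rfl
    have hvv : ∀ p : Fin 3 → ℝ, (p 0 • o + p 1 • c + p 2 • s) ⬝ᵥ (p 0 • o + p 1 • c + p 2 • s) =
        p 0 ^ 2 * (o ⬝ᵥ o) + p 1 ^ 2 * (c ⬝ᵥ c) + p 2 ^ 2 * (c ⬝ᵥ c) := by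
      intro p
      simp only [add_dotProduct, dotProduct_add, smul_dotProduct, dotProduct_smul, smul_eq_mul,
        dotProduct_comm c o, dotProduct_comm s o, dotProduct_comm s c, hΓ.oc, hΓ.os, hΓ.cs,
        hΓ.norm_s]
      ring
    refine le_nthEigenvalue_two hM hcard ![o, c, s] (fun p => ?_) (fun p => ?_)
    all_goals rw [hv' p, hvv p]
    · intro hp
      have h1 := hΓ.o_pos
      have h2 := hΓ.c_pos
      by_contra hcon
      have a0 : 0 ≤ p 0 ^ 2 * (o ⬝ᵥ o) := by positivity
      have a1 : 0 ≤ p 1 ^ 2 * (c ⬝ᵥ c) := by positivity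
      have a2 : 0 ≤ p 2 ^ 2 * (c ⬝ᵥ c) := by positivity
      have b0 : p 0 ^ 2 * (o ⬝ᵥ o) = 0 := by linarith
      have b1 : p 1 ^ 2 * (c ⬝ᵥ c) = 0 := by linarith
      have b2 : p 2 ^ 2 * (c ⬝ᵥ c) = 0 := by linarith
      apply hp
      ext i
      fin_cases i
      · simpa [h1.ne'] using b0
      · simpa [h2.ne'] using b1
      · simpa [h2.ne'] using b2
    · have hform := hW.form (p 0 • o + p 1 • c + p 2 • s)
      have hΓv : (p 0 • o + p 1 • c + p 2 • s) ⬝ᵥ Γ *ᵥ (p 0 • o + p 1 • c + p 2 • s) = ν * (p 0 ^ 2 * (o ⬝ᵥ o)) +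
          μ * (p 1 ^ 2 * (c ⬝ᵥ c) + p 2 ^ 2 * (c ⬝ᵥ c)) := by
        simp only [Matrix.mulVec_add, Matrix.mulVec_smul, hΓ.eig_o, hΓ.eig_c, hΓ.eig_s,
          add_dotProduct, dotProduct_add, smul_dotProduct, dotProduct_smul, smul_eq_mul,
          dotProduct_comm c o, dotProduct_comm s o, dotProduct_comm s c, hΓ.oc, hΓ.os, hΓ.cs,
          hΓ.norm_s]
        ring
      have h1 : μ * (p 0 ^ 2 * (o ⬝ᵥ o)) ≤ ν * (p 0 ^ 2 * (o ⬝ᵥ o)) := by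
        have := hΓ.gap_o
        have := hΓ.g_pos
        have := hΓ.o_pos
        gcongr
        linarith
      rw [abs_le, hΓv, hvv] at hform
      linarith [hform.1]
  · refine nthEigenvalue_one_le hM (by omega) o fun v hv => ?_
    have h1 := hΓ.form_le v hv
    have h2 := (abs_le.1 (hW.form v)).2
    linarith

/-- Eigenvectors of `M`, for an eigenvalue close to that of the plane, are close to the plane. -/
lemma HasPlaneGap.residual_le (hΓ : HasPlaneGap Γ o c s ν μ g) (hW : OpBound (M - Γ) ρ)
    (hρ : 4 * ρ ≤ g) (hρ0 : 0 ≤ ρ) {u : ι → ℝ} {l : ℝ} (hu : M *ᵥ u = l • u) (hu1 : u ⬝ᵥ u = 1)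
    (hl1 : μ - ρ ≤ l) (hl2 : l ≤ μ + ρ) :
    ∃ (α β : ℝ) (r : ι → ℝ), u = α • c + β • s + r ∧ c ⬝ᵥ r = 0 ∧ s ⬝ᵥ r = 0 ∧
      r ⬝ᵥ r ≤ 4 * (ρ / g) ^ 2 := by
  have hA := hΓ.o_pos
  have hB := hΓ.c_pos
  have hg := hΓ.g_pos
  set α := (c ⬝ᵥ u) / (c ⬝ᵥ c) with hα
  set β := (s ⬝ᵥ u) / (c ⬝ᵥ c) with hβ
  set a := (o ⬝ᵥ u) / (o ⬝ᵥ o) with ha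
  have hcu : c ⬝ᵥ u = α * (c ⬝ᵥ c) := by rw [hα]; field_simp
  have hsu : s ⬝ᵥ u = β * (c ⬝ᵥ c) := by rw [hβ]; field_simp
  have hou : o ⬝ᵥ u = a * (o ⬝ᵥ o) := by rw [ha]; field_simp
  set r := u - (α • c + β • s) with hr
  set w := r - a • o with hw
  have hcr : c ⬝ᵥ r = 0 := by
    simp only [hr, dotProduct_sub, dotProduct_add, dotProduct_smul, smul_eq_mul, hcu, hΓ.cs]; ring
  have hsr : s ⬝ᵥ r = 0 := by
    simp only [hr, dotProduct_sub, dotProduct_add, dotProduct_smul, smul_eq_mul, hsu,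
      dotProduct_comm s c, hΓ.cs, hΓ.norm_s]; ring
  have hor : o ⬝ᵥ r = a * (o ⬝ᵥ o) := by
    simp only [hr, dotProduct_sub, dotProduct_add, dotProduct_smul, smul_eq_mul, hou,
      hΓ.oc, hΓ.os]; ring
  have how : o ⬝ᵥ w = 0 := by
    simp only [hw, dotProduct_sub, dotProduct_smul, smul_eq_mul, hor]; ring
  have hcw : c ⬝ᵥ w = 0 := by
    simp only [hw, dotProduct_sub, dotProduct_smul, smul_eq_mul, hcr, dotProduct_comm c o, hΓ.oc]
    ring
  have hsw : s ⬝ᵥ w = 0 := by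
    simp only [hw, dotProduct_sub, dotProduct_smul, smul_eq_mul, hsr, dotProduct_comm s o, hΓ.os]
    ring
  have hu' : u = α • c + β • s + (a • o + w) := by rw [hw, hr]; module
  have hrw : r = a • o + w := by rw [hw]; module
  have hrr : r ⬝ᵥ r = a ^ 2 * (o ⬝ᵥ o) + w ⬝ᵥ w := by
    rw [hrw]
    simp only [add_dotProduct, dotProduct_add, smul_dotProduct, dotProduct_smul, smul_eq_mul,
      dotProduct_comm w o, how]
    ring
  have hwu : w ⬝ᵥ u = w ⬝ᵥ w := by
    rw [hu']
    simp only [dotProduct_add, dotProduct_smul, smul_eq_mul,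
      dotProduct_comm w o, how, dotProduct_comm w c, hcw, dotProduct_comm w s, hsw]
    ring
  have hMu : M *ᵥ u = Γ *ᵥ u + (M - Γ) *ᵥ u := by rw [Matrix.sub_mulVec]; abel
  -- the component along `o`
  have h1 : |a| * √(o ⬝ᵥ o) ≤ 4 / 3 * (ρ / g) := by
    have e1 : o ⬝ᵥ M *ᵥ u = l * (o ⬝ᵥ u) := by rw [hu, dotProduct_smul, smul_eq_mul]
    have e2 : o ⬝ᵥ Γ *ᵥ u = ν * (o ⬝ᵥ u) := by
      rw [dotProduct_mulVec_symm hΓ.symm, hΓ.eig_o, smul_dotProduct, smul_eq_mul]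
    rw [hMu, dotProduct_add, e2] at e1
    have e3 := hW o u
    rw [hu1, Real.sqrt_one, mul_one] at e3
    have e4 : o ⬝ᵥ (M - Γ) *ᵥ u = -((ν - l) * (o ⬝ᵥ u)) := by linarith
    have hgap := hΓ.gap_o
    rw [e4, abs_neg, abs_mul, abs_of_nonneg (by linarith), hou, abs_mul, abs_of_pos hA] at e3
    have e5 : (o ⬝ᵥ o) = √(o ⬝ᵥ o) * √(o ⬝ᵥ o) := (Real.mul_self_sqrt hA.le).symm
    have hq : 0 < √(o ⬝ᵥ o) := Real.sqrt_pos.2 hA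
    set q := √(o ⬝ᵥ o)
    rw [e5] at e3
    have e6 : (ν - l) * (|a| * q) ≤ ρ := by
      refine le_of_mul_le_mul_right ?_ hq
      linarith
    -- The perturbed eigenvalue l moves by at most ρ ≤ g/4, so at least three quarters of the gap
    -- remain. Both components of r are then at most 4ρ/(3g), and 2 · (4/3)² ≤ 4.
    have e7 : 3 / 4 * g * (|a| * q) ≤ (ν - l) * (|a| * q) := by
      gcongr; linarith
    rw [← mul_div_assoc, le_div_iff₀ hg]
    linarith
  -- the component orthogonal to the three vectors
  have h2 : √(w ⬝ᵥ w) ≤ 4 / 3 * (ρ / g) := by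
    have hq0 : 0 ≤ √(w ⬝ᵥ w) := Real.sqrt_nonneg _
    have e1 : w ⬝ᵥ M *ᵥ u = l * (w ⬝ᵥ w) := by rw [hu, dotProduct_smul, smul_eq_mul, hwu]
    have e2 : w ⬝ᵥ Γ *ᵥ u = w ⬝ᵥ Γ *ᵥ w := by
      rw [hu']
      simp only [Matrix.mulVec_add, Matrix.mulVec_smul, hΓ.eig_o, hΓ.eig_c, hΓ.eig_s,
        dotProduct_add, dotProduct_smul, smul_eq_mul, dotProduct_comm w o, how,
        dotProduct_comm w c, hcw, dotProduct_comm w s, hsw]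
      ring
    rw [hMu, dotProduct_add, e2] at e1
    have e3 := (abs_le.1 (hW w u)).2
    rw [hu1, Real.sqrt_one, mul_one] at e3
    have e4 := hΓ.form_gap w how hcw hsw
    have e5 : (w ⬝ᵥ w) = √(w ⬝ᵥ w) * √(w ⬝ᵥ w) :=
      (Real.mul_self_sqrt (dotProduct_self_nonneg' w)).symm
    have e6 : (μ - ρ) * (w ⬝ᵥ w) ≤ l * (w ⬝ᵥ w) :=
      mul_le_mul_of_nonneg_right hl1 (dotProduct_self_nonneg' w)
    have e7 : (g - ρ) * (w ⬝ᵥ w) ≤ ρ * √(w ⬝ᵥ w) := by linarith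
    rcases hq0.eq_or_lt with hq | hq
    · rw [← hq]; positivity
    · set q := √(w ⬝ᵥ w)
      rw [e5, ← mul_assoc] at e7
      have e8 := le_of_mul_le_mul_right e7 hq
      have e9 : 3 / 4 * g * q ≤ (g - ρ) * q := by gcongr; linarith
      rw [← mul_div_assoc, le_div_iff₀ hg]
      linarith
  refine ⟨α, β, r, by rw [hr]; module, hcr, hsr, ?_⟩
  have h3 : a ^ 2 * (o ⬝ᵥ o) = (|a| * √(o ⬝ᵥ o)) ^ 2 := by
    rw [mul_pow, sq_abs, Real.sq_sqrt hA.le]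
  have h4 : w ⬝ᵥ w = √(w ⬝ᵥ w) ^ 2 := (Real.sq_sqrt (dotProduct_self_nonneg' w)).symm
  rw [hrr, h3, h4]
  have h5 : (|a| * √(o ⬝ᵥ o)) ^ 2 ≤ (4 / 3 * (ρ / g)) ^ 2 := by gcongr
  have h6 : √(w ⬝ᵥ w) ^ 2 ≤ (4 / 3 * (ρ / g)) ^ 2 := by gcongr
  nlinarith [sq_nonneg (ρ / g)]

end Perturbation

/-! ### Approximation of linear maps by isometries of the plane -/

/-- The rotation `z ↦ a z`. -/
lemma exists_rotation (a : ℂ) (ha : a ≠ 0) :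
    ∃ Q : ℂ ≃ₗᵢ[ℝ] ℂ, ∀ z : ℂ, Q z = a / ‖a‖ * z := by
  have h : ‖a / ‖a‖‖ = 1 := by
    rw [norm_div, Complex.norm_real, norm_norm, div_self (norm_ne_zero_iff.2 ha)]
  refine ⟨rotation ⟨a / ‖a‖, by simpa [Submonoid.unitSphere] using h⟩, fun z => ?_⟩
  exact rotation_apply _ _

/-- A small product ab forces the smaller coefficient b to be O(e), hence ‖a‖ = 1 + O(e), and only
the phase of a matters. The points z and w are unrelated so that either one can play the role of the
conjugate of the other. -/
lemma norm_smul_sub_isometry_le {a b : ℂ} {e : ℝ} (h1 : 1 - 4 * e ≤ ‖a‖ ^ 2 + ‖b‖ ^ 2)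
    (h2 : ‖a‖ ^ 2 + ‖b‖ ^ 2 ≤ 1) (h3 : ‖a * b‖ ≤ 3 * e) (he : e ≤ 1 / 16)
    (hab : ‖b‖ ≤ ‖a‖) {z w : ℂ} (hz : ‖z‖ = 1) (hw : ‖w‖ = 1) :
    a ≠ 0 ∧ ‖a * z + b * w - a / ‖a‖ * z‖ ≤ 11 * e := by
  rw [norm_mul] at h3
  have hb0 := norm_nonneg b
  have ha1 : 3 / 5 ≤ ‖a‖ := by
    by_contra hc
    push Not at hc
    nlinarith
  have ha2 : ‖a‖ ≤ 1 := by nlinarith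
  have ha0 : a ≠ 0 := norm_pos_iff.1 (by linarith)
  have hb1 : ‖b‖ ≤ 5 * e := by nlinarith
  have ha3 : 1 - ‖a‖ ≤ 6 * e := by nlinarith
  refine ⟨ha0, ?_⟩
  have hna : (‖a‖ : ℂ) ≠ 0 := by exact_mod_cast (by linarith : ‖a‖ ≠ 0)
  have e1 : a * z + b * w - a / ‖a‖ * z = b * w - (a / ‖a‖) * ((1 - ‖a‖ : ℝ) : ℂ) * z := by
    push_cast; field_simp; ring
  have e2 : ‖a / ‖a‖‖ = 1 := by
    rw [norm_div, Complex.norm_real, norm_norm, div_self (norm_ne_zero_iff.2 ha0)]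
  rw [e1]
  refine (norm_sub_le _ _).trans ?_
  rw [norm_mul, norm_mul, norm_mul, e2, hz, hw, Complex.norm_real, Real.norm_eq_abs,
    abs_of_nonneg (by linarith)]
  linarith

/-- Every real-linear map of the plane has the form w ↦ a w + b w̄. The hypotheses say that it is
almost orthogonal; the dominant coefficient decides whether the nearby isometry is a rotation or a
reflection. -/
lemma exists_isometry_near {a b : ℂ} {e : ℝ} (h1 : 1 - 4 * e ≤ ‖a‖ ^ 2 + ‖b‖ ^ 2)
    (h2 : ‖a‖ ^ 2 + ‖b‖ ^ 2 ≤ 1) (h3 : ‖a * b‖ ≤ 3 * e) (he : e ≤ 1 / 16) :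
    ∃ Q : ℂ ≃ₗᵢ[ℝ] ℂ, ∀ w : ℂ, ‖w‖ = 1 → ‖a * w + b * starRingEnd ℂ w - Q w‖ ≤ 11 * e := by
  rcases le_total ‖b‖ ‖a‖ with hab | hab
  · have ha0 := (norm_smul_sub_isometry_le h1 h2 h3 he hab (z := 1) (w := 1)
      (by simp) (by simp)).1
    obtain ⟨Q, hQ⟩ := exists_rotation a ha0
    refine ⟨Q, fun w hw => ?_⟩
    rw [hQ]
    exact (norm_smul_sub_isometry_le h1 h2 h3 he hab hw (by simpa using hw)).2
  · rw [add_comm] at h1 h2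
    rw [mul_comm] at h3
    have hb0 := (norm_smul_sub_isometry_le h1 h2 h3 he hab (z := 1) (w := 1)
      (by simp) (by simp)).1
    obtain ⟨Q, hQ⟩ := exists_rotation b hb0
    refine ⟨Complex.conjLIE.trans Q, fun w hw => ?_⟩
    rw [LinearIsometryEquiv.trans_apply, hQ, Complex.conjLIE_apply, add_comm]
    exact (norm_smul_sub_isometry_le h1 h2 h3 he hab (by simpa using hw) hw).2

/-! ### The vanilla spectral algorithm on a perturbed circulant matrix -/

section Vanilla

variable {ι : Type*} [Fintype ι] {m : ℕ} [NeZero m]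

/-- The circulant matrix with symbol `arcSum m w`, with rows and columns indexed through `τ`. -/
def circulantMatrix (τ : ι ≃ ZMod m) (w : ℕ → ℝ) : Matrix ι ι ℝ :=
  Matrix.of fun i j => arcSum m w (τ i - τ j)

lemma circulant_form (τ : ι ≃ ZMod m) (w : ℕ → ℝ) (v : ι → ℝ) :
    m * (v ⬝ᵥ circulantMatrix τ w *ᵥ v) =
      ∑ k, circEig (arcSum m w) k * fourierSq (fun a => v (τ.symm a)) k := by
  rw [circulant_quadratic (arcSum_neg w)]
  congr 1
  rw [← Equiv.sum_comp τ]
  refine Finset.sum_congr rfl fun i _ => ?_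
  rw [← Equiv.sum_comp τ, Matrix.mulVec, dotProduct, Finset.mul_sum]
  refine Finset.sum_congr rfl fun j _ => ?_
  simp [circulantMatrix]; ring

lemma circulant_norm (τ : ι ≃ ZMod m) (v : ι → ℝ) :
    m * (v ⬝ᵥ v) = ∑ k, fourierSq (fun a => v (τ.symm a)) k := by
  rw [sum_fourierSq]
  congr 1
  rw [← Equiv.sum_comp τ]
  refine Finset.sum_congr rfl fun i _ => ?_
  simp [sq]

lemma fourierSq_zero_freq (τ : ι ≃ ZMod m) (v : ι → ℝ) :
    fourierSq (fun a => v (τ.symm a)) 0 = ((fun _ => 1) ⬝ᵥ v) ^ 2 := by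
  rw [fourierSq, ← Equiv.sum_comp τ, ← Equiv.sum_comp τ]
  simp [cosZ_zero, sinZ_zero, dotProduct]

lemma fourierSq_one_freq (τ : ι ≃ ZMod m) (v : ι → ℝ) :
    fourierSq (fun a => v (τ.symm a)) 1 =
      ((fun i => cosZ (τ i)) ⬝ᵥ v) ^ 2 + ((fun i => sinZ (τ i)) ⬝ᵥ v) ^ 2 := by
  rw [fourierSq, ← Equiv.sum_comp τ, ← Equiv.sum_comp τ]
  simp [dotProduct]

lemma fourierSq_neg_one_freq (u : ZMod m → ℝ) : fourierSq u (-1) = fourierSq u 1 := by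
  simp [fourierSq, cosZ_neg, sinZ_neg]

/-- The constant vector carries frequency 0, and the cosine and sine vectors carry the frequencies
±1. Orthogonality to them removes these terms from the Fourier expansion of the form, and the
eigenvalue comparisons bound the rest. The squared norms m/2 come from the vanishing of the sums at
frequency 2, which needs 2 ≠ 0 in `ZMod m`. -/
lemma circulant_hasPlaneGap (hm : 100 ≤ m) (τ : ι ≃ ZMod m) {cl : ℝ} (hc : 0 < cl) {w : ℕ → ℝ}
    (hw : ∀ r < m / 2, cl * (2 * Real.pi / m) ≤ w r) (hw' : 0 ≤ w (m / 2)) :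
    HasPlaneGap (circulantMatrix τ w) (fun _ => 1) (fun i => cosZ (τ i)) (fun i => sinZ (τ i))
      (circEig (arcSum m w) 0) (circEig (arcSum m w) 1) (cl * m / 20000) ∧
    (fun i => cosZ (τ i)) ⬝ᵥ (fun i => cosZ (τ i)) = (m : ℝ) / 2 := by
  obtain ⟨g1, g2, g3⟩ := circEig_arcSum_gaps hm hc.le hw hw'
  have : Fact (1 < m) := ⟨by omega⟩
  have hm0 : (0 : ℝ) < m := by exact_mod_cast (by omega : 0 < m)
  have hcard : Fintype.card ι = m := by rw [Fintype.card_congr τ, ZMod.card]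
  have h20 : (2 : ZMod m) ≠ 0 := by
    intro h
    have : ((2 : ℕ) : ZMod m) = 0 := by exact_mod_cast h
    rw [ZMod.natCast_eq_zero_iff] at this
    exact absurd (Nat.le_of_dvd (by omega) this) (by omega)
  have s1 : ∑ x : ZMod m, (cosZ x * cosZ x + sinZ x * sinZ x) = m := by
    have : ∀ x : ZMod m, cosZ x * cosZ x + sinZ x * sinZ x = 1 := by
      intro x; linarith [cosZ_sq_add_sinZ_sq x]
    simp [this, ZMod.card]
  have s2 : ∑ x : ZMod m, (cosZ x * cosZ x - sinZ x * sinZ x) = 0 := by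
    rw [← (sum_cosZ_mul (2 : ZMod m)).trans (if_neg h20)]
    exact Finset.sum_congr rfl fun x _ => by rw [mul_two, cosZ_add]
  have s3 : ∑ x : ZMod m, cosZ x * sinZ x = 0 := by
    have h := sum_sinZ_mul (2 : ZMod m)
    have : ∀ x : ZMod m, sinZ (x * 2) = 2 * (cosZ x * sinZ x) := by
      intro x; rw [mul_two, sinZ_add]; ring
    simp only [this, ← Finset.mul_sum] at h
    linarith
  have s4 : ∑ x : ZMod m, cosZ x = 0 := by
    have := sum_cosZ_mul (1 : ZMod m)
    simpa using this
  have s5 : ∑ x : ZMod m, sinZ x = 0 := by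
    have := sum_sinZ_mul (1 : ZMod m)
    simpa using this
  rw [Finset.sum_add_distrib] at s1
  rw [Finset.sum_sub_distrib] at s2
  have t1 : (fun i => cosZ (τ i)) ⬝ᵥ (fun i => cosZ (τ i)) = (m : ℝ) / 2 := by
    rw [dotProduct, Equiv.sum_comp τ fun x => cosZ x * cosZ x]; linarith
  have t2 : (fun i => sinZ (τ i)) ⬝ᵥ (fun i => sinZ (τ i)) = (m : ℝ) / 2 := by
    rw [dotProduct, Equiv.sum_comp τ fun x => sinZ x * sinZ x]; linarith
  refine ⟨HasPlaneGap.mk ?_ ?_ ?_ ?_ ?_ ?_ ?_ ?_ ?_ ?_ (by positivity) g3 ?_ ?_, t1⟩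
  · ext i j
    simp only [circulantMatrix, Matrix.transpose_apply, Matrix.of_apply]
    rw [← arcSum_neg, neg_sub]
  · ext i
    have := sum_circulant_one (arcSum m w) (τ i)
    simp only [Matrix.mulVec, dotProduct, circulantMatrix, Matrix.of_apply, mul_one,
      Pi.smul_apply, smul_eq_mul]
    rw [Equiv.sum_comp τ fun x => arcSum m w (τ i - x), this]
  · ext i
    have := sum_circulant_cosZ (arcSum_neg w) (τ i)
    simp only [Matrix.mulVec, dotProduct, circulantMatrix, Matrix.of_apply,
      Pi.smul_apply, smul_eq_mul]
    rw [Equiv.sum_comp τ fun x => arcSum m w (τ i - x) * cosZ x, this]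
  · ext i
    have := sum_circulant_sinZ (arcSum_neg w) (τ i)
    simp only [Matrix.mulVec, dotProduct, circulantMatrix, Matrix.of_apply,
      Pi.smul_apply, smul_eq_mul]
    rw [Equiv.sum_comp τ fun x => arcSum m w (τ i - x) * sinZ x, this]
  · simp only [dotProduct, mul_one, Finset.sum_const, Finset.card_univ, hcard, nsmul_eq_mul]
    exact hm0
  · rw [t1]; positivity
  · rw [t1, t2]
  · simp only [dotProduct, one_mul]; rw [Equiv.sum_comp τ fun x => cosZ x, s4]
  · simp only [dotProduct, one_mul]; rw [Equiv.sum_comp τ fun x => sinZ x, s5]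
  · simp only [dotProduct]; rw [Equiv.sum_comp τ fun x => cosZ x * sinZ x, s3]
  · intro v hv
    refine le_of_mul_le_mul_left ?_ hm0
    rw [mul_left_comm, circulant_norm τ, circulant_form, Finset.mul_sum]
    refine Finset.sum_le_sum fun k _ => ?_
    by_cases hk : k = 0
    · rw [hk, fourierSq_zero_freq, hv]; simp
    · exact mul_le_mul_of_nonneg_right (g1 k hk) (fourierSq_nonneg _ _)
  · intro v hv hcv hsv
    refine le_of_mul_le_mul_left ?_ hm0
    rw [mul_left_comm, circulant_norm τ, circulant_form, Finset.mul_sum]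
    refine Finset.sum_le_sum fun k _ => ?_
    have h1 : fourierSq (fun a => v (τ.symm a)) 1 = 0 := by
      rw [fourierSq_one_freq, hcv, hsv]; simp
    by_cases hk : k = 0
    · rw [hk, fourierSq_zero_freq, hv]; simp
    by_cases hk1 : k = 1
    · rw [hk1, h1]; simp
    by_cases hk2 : k = -1
    · rw [hk2, fourierSq_neg_one_freq, h1]; simp
    · exact mul_le_mul_of_nonneg_right (by linarith [g2 k hk hk1 hk2]) (fourierSq_nonneg _ _)

/-- The output of the vanilla spectral algorithm is `ℓ²`-close to the grid, up to an isometry. -/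
theorem vanilla_close [DecidableEq ι] (hm : 100 ≤ m) (τ : ι ≃ ZMod m) {cl : ℝ} (hc : 0 < cl)
    {w : ℕ → ℝ} (hw : ∀ r < m / 2, cl * (2 * Real.pi / m) ≤ w r) (hw' : 0 ≤ w (m / 2))
    {M : Matrix ι ι ℝ} (hM : M.IsSymm) {ρ : ℝ} (hρ0 : 0 ≤ ρ) (hρ : 4 * ρ ≤ cl * m / 20000)
    (hW : OpBound (M - circulantMatrix τ w) ρ) {y : ι → ℂ} (hy : IsVanillaSpectral M y) :
    ∃ Q : ℂ ≃ₗᵢ[ℝ] ℂ, ∑ i, ‖y i - Q (gridZ m (τ i))‖ ^ 2 ≤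
      24 * (ρ / (cl * m / 20000)) ^ 2 * m := by
  obtain ⟨hΓ, hcc⟩ := circulant_hasPlaneGap hm τ hc hw hw'
  obtain ⟨u, v, hu, hv, huu, hvv, huv, hy⟩ := hy
  have hcard : Fintype.card ι = m := by rw [Fintype.card_congr τ, ZMod.card]
  have hm0 : (0 : ℝ) < m := by exact_mod_cast (by omega : 0 < m)
  obtain ⟨b1, b2⟩ := hΓ.eigenvalue_bounds hM (by omega) hW
  have b3 := nthEigenvalue_two_le_one hM (by omega)
  set c : ι → ℝ := fun i => cosZ (τ i) with hcdef
  set s : ι → ℝ := fun i => sinZ (τ i) with hsdef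
  set g := cl * m / 20000 with hg
  have hg0 : 0 < g := by positivity
  obtain ⟨α, β, r, hur, hcr, hsr, hrr⟩ :=
    hΓ.residual_le hW hρ hρ0 hu huu (b1.trans b3) b2
  obtain ⟨α', β', r', hvr, hcr', hsr', hrr'⟩ :=
    hΓ.residual_le hW hρ hρ0 hv hvv b1 (b3.trans b2)
  set e := (ρ / g) ^ 2 with he
  have he0 : 0 ≤ e := by positivity
  have he1 : e ≤ 1 / 16 := by
    have : ρ / g ≤ 1 / 4 := by rw [div_le_iff₀ hg0]; linarith
    have h0 : 0 ≤ ρ / g := by positivity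
    rw [he]; nlinarith
  set q := √((m : ℝ) / 2) with hq
  have hqq : q * q = m / 2 := Real.mul_self_sqrt (by positivity)
  have hss := hΓ.norm_s
  have hcs := hΓ.cs
  rw [hcc] at hss
  -- The matrix with rows q(α, β) and q(α', β') expresses the spectral embedding in terms of the
  -- grid. Orthonormality of u and v makes it orthogonal up to the residuals r and r'.
  have k1 : (q * α) ^ 2 + (q * β) ^ 2 = 1 - r ⬝ᵥ r := by
    have : u ⬝ᵥ u = (α ^ 2 + β ^ 2) * (m / 2) + r ⬝ᵥ r := by
      rw [hur]
      simp only [add_dotProduct, dotProduct_add, smul_dotProduct, dotProduct_smul, smul_eq_mul,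
        dotProduct_comm r c, dotProduct_comm r s, dotProduct_comm s c, hcr, hsr, hcs, hcc, hss]
      ring
    rw [huu, ← hqq] at this
    linarith
  have k2 : (q * α') ^ 2 + (q * β') ^ 2 = 1 - r' ⬝ᵥ r' := by
    have : v ⬝ᵥ v = (α' ^ 2 + β' ^ 2) * (m / 2) + r' ⬝ᵥ r' := by
      rw [hvr]
      simp only [add_dotProduct, dotProduct_add, smul_dotProduct, dotProduct_smul, smul_eq_mul,
        dotProduct_comm r' c, dotProduct_comm r' s, dotProduct_comm s c, hcr', hsr', hcs, hcc, hss]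
      ring
    rw [hvv, ← hqq] at this
    linarith
  have k3 : (q * α) * (q * α') + (q * β) * (q * β') = -(r ⬝ᵥ r') := by
    have : u ⬝ᵥ v = (α * α' + β * β') * (m / 2) + r ⬝ᵥ r' := by
      rw [hur, hvr]
      simp only [add_dotProduct, dotProduct_add, smul_dotProduct, dotProduct_smul, smul_eq_mul,
        dotProduct_comm r c, dotProduct_comm r s, dotProduct_comm s c, hcr, hsr, hcr', hsr', hcs,
        hcc, hss]
      ring
    rw [huv, ← hqq] at this
    linarith
  have hr0 := dotProduct_self_nonneg' r
  have hr0' := dotProduct_self_nonneg' r'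
  have k4 : |r ⬝ᵥ r'| ≤ 4 * e := by
    refine abs_le_of_sq_le_sq ?_ (by positivity)
    calc (r ⬝ᵥ r') ^ 2 ≤ (r ⬝ᵥ r) * (r' ⬝ᵥ r') := dotProduct_sq_le r r'
      _ ≤ (4 * e) * (4 * e) := by gcongr
      _ = (4 * e) ^ 2 := by ring
  set p1 := q * α
  set p2 := q * β
  set q1 := q * α'
  set q2 := q * β'
  -- These are the coefficients of w and w̄ in the complex form of that matrix. Then ‖a‖² + ‖b‖² is
  -- half the sum of the squared row norms, Re(ab) a quarter of their difference, and Im(ab) half of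
  -- the inner product of the rows.
  set a : ℂ := ⟨(p1 + q2) / 2, (q1 - p2) / 2⟩ with ha
  set b : ℂ := ⟨(p1 - q2) / 2, (q1 + p2) / 2⟩ with hb
  have hnorm : ‖a‖ ^ 2 + ‖b‖ ^ 2 = 1 - (r ⬝ᵥ r + r' ⬝ᵥ r') / 2 := by
    rw [← Complex.normSq_eq_norm_sq, ← Complex.normSq_eq_norm_sq, Complex.normSq_apply,
      Complex.normSq_apply]
    simp only [ha, hb]
    linarith
  have hab : ‖a * b‖ ≤ 3 * e := by
    refine (Complex.norm_le_abs_re_add_abs_im _).trans ?_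
    have e1 : (a * b).re = (r' ⬝ᵥ r' - r ⬝ᵥ r) / 4 := by
      rw [Complex.mul_re]
      simp only [ha, hb]
      linarith
    have e2 : (a * b).im = -(r ⬝ᵥ r') / 2 := by
      rw [Complex.mul_im]
      simp only [ha, hb]
      linarith
    have e3 : |(a * b).re| ≤ e := by rw [e1, abs_le]; constructor <;> linarith
    have e4 : |(a * b).im| ≤ 2 * e := by
      rw [e2, abs_le]; rw [abs_le] at k4; constructor <;> linarith [k4.1, k4.2]
    linarith
  obtain ⟨Q, hQ⟩ := exists_isometry_near (by linarith) (by linarith) hab he1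
  refine ⟨Q, ?_⟩
  -- The first term sums to at most 8em through the residuals. The square of the isometry error 11e
  -- is made linear in e using e ≤ 1/16, which gives 16e per point.
  have hpoint : ∀ i, ‖y i - Q (gridZ m (τ i))‖ ^ 2 ≤ m * (r i * r i + r' i * r' i) + 16 * e := by
    intro i
    set W : ℂ := (gridZ m (τ i) : ℂ) with hW
    have hWc : W.re = c i := rfl
    have hWs : W.im = s i := rfl
    have hdec : y i = (a * W + b * starRingEnd ℂ W) + ⟨q * r i, q * r' i⟩ := by
      rw [hy i, hcard]
      apply Complex.ext
      · simp only [Complex.add_re, Complex.mul_re, Complex.conj_re, Complex.conj_im, hWc, hWs, ha,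
          hb]
        rw [show u i = α * c i + β * s i + r i by rw [hur]; simp]
        ring
      · simp only [Complex.add_im, Complex.mul_im, Complex.conj_re, Complex.conj_im, hWc, hWs, ha,
          hb]
        rw [show v i = α' * c i + β' * s i + r' i by rw [hvr]; simp]
        ring
    have h1 := hQ W (Circle.norm_coe _)
    have h2 : ‖y i - Q W‖ ≤ 11 * e + ‖(⟨q * r i, q * r' i⟩ : ℂ)‖ := by
      rw [hdec, add_sub_right_comm]
      exact (norm_add_le _ _).trans (by gcongr)
    have h3 : ‖(⟨q * r i, q * r' i⟩ : ℂ)‖ ^ 2 = m / 2 * (r i * r i + r' i * r' i) := by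
      rw [← Complex.normSq_eq_norm_sq, Complex.normSq_mk, ← hqq]; ring
    set x := ‖(⟨q * r i, q * r' i⟩ : ℂ)‖
    calc ‖y i - Q W‖ ^ 2 ≤ (11 * e + x) ^ 2 := by gcongr
      _ ≤ 2 * x ^ 2 + 242 * e * e := by linarith [sq_nonneg (11 * e - x)]
      _ ≤ 2 * x ^ 2 + 242 * e * (1 / 16) := by gcongr
      _ ≤ _ := by rw [h3]; linarith
  calc ∑ i, ‖y i - Q (gridZ m (τ i))‖ ^ 2
      ≤ ∑ i, (m * (r i * r i + r' i * r' i) + 16 * e) := Finset.sum_le_sum fun i _ => hpoint i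
    _ = m * (r ⬝ᵥ r + r' ⬝ᵥ r') + 16 * e * m := by
        rw [Finset.sum_add_distrib, ← Finset.mul_sum, Finset.sum_add_distrib, Finset.sum_const,
          Finset.card_univ, hcard]
        simp only [dotProduct, nsmul_eq_mul]
        ring
    _ ≤ m * (4 * e + 4 * e) + 16 * e * m := by gcongr
    _ = 24 * e * m := by ring

/-- The normalized output of the vanilla spectral algorithm is `ℓ¹`-close to the grid. -/
theorem vanilla_normalized_close [DecidableEq ι] (hm : 100 ≤ m) (τ : ι ≃ ZMod m) {cl : ℝ}
    (hc : 0 < cl) {w : ℕ → ℝ} (hw : ∀ r < m / 2, cl * (2 * Real.pi / m) ≤ w r)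
    (hw' : 0 ≤ w (m / 2)) {M : Matrix ι ι ℝ} (hM : M.IsSymm) {ρ : ℝ} (hρ0 : 0 ≤ ρ)
    (hρ : 4 * ρ ≤ cl * m / 20000) (hW : OpBound (M - circulantMatrix τ w) ρ) {y : ι → ℂ}
    (hy : IsVanillaSpectral M y) {z : ι → Circle} (hz : ∀ i, y i = ‖y i‖ * (z i : ℂ)) :
    ∃ Q : ℂ ≃ₗᵢ[ℝ] ℂ, ∑ i, ‖(z i : ℂ) - Q (gridZ m (τ i))‖ ≤ 200000 / cl * ρ := by
  obtain ⟨Q, hQ⟩ := vanilla_close hm τ hc hw hw' hM hρ0 hρ hW hy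
  have hm0 : (0 : ℝ) < m := by exact_mod_cast (by omega : 0 < m)
  have hcard : Fintype.card ι = m := by rw [Fintype.card_congr τ, ZMod.card]
  refine ⟨Q, ?_⟩
  -- The radial projection of y i is its nearest point on the circle, so normalizing at most doubles
  -- the distance to another point of the circle. An arbitrary z i is harmless when y i = 0.
  have h1 : ∀ i, ‖(z i : ℂ) - Q (gridZ m (τ i))‖ ≤ 2 * ‖y i - Q (gridZ m (τ i))‖ := by
    intro i
    have h2 : ‖(z i : ℂ) - y i‖ ≤ ‖y i - Q (gridZ m (τ i))‖ := by
      have h3 : (z i : ℂ) - y i = ((1 - ‖y i‖ : ℝ) : ℂ) * z i := by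
        rw [Complex.ofReal_sub, sub_mul, ← hz i]; simp
      have h4 : ‖Q (gridZ m (τ i) : ℂ)‖ = 1 := by rw [Q.norm_map, Circle.norm_coe]
      rw [h3, norm_mul, Circle.norm_coe, mul_one, Complex.norm_real, Real.norm_eq_abs, ← h4,
        norm_sub_rev]
      exact abs_norm_sub_norm_le _ _
    have h5 := norm_sub_le_norm_sub_add_norm_sub (z i : ℂ) (y i) (Q (gridZ m (τ i)))
    linarith
  have h2 : ∑ i, ‖(z i : ℂ) - Q (gridZ m (τ i))‖ ≤ 2 * ∑ i, ‖y i - Q (gridZ m (τ i))‖ := by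
    rw [Finset.mul_sum]; exact Finset.sum_le_sum fun i _ => h1 i
  -- Cauchy–Schwarz converts ℓ² into ℓ¹, and 24 ≤ 5².
  have h3 : (∑ i, ‖y i - Q (gridZ m (τ i))‖) ^ 2 ≤ (5 * (ρ / (cl * m / 20000)) * m) ^ 2 := by
    calc (∑ i, ‖y i - Q (gridZ m (τ i))‖) ^ 2
        ≤ (Finset.univ : Finset ι).card * ∑ i, ‖y i - Q (gridZ m (τ i))‖ ^ 2 :=
          sq_sum_le_card_mul_sum_sq
      _ ≤ m * (24 * (ρ / (cl * m / 20000)) ^ 2 * m) := by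
          rw [Finset.card_univ, hcard]; gcongr
      _ ≤ (5 * (ρ / (cl * m / 20000)) * m) ^ 2 := by
          nlinarith [sq_nonneg (ρ / (cl * m / 20000) * m)]
  have h4 := abs_le_of_sq_le_sq h3 (by positivity)
  have h5 : 5 * (ρ / (cl * m / 20000)) * m = 100000 / cl * ρ := by field_simp; ring
  have h6 := le_abs_self (∑ i, ‖y i - Q (gridZ m (τ i))‖)
  rw [h5] at h4
  have h7 : 200000 / cl * ρ = 2 * (100000 / cl * ρ) := by ring
  linarith

end Vanilla

/-! ### Rearrangement -/

/-- The exchange inequality: uncrossing two matched pairs on the line does not increase the total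
distance. -/
lemma abs_sub_add_abs_sub_le_swap {a b c d : ℝ} (hab : a ≤ b) (hcd : c ≤ d) :
    |b - d| + |a - c| ≤ |b - c| + |a - d| := by
  rcases abs_cases (b - d) with ⟨h1, _⟩ | ⟨h1, _⟩ <;>
  rcases abs_cases (a - c) with ⟨h2, _⟩ | ⟨h2, _⟩ <;>
  rcases abs_cases (b - c) with ⟨h3, _⟩ | ⟨h3, _⟩ <;>
  rcases abs_cases (a - d) with ⟨h4, _⟩ | ⟨h4, _⟩ <;>
  linarith

/-- The sorted matching minimizes the sum of distances on the line. -/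
lemma sum_abs_sub_le_of_monotone {n : ℕ} {f g : Fin n → ℝ} (hf : Monotone f) (hg : Monotone g)
    (p : Equiv.Perm (Fin n)) : ∑ i, |f i - g i| ≤ ∑ i, |f i - g (p i)| := by
  -- Induction on the number k of leading indices that the permutation may still move.
  suffices h : ∀ k : ℕ, ∀ p : Equiv.Perm (Fin n), (∀ i : Fin n, k ≤ i → p i = i) →
      ∑ i, |f i - g i| ≤ ∑ i, |f i - g (p i)| from h n p fun i hi => absurd i.2 (by omega)
  intro k
  induction k with
  | zero =>
    intro p hp
    exact le_of_eq (Finset.sum_congr rfl fun i _ => by rw [hp i (Nat.zero_le _)])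
  | succ k ih =>
    intro p hp
    by_cases hk : k < n
    swap
    · exact ih p fun i hi => absurd i.2 (by omega)
    set j : Fin n := ⟨k, hk⟩ with hj
    by_cases hpj : p j = j
    · refine ih p fun i hi => ?_
      rcases Nat.eq_or_lt_of_le hi with h | h
      · have : i = j := Fin.ext h.symm
        rw [this, hpj]
      · exact hp i h
    set b := p.symm j with hb
    have hpb : p b = j := by simp [hb]
    have hbj : b ≠ j := fun h => hpj (by rw [← h, hpb, h])
    have hle : ∀ i, p i ≠ i → i ≤ j := by
      intro i hi
      by_contra hc
      push Not at hc
      exact hi (hp i hc)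
    have hblt : b ≤ j := hle b (by rw [hpb]; exact hbj.symm)
    have hplt : p j ≤ j := hle (p j) (fun h => hpj (p.injective h))
    -- Exchanging the images of j and of its preimage b makes j fixed. Both b and p j are at most j,
    -- so the exchange inequality applies.
    set q : Equiv.Perm (Fin n) := p.trans (Equiv.swap (p j) j) with hq
    have hqj : q j = j := by simp [hq]
    have hqb : q b = p j := by simp [hq, hpb]
    have hqo : ∀ i, i ≠ j → i ≠ b → q i = p i := by
      intro i h1 h2
      rw [hq, Equiv.trans_apply, Equiv.swap_apply_of_ne_of_ne]
      · exact fun h => h1 (p.injective h)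
      · exact fun h => h2 (by rw [hb, ← h]; simp)
    have h1 : ∑ i, |f i - g i| ≤ ∑ i, |f i - g (q i)| := by
      refine ih q fun i hi => ?_
      rcases Nat.eq_or_lt_of_le hi with h | h
      · have : i = j := Fin.ext h.symm
        rw [this, hqj]
      · have hij : j < i := h
        rw [hqo i hij.ne' (fun h' => absurd hblt (by rw [← h']; exact not_le.2 hij))]
        exact hp i h
    refine h1.trans ?_
    rw [← sub_nonneg, ← Finset.sum_sub_distrib, Finset.sum_eq_add j b hbj.symm]
    · rw [hqj, hqb, hpb]
      have := abs_sub_add_abs_sub_le_swap (hf hblt) (hg hplt)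
      linarith
    · rintro i - ⟨h2, h3⟩
      rw [hqo i h2 h3, sub_self]
    · simp
    · simp

/-! ### Cutting the circle -/

/-- The coordinate of `z` in the fundamental domain starting at the angle `κ`. -/
def cutCoord (κ : ℝ) (z : Circle) : ℝ := toIcoMod Real.two_pi_pos κ (Complex.arg z)

lemma cutCoord_mem (κ : ℝ) (z : Circle) : cutCoord κ z ∈ Set.Ico κ (κ + 2 * Real.pi) :=
  toIcoMod_mem_Ico _ _ _

lemma exp_cutCoord (κ : ℝ) (z : Circle) : Circle.exp (cutCoord κ z) = z := by
  have h := circle_exp_add_two_pi_mul (Complex.arg z)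
    (-toIcoDiv Real.two_pi_pos κ (Complex.arg z))
  rw [Circle.exp_arg] at h
  rw [cutCoord, toIcoMod, zsmul_eq_mul]
  convert h using 2
  push_cast; ring

lemma cutCoord_eq {κ x : ℝ} {k : ℤ} (h1 : κ + 2 * Real.pi * k ≤ x)
    (h2 : x < κ + 2 * Real.pi * k + 2 * Real.pi) :
    cutCoord κ (Circle.exp x) = x - 2 * Real.pi * k := by
  obtain ⟨l, hl⟩ := Circle.exp_eq_exp.1 (exp_cutCoord κ (Circle.exp x))
  obtain ⟨h3, h4⟩ := cutCoord_mem κ (Circle.exp x)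
  rw [hl] at h3 h4 ⊢
  have hpi := Real.two_pi_pos
  have h5 : (-1 : ℝ) < l + k := by
    by_contra hc
    push Not at hc
    nlinarith
  have h6 : (l + k : ℝ) < 1 := by
    by_contra hc
    push Not at hc
    nlinarith
  have h7 : l + k = 0 := by
    have h8 : -1 < l + k := by exact_mod_cast h5
    have h9 : l + k < 1 := by exact_mod_cast h6
    omega
  have h8 : (l : ℝ) = -k := by
    have : ((l + k : ℤ) : ℝ) = 0 := by rw [h7]; simp
    push_cast at this
    linarith
  rw [h8]; ring

lemma geoDist_le_abs_cutCoord_sub (κ : ℝ) (z y : Circle) :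
    geoDist z y ≤ |cutCoord κ z - cutCoord κ y| := by
  conv_lhs => rw [← exp_cutCoord κ z, ← exp_cutCoord κ y]
  exact geoDist_exp_le _ _

lemma exists_lifts (z y : Circle) :
    ∃ x x' : ℝ, Circle.exp x = z ∧ Circle.exp x' = y ∧ |x - x'| = geoDist z y := by
  obtain ⟨k, hk⟩ := exists_int_geoDist_exp (Complex.arg z) (Complex.arg y)
  rw [Circle.exp_arg, Circle.exp_arg] at hk
  refine ⟨Complex.arg z, Complex.arg y + k * (2 * Real.pi), Circle.exp_arg z, ?_, ?_⟩
  · rw [circle_exp_add_two_pi_mul, Circle.exp_arg]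
  · rw [hk]; congr 1; ring

/-- The angle of the cut just before the grid point of index `t`. -/
def cutAngle (m t : ℕ) : ℝ := 2 * Real.pi * t / m - Real.pi / m

/-- On average over the cuts, cutting the circle costs little. -/
lemma sum_abs_cutCoord_sub_le {m : ℕ} (hm : 0 < m) (z y : Circle) :
    ∑ t ∈ Finset.range m, |cutCoord (cutAngle m t) z - cutCoord (cutAngle m t) y| ≤
      2 * m * geoDist z y + 2 * Real.pi := by
  obtain ⟨x, x', hx, hx', hxx⟩ := exists_lifts z y
  wlog hle : x ≤ x' generalizing z y x x'
  · have := this y z x' x hx' hx (by rw [abs_sub_comm, hxx, geoDist_comm]) (le_of_not_ge hle)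
    simp_rw [abs_sub_comm (cutCoord _ z), geoDist_comm z]
    exact this
  rw [abs_sub_comm, abs_of_nonneg (sub_nonneg.2 hle)] at hxx
  have hm0 : (0 : ℝ) < m := by exact_mod_cast hm
  have hpi := Real.pi_pos
  set d := geoDist z y with hd
  classical
  -- B collects the cuts falling between the two lifts. Such a cut costs at most 2π; any other cut
  -- keeps the two coordinates at distance exactly d.
  set B := (Finset.range m).filter fun t => ∃ k : ℤ,
    x < cutAngle m t + 2 * Real.pi * k ∧ cutAngle m t + 2 * Real.pi * k ≤ x' with hB
  -- In this scale the lifts of the cuts are the integers t + mk: the shift by 1/2 undoes the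
  -- half-step offset in `cutAngle`. Counting B becomes counting integers in (a, b].
  set a := x * m / (2 * Real.pi) + 1 / 2 with ha
  set b := x' * m / (2 * Real.pi) + 1 / 2 with hb
  have hBcard : (B.card : ℝ) ≤ m * d / (2 * Real.pi) + 1 := by
    have hsub : B ⊆ (Finset.Ioc ⌊a⌋ ⌊b⌋).image fun j : ℤ => (j % m).toNat := by
      intro t ht
      rw [hB, Finset.mem_filter, Finset.mem_range] at ht
      obtain ⟨htm, k, h1, h2⟩ := ht
      rw [Finset.mem_image]
      refine ⟨t + m * k, ?_, ?_⟩
      · have e : cutAngle m t + 2 * Real.pi * k =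
            ((t + m * k : ℤ) - 1 / 2) * (2 * Real.pi) / m := by
          rw [cutAngle]; push_cast; field_simp; ring
        rw [e] at h1 h2
        rw [lt_div_iff₀ hm0] at h1
        rw [div_le_iff₀ hm0] at h2
        rw [Finset.mem_Ioc, Int.floor_lt, Int.le_floor, ha, hb]
        constructor
        · rw [← lt_sub_iff_add_lt, div_lt_iff₀ (by positivity)]; exact h1
        · rw [← sub_le_iff_le_add, le_div_iff₀ (by positivity)]; exact h2
      · rw [Int.add_mul_emod_self_left]
        rw [Int.emod_eq_of_lt (by omega) (by omega)]
        simp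
    have h1 := (Finset.card_le_card hsub).trans Finset.card_image_le
    rw [Int.card_Ioc] at h1
    have h2 : ((⌊b⌋ - ⌊a⌋).toNat : ℝ) ≤ b - a + 1 := by
      have h3 : ⌊a⌋ ≤ ⌊b⌋ := by
        apply Int.floor_mono
        rw [ha, hb]; gcongr
      have h4 : ((⌊b⌋ - ⌊a⌋).toNat : ℤ) = ⌊b⌋ - ⌊a⌋ := Int.toNat_of_nonneg (by omega)
      have h5 : ((⌊b⌋ - ⌊a⌋).toNat : ℝ) = (⌊b⌋ : ℝ) - ⌊a⌋ := by exact_mod_cast h4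
      rw [h5]
      linarith [Int.floor_le b, Int.lt_floor_add_one a]
    have h3 : b - a = m * d / (2 * Real.pi) := by rw [ha, hb, ← hxx]; ring
    calc (B.card : ℝ) ≤ ((⌊b⌋ - ⌊a⌋).toNat : ℝ) := by exact_mod_cast h1
      _ ≤ _ := by rw [← h3]; exact h2
  have hterm : ∀ t ∈ Finset.range m, |cutCoord (cutAngle m t) z - cutCoord (cutAngle m t) y| ≤
      d + if t ∈ B then 2 * Real.pi else 0 := by
    intro t ht
    have hd0 : 0 ≤ d := geoDist_nonneg _ _
    split_ifs with htB
    · have h1 := cutCoord_mem (cutAngle m t) z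
      have h2 := cutCoord_mem (cutAngle m t) y
      rw [abs_le]
      constructor <;> linarith [h1.1, h1.2, h2.1, h2.2]
    · rw [hB, Finset.mem_filter, not_and] at htB
      have htB := htB ht
      push Not at htB
      set k := toIcoDiv Real.two_pi_pos (cutAngle m t) x with hk
      have h1 := toIcoMod_mem_Ico Real.two_pi_pos (cutAngle m t) x
      rw [toIcoMod, ← hk, zsmul_eq_mul] at h1
      have h2 := htB (k + 1) (by push_cast; linarith [h1.2])
      push_cast at h2
      rw [← hx, ← hx', cutCoord_eq (k := k) (by linarith [h1.1]) (by linarith [h1.2]),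
        cutCoord_eq (k := k) (by linarith [h1.1]) (by linarith)]
      rw [sub_sub_sub_cancel_right, abs_sub_comm, abs_of_nonneg (sub_nonneg.2 hle)]
      linarith
  refine (Finset.sum_le_sum hterm).trans ?_
  rw [Finset.sum_add_distrib, Finset.sum_const, Finset.card_range, nsmul_eq_mul,
    Finset.sum_ite_mem, Finset.inter_eq_right.2 (Finset.filter_subset _ _), Finset.sum_const,
    nsmul_eq_mul]
  have : (B.card : ℝ) * (2 * Real.pi) ≤ (m * d / (2 * Real.pi) + 1) * (2 * Real.pi) := by gcongr
  have e : (m * d / (2 * Real.pi) + 1) * (2 * Real.pi) = m * d + 2 * Real.pi := by field_simp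
  linarith

/-! ### Sorted points and shifts of the grid -/

lemma cutCoord_gridPoint {m : ℕ} (hm : 0 < m) {t j : ℕ} (hj : j < m) :
    cutCoord (cutAngle m t) (gridPoint m (t + j)) = 2 * Real.pi * (t + j) / m := by
  have hm0 : (0 : ℝ) < m := by exact_mod_cast hm
  have hpi := Real.pi_pos
  have hj' : (j : ℝ) + 1 ≤ m := by exact_mod_cast hj
  have e1 : 2 * Real.pi * (t + j) / m = cutAngle m t + (2 * Real.pi * j / m + Real.pi / m) := by
    rw [cutAngle]; ring
  have e2 : 2 * Real.pi * j / m + Real.pi / m < 2 * Real.pi := by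
    rw [← add_div, div_lt_iff₀ hm0]; nlinarith
  rw [gridPoint]
  push_cast
  rw [cutCoord_eq (k := 0)]
  · simp
  · rw [e1]
    have : 0 ≤ 2 * Real.pi * j / m + Real.pi / m := by positivity
    push_cast; linarith
  · rw [e1]; push_cast; linarith

/-- Points in trigonometric order become sorted after a cyclic shift and a cut of the circle. -/
lemma exists_monotone_shift {m : ℕ} [NeZero m] {z : Fin m → Circle} (hz : TrigonometricOrder z)
    (κ : ℝ) : ∃ l0 : Fin m, Monotone fun l : Fin m => cutCoord κ (z (l + l0)) := by
  obtain ⟨θ, hmono, hspread, hzθ⟩ := hz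
  have hm : 0 < m := Nat.pos_of_ne_zero (NeZero.ne m)
  have hpi := Real.two_pi_pos
  set o : Fin m := ⟨0, hm⟩ with ho
  -- the first turn that starts after the first point
  set k : ℤ := toIcoDiv Real.two_pi_pos κ (θ o) + 1 with hk
  have h0 := toIcoMod_mem_Ico Real.two_pi_pos κ (θ o)
  rw [toIcoMod, zsmul_eq_mul] at h0
  have hkR : (k : ℝ) = toIcoDiv Real.two_pi_pos κ (θ o) + 1 := by rw [hk]; push_cast; ring
  obtain ⟨h0a, h0b⟩ := h0
  have hK1 : θ o < κ + 2 * Real.pi * k := by rw [hkR]; linarith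
  have hK2 : κ + 2 * Real.pi * k ≤ θ o + 2 * Real.pi := by rw [hkR]; linarith
  have hot : ∀ l, θ o ≤ θ l := fun l => hmono (Fin.le_def.2 (Nat.zero_le _))
  have hcoordlt : ∀ l, θ l < κ + 2 * Real.pi * k →
      cutCoord κ (z l) = θ l - 2 * Real.pi * (k - 1 : ℤ) := by
    intro l hl
    rw [hzθ, cutCoord_eq (k := k - 1)]
    · push_cast; linarith [hot l]
    · push_cast; linarith
  have hcoordge : ∀ l, κ + 2 * Real.pi * k ≤ θ l →
      cutCoord κ (z l) = θ l - 2 * Real.pi * k := by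
    intro l hl
    rw [hzθ, cutCoord_eq (k := k)]
    · exact hl
    · linarith [hspread o l]
  by_cases hall : ∀ l, θ l < κ + 2 * Real.pi * k
  · refine ⟨o, fun a b hab => ?_⟩
    have : ∀ l : Fin m, l + o = l := fun l => by
      have : o = 0 := rfl
      rw [this, add_zero]
    simp only [this]
    rw [hcoordlt _ (hall _), hcoordlt _ (hall _)]
    linarith [hmono hab]
  · push Not at hall
    have hex : ∃ l : ℕ, ∃ h : l < m, κ + 2 * Real.pi * k ≤ θ ⟨l, h⟩ := by
      obtain ⟨l, hl⟩ := hall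
      exact ⟨l, l.2, hl⟩
    classical
    -- Here s is the first point past the cut. Starting from it, the cut coordinates increase; the
    -- points before s belong to the previous turn and come last.
    set s := Nat.find hex with hs
    obtain ⟨hsm, hsθ⟩ := Nat.find_spec hex
    have hbelow : ∀ l : Fin m, (l : ℕ) < s → θ l < κ + 2 * Real.pi * k := by
      intro l hl
      have := Nat.find_min hex hl
      push Not at this
      exact this l.2
    have habove : ∀ l : Fin m, s ≤ l → κ + 2 * Real.pi * k ≤ θ l := by
      intro l hl
      exact hsθ.trans (hmono (Fin.le_def.2 hl))
    have hsm' : s < m := hsm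
    refine ⟨⟨s, hsm'⟩, fun a b hab => ?_⟩
    have hab' : (a : ℕ) ≤ b := hab
    have hval : ∀ l : Fin m, ((l + ⟨s, hsm'⟩ : Fin m) : ℕ) = if l + s < m then l + s else l + s - m := by
      intro l
      rw [Fin.val_add]
      have := l.2
      split_ifs with h
      · exact Nat.mod_eq_of_lt h
      · rw [Nat.mod_eq_sub_mod (by simpa using h)]
        exact Nat.mod_eq_of_lt (by simp; omega)
    have hla := hval a
    have hlb := hval b
    simp only
    by_cases ha : (a : ℕ) + s < m
    · rw [if_pos ha] at hla
      rw [hcoordge _ (habove _ (by omega))]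
      by_cases hb : (b : ℕ) + s < m
      · rw [if_pos hb] at hlb
        rw [hcoordge _ (habove _ (by omega))]
        have : (a + ⟨s, hsm'⟩ : Fin m) ≤ b + ⟨s, hsm'⟩ := Fin.le_def.2 (by omega)
        linarith [hmono this]
      · rw [if_neg hb] at hlb
        have := b.2
        rw [hcoordlt _ (hbelow _ (by omega))]
        push_cast
        linarith [hspread (b + ⟨s, hsm'⟩) (a + ⟨s, hsm'⟩)]
    · rw [if_neg ha] at hla
      rw [if_neg (by omega)] at hlb
      have := a.2
      have := b.2
      rw [hcoordlt _ (hbelow _ (by omega)), hcoordlt _ (hbelow _ (by omega))]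
      have : (a + ⟨s, hsm'⟩ : Fin m) ≤ b + ⟨s, hsm'⟩ := Fin.le_def.2 (by omega)
      linarith [hmono this]

/-- If sorted points are `ℓ¹`-close to some labelling of the grid, then they are `ℓ¹`-close to a
cyclic shift of the grid. -/
lemma exists_shift_close {m : ℕ} [NeZero m] {z : Fin m → Circle} (hz : TrigonometricOrder z)
    (p : Fin m ≃ ZMod m) : ∃ k ∈ Set.Icc 1 m,
      ∑ l : Fin m, geoDist (gridPoint m (k + (l + 1))) (z l) ≤
        2 * ∑ l, geoDist (z l) (gridZ m (p l)) + 2 * Real.pi := by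
  have hm : 0 < m := Nat.pos_of_ne_zero (NeZero.ne m)
  have hm0 : (0 : ℝ) < m := by exact_mod_cast hm
  have hpi := Real.pi_pos
  -- Some cut costs no more than the average over the m cuts. The additive 2π per point becomes a
  -- single 2π in total.
  obtain ⟨t, -, ht⟩ : ∃ t ∈ Finset.range m,
      ∑ l, |cutCoord (cutAngle m t) (z l) - cutCoord (cutAngle m t) (gridZ m (p l))| ≤
        2 * ∑ l, geoDist (z l) (gridZ m (p l)) + 2 * Real.pi := by
    refine Finset.exists_le_of_sum_le ⟨0, Finset.mem_range.2 hm⟩ ?_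
    rw [Finset.sum_comm, Finset.sum_const, Finset.card_range, nsmul_eq_mul]
    refine (Finset.sum_le_sum fun l _ => sum_abs_cutCoord_sub_le hm (z l) _).trans (le_of_eq ?_)
    rw [Finset.sum_add_distrib, ← Finset.mul_sum, Finset.sum_const, Finset.card_univ,
      Fintype.card_fin, nsmul_eq_mul]
    ring
  obtain ⟨l0, hl0⟩ := exists_monotone_shift hz (cutAngle m t)
  set κ := cutAngle m t with hκ
  let toFin : ZMod m ≃ Fin m :=
    { toFun := fun a => ⟨a.val, ZMod.val_lt a⟩
      invFun := fun i => ((i : ℕ) : ZMod m)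
      left_inv := fun a => ZMod.natCast_zmod_val a
      right_inv := fun i => Fin.ext (ZMod.val_cast_of_lt i.2) }
  have hcut : ∀ j : Fin m, cutCoord κ (gridPoint m (t + j)) = 2 * Real.pi * (t + j) / m :=
    fun j => cutCoord_gridPoint hm j.2
  -- The labelling p, read in the order of the sorted points and relative to the cut, is a
  -- permutation of the ranks after the cut; this is the form needed for the rearrangement
  -- inequality.
  set r : Equiv.Perm (Fin m) :=
    ((Equiv.addRight l0).trans p).trans ((Equiv.subRight (t : ZMod m)).trans toFin) with hr
  have hrg : ∀ l, gridPoint m (t + r l) = gridZ m (p (l + l0)) := by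
    intro l
    rw [← gridZ_natCast]
    congr 1
    have : ((r l : ℕ) : ZMod m) = p (l + l0) - t := ZMod.natCast_zmod_val _
    push_cast
    rw [this]; ring
  have hg : Monotone fun j : Fin m => cutCoord κ (gridPoint m (t + j)) := by
    intro a b hab
    simp only [hcut]
    have : ((a : ℕ) : ℝ) ≤ (b : ℕ) := by exact_mod_cast hab
    gcongr
  have hrearr := sum_abs_sub_le_of_monotone hl0 hg r
  simp only [hrg] at hrearr
  have hreindex := Equiv.sum_comp (Equiv.addRight l0) fun l =>
    |cutCoord κ (z l) - cutCoord κ (gridZ m (p l))|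
  simp only [Equiv.coe_addRight] at hreindex
  rw [hreindex] at hrearr
  -- the shift
  set k := (t + 2 * m - l0 - 1 - 1) % m + 1 with hk
  have hl0m := l0.2
  refine ⟨k, ⟨by omega, ?_⟩, ?_⟩
  · have := Nat.mod_lt (t + 2 * m - l0 - 1 - 1) hm
    omega
  have hshift : ∀ l : Fin m, gridPoint m (k + (((l + l0 : Fin m) : ℕ) + 1)) = gridPoint m (t + l) := by
    intro l
    apply gridPoint_eq_of_cast (NeZero.ne m)
    have e1 : (((l + l0 : Fin m) : ℕ) : ZMod m) = (l : ℕ) + (l0 : ℕ) := by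
      rw [Fin.val_add, ZMod.natCast_mod]; push_cast; ring
    -- The term 2m prevents truncation in the natural subtraction and vanishes modulo m. Taking the
    -- remainder and then adding 1 puts k in [1, m] with k + l0 + 1 ≡ t.
    have e2 : (k : ZMod m) = t - (l0 : ℕ) - 1 := by
      have h3 : (((t + 2 * m - l0 - 1 - 1 : ℕ) : ℤ) : ZMod m) = ((t + 2 * m - l0 - 1 - 1 : ℤ) : ZMod m) := by
        congr 1; omega
      rw [hk]
      push_cast [ZMod.natCast_mod] at h3 ⊢
      rw [h3]
      simp
    push_cast
    rw [e1, e2]; ring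
  rw [← Equiv.sum_comp (Equiv.addRight l0)]
  simp only [Equiv.coe_addRight, hshift]
  refine le_trans (Finset.sum_le_sum fun l _ => ?_) (hrearr.trans ht)
  rw [geoDist_comm]
  exact geoDist_le_abs_cutCoord_sub κ _ _

/-- The image of the grid by an isometry is, up to a small error, a relabelling of the grid. -/
lemma exists_relabelling {m : ℕ} [NeZero m] (Q : ℂ ≃ₗᵢ[ℝ] ℂ) :
    ∃ p : ZMod m ≃ ZMod m, ∀ a, geoDist (orthAct Q (gridZ m a)) (gridZ m (p a)) ≤ Real.pi / m := by
  obtain ⟨c, hc⟩ := linear_isometry_complex Q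
  -- A rotation is replaced by the translation of indices closest to it, and a reflection by the
  -- same translation after negation.
  obtain ⟨b, hb⟩ := exists_gridZ_near (N := m) c
  rcases hc with hc | hc
  · refine ⟨Equiv.addLeft b, fun a => ?_⟩
    have : orthAct Q (gridZ m a) = gridZ m a * c := by
      apply Circle.ext
      rw [coe_orthAct, hc, rotation_apply, mul_comm, Circle.coe_mul]
    rw [this, Equiv.coe_addLeft, gridZ_add, mul_comm (gridZ m b), geoDist_mul_left]
    exact hb
  · refine ⟨(Equiv.neg _).trans (Equiv.addLeft b), fun a => ?_⟩
    have : orthAct Q (gridZ m a) = gridZ m (-a) * c := by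
      apply Circle.ext
      rw [coe_orthAct, hc, LinearIsometryEquiv.trans_apply, rotation_apply, mul_comm,
        Circle.coe_mul, gridZ_neg, Circle.coe_inv_eq_conj, Complex.conjLIE_apply]
    rw [this, Equiv.trans_apply, Equiv.coe_addLeft, Equiv.neg_apply, gridZ_add,
      mul_comm (gridZ m b), geoDist_mul_left]
    exact hb

/-- The uniform approximation step preserves `ℓ¹`-closeness to the grid. -/
theorem uniformApproximation_close {ι : Type*} [Fintype ι] {m : ℕ} [NeZero m] (τ : ι ≃ ZMod m)
    (Q : ℂ ≃ₗᵢ[ℝ] ℂ) {z x : ι → Circle} {σ : Fin (Fintype.card ι) ≃ ι} {k : ℕ}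
    (hσ : TrigonometricOrder fun l => z (σ l))
    (hmin : IsMinOn (shiftCost fun l => z (σ l)) (Set.Icc 1 (Fintype.card ι)) k)
    (hx : ∀ l : Fin (Fintype.card ι), x (σ l) = gridPoint (Fintype.card ι) (k + (l + 1))) :
    ∑ i, geoDist (x i) (orthAct Q (gridZ m (τ i))) ≤
      20 * ∑ i, ‖(z i : ℂ) - Q (gridZ m (τ i))‖ + 60 := by
  have hcard : Fintype.card ι = m := by rw [Fintype.card_congr τ, ZMod.card]
  obtain ⟨p, hp⟩ := exists_relabelling (m := m) Q
  have hm0 : (0 : ℝ) < m := by exact_mod_cast Nat.pos_of_ne_zero (NeZero.ne m)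
  set Δ := ∑ i, ‖(z i : ℂ) - Q (gridZ m (τ i))‖ with hΔ
  have hd : ∀ i, geoDist (z i) (gridZ m (p (τ i))) ≤
      2 * ‖(z i : ℂ) - Q (gridZ m (τ i))‖ + Real.pi / m := by
    intro i
    refine (geoDist_triangle _ (orthAct Q (gridZ m (τ i))) _).trans (add_le_add ?_ (hp _))
    exact geoDist_le_two_mul_norm_sub _ _
  have hD : ∑ i, geoDist (z i) (gridZ m (p (τ i))) ≤ 2 * Δ + Real.pi := by
    refine (Finset.sum_le_sum fun i _ => hd i).trans (le_of_eq ?_)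
    rw [Finset.sum_add_distrib, ← Finset.mul_sum, Finset.sum_const, Finset.card_univ, hcard,
      nsmul_eq_mul, mul_div_cancel₀ _ hm0.ne']
  have hΔ0 : 0 ≤ Δ := Finset.sum_nonneg fun i _ => norm_nonneg _
  obtain ⟨k', hk', hk'sum⟩ : ∃ k' ∈ Set.Icc 1 (Fintype.card ι),
      ∑ l : Fin (Fintype.card ι), geoDist (gridPoint (Fintype.card ι) (k' + (l + 1))) (z (σ l)) ≤
        2 * (2 * Δ + Real.pi) + 2 * Real.pi := by
    have : NeZero (Fintype.card ι) := ⟨by rw [hcard]; exact NeZero.ne m⟩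
    -- The shift is taken in the grid of size `Fintype.card ι`, which equals m only propositionally;
    -- this transport preserves the grid points.
    let cst : ZMod m ≃ ZMod (Fintype.card ι) := (ZMod.ringEquivCongr hcard.symm).toEquiv
    have hcst : ∀ a, gridZ (Fintype.card ι) (cst a) = gridZ m a := by
      intro a
      rw [gridZ, gridZ]
      congr 1
      exact ZMod.ringEquivCongr_val hcard.symm a
    obtain ⟨k', hk', h⟩ := exists_shift_close hσ (((σ.trans τ).trans p).trans cst)
    refine ⟨k', hk', h.trans ?_⟩
    have e : ∑ l, geoDist (z (σ l)) (gridZ (Fintype.card ι) (((((σ.trans τ).trans p).trans cst)) l)) =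
        ∑ i, geoDist (z i) (gridZ m (p (τ i))) := by
      rw [← Equiv.sum_comp σ]
      refine Finset.sum_congr rfl fun l _ => ?_
      rw [← hcst]; rfl
    linarith
  -- The optimal shift costs no more than the shift just built. The outer factor 2 is the price of
  -- the ℓ¹ norm against the Euclidean one.
  have hcost : shiftCost (fun l => z (σ l)) k ≤ 2 * (2 * (2 * Δ + Real.pi) + 2 * Real.pi) := by
    refine (hmin hk').trans ?_
    refine le_trans ?_ (mul_le_mul_of_nonneg_left hk'sum zero_le_two)
    rw [shiftCost, Finset.mul_sum]
    refine Finset.sum_le_sum fun l _ => (l1Norm_le _).trans ?_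
    gcongr
    exact norm_sub_le_geoDist _ _
  have hxz : ∑ i, ‖(x i : ℂ) - z i‖ ≤ 2 * (2 * (2 * Δ + Real.pi) + 2 * Real.pi) := by
    refine le_trans ?_ hcost
    rw [shiftCost, ← Equiv.sum_comp σ]
    refine Finset.sum_le_sum fun l _ => ?_
    rw [hx l]
    exact norm_le_l1Norm _
  have hfin : ∑ i, geoDist (x i) (orthAct Q (gridZ m (τ i))) ≤
      2 * (∑ i, ‖(x i : ℂ) - z i‖ + ∑ i, ‖(z i : ℂ) - Q (gridZ m (τ i))‖) := by
    rw [← Finset.sum_add_distrib, Finset.mul_sum]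
    refine Finset.sum_le_sum fun i _ => (geoDist_le_two_mul_norm_sub _ _).trans ?_
    gcongr
    exact norm_sub_le_norm_sub_add_norm_sub _ _ _
  have := Real.pi_lt_d2
  rw [← hΔ] at hfin
  linarith

/-! ### The refinement step -/

/-- The indices k + l + 1 exhaust the residues modulo m, so the initial positions visit each grid
point exactly once. Sums over S thereby become sums over `ZMod m`, where symmetries of the grid are
available. -/
lemma exists_grid_labelling {ι : Type*} [Fintype ι] {m : ℕ} [NeZero m]
    (hcard : Fintype.card ι = m) {y : ι → ℂ} {x : ι → Circle} (h : IsUniformApproximation y x) :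
    ∃ τ : ι ≃ ZMod m, ∀ i, x i = gridZ m (τ i) := by
  obtain ⟨z, σ, k, -, -, -, -, hx⟩ := h
  set φ : ι → ZMod m := fun i => ((k + ((σ.symm i : ℕ) + 1) : ℕ) : ZMod m) with hφ
  have hinj : Function.Injective φ := by
    intro i j hij
    simp only [hφ] at hij
    push_cast at hij
    have h1 : (((σ.symm i : ℕ)) : ZMod m) = ((σ.symm j : ℕ) : ZMod m) := by
      linear_combination hij
    rw [ZMod.natCast_eq_natCast_iff'] at h1
    rw [Nat.mod_eq_of_lt ((σ.symm i).2.trans_eq hcard),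
      Nat.mod_eq_of_lt ((σ.symm j).2.trans_eq hcard)] at h1
    exact σ.symm.injective (Fin.ext h1)
  have hbij : Function.Bijective φ :=
    (Fintype.bijective_iff_injective_and_card φ).2 ⟨hinj, by rw [hcard, ZMod.card]⟩
  refine ⟨Equiv.ofBijective φ hbij, fun i => ?_⟩
  have := hx (σ.symm i)
  rw [Equiv.apply_symm_apply] at this
  rw [Equiv.ofBijective_apply, this, hφ, gridZ_natCast]
  subst hcard
  rfl

lemma natAbs_valMinAbs_natCast {m : ℕ} [NeZero m] {N : ℕ} (hN : N ≤ m) :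
    min N (m - N) ≤ (N : ZMod m).valMinAbs.natAbs := by
  rcases Nat.lt_or_ge (m / 2) N with h | h
  · rcases hN.eq_or_lt with h' | h'
    · subst h'; simp
    · rw [ZMod.valMinAbs_natCast_of_half_lt h h']; omega
  · rw [ZMod.valMinAbs_natCast_of_le_half h]; simp

/-- Points c behind a, on the side away from b, see a closer than b by the full distance t, or by at
least t/2 if the path to b wraps around. At least m/8 points lie within m/8 steps behind a, and
(m/8)(t/2)² = m t²/32. -/
lemma sum_sq_geoDist_sub_ge {m : ℕ} [NeZero m] (a b : ZMod m) :
    (m : ℝ) / 32 * geoDist (gridZ m b) (gridZ m a) ^ 2 ≤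
      ∑ c, (geoDist (gridZ m b) (gridZ m c) - geoDist (gridZ m a) (gridZ m c)) ^ 2 := by
  classical
  have hm : 0 < m := Nat.pos_of_ne_zero (NeZero.ne m)
  have hm0 : (0 : ℝ) < m := by exact_mod_cast hm
  have hpi := Real.pi_pos
  set s := (b - a).valMinAbs.natAbs with hs
  have hsm : s ≤ m / 2 := ZMod.natAbs_valMinAbs_le _
  set t := geoDist (gridZ m b) (gridZ m a) with ht
  have hts : t = 2 * Real.pi / m * s := geoDist_gridZ b a
  obtain ⟨e, he, hbe⟩ : ∃ e : ZMod m, (e = 1 ∨ e = -1) ∧ b - a = e * s := by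
    rcases Int.natAbs_eq (b - a).valMinAbs with h | h
    · refine ⟨1, Or.inl rfl, ?_⟩
      rw [one_mul, ← Int.cast_natCast, hs, ← h, ZMod.coe_valMinAbs]
    · refine ⟨-1, Or.inr rfl, ?_⟩
      rw [neg_one_mul, ← Int.cast_natCast, hs, ← Int.cast_neg, ← h, ZMod.coe_valMinAbs]
  have hnat : ∀ N : ℕ, (e * (N : ZMod m)).valMinAbs.natAbs = (N : ZMod m).valMinAbs.natAbs := by
    intro N
    rcases he with rfl | rfl
    · rw [one_mul]
    · rw [neg_one_mul, ZMod.natAbs_valMinAbs_neg]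
  have hee : e * e = 1 := by rcases he with rfl | rfl <;> ring
  have hterm : ∀ j ∈ Finset.range (m / 8 + 1),
      t / 2 ≤ geoDist (gridZ m b) (gridZ m (a - e * j)) - geoDist (gridZ m a) (gridZ m (a - e * j)) := by
    intro j hj
    rw [Finset.mem_range] at hj
    have e1 : b - (a - e * j) = e * ((s + j : ℕ) : ZMod m) := by
      push_cast; linear_combination hbe
    have e2 : a - (a - e * j) = e * (j : ZMod m) := by ring
    rw [geoDist_gridZ, geoDist_gridZ, e1, e2, hnat, hnat]
    have h1 := natAbs_valMinAbs_natCast (m := m) (N := s + j) (by omega)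
    rw [ZMod.valMinAbs_natCast_of_le_half (show j ≤ m / 2 by omega), Int.natAbs_natCast, hts]
    have h2 : (s : ℝ) ≤ 2 * ((((s + j : ℕ) : ZMod m).valMinAbs.natAbs : ℝ) - j) := by
      have : s + 2 * j ≤ 2 * ((s + j : ℕ) : ZMod m).valMinAbs.natAbs := by
        refine le_trans ?_ (Nat.mul_le_mul_left 2 h1)
        omega
      have h3 : ((s + 2 * j : ℕ) : ℝ) ≤
        ((2 * ((s + j : ℕ) : ZMod m).valMinAbs.natAbs : ℕ) : ℝ) := Nat.cast_le.2 this
      push_cast at h3 ⊢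
      linarith
    rw [← mul_sub]
    have h3 : 2 * Real.pi / m * (s : ℝ) ≤ 2 * Real.pi / m *
      (2 * ((((s + j : ℕ) : ZMod m).valMinAbs.natAbs : ℝ) - j)) := by gcongr
    linarith
  have hinj : Set.InjOn (fun j : ℕ => a - e * (j : ZMod m)) (Finset.range (m / 8 + 1)) := by
    intro i hi j hj hij
    simp only [Finset.coe_range, Set.mem_Iio] at hi hj hij
    have h1 : (i : ZMod m) = j := by
      linear_combination (-e) * hij - ((i : ZMod m) - j) * hee
    rw [ZMod.natCast_eq_natCast_iff'] at h1
    rwa [Nat.mod_eq_of_lt (by omega), Nat.mod_eq_of_lt (by omega)] at h1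
  have ht0 : 0 ≤ t := geoDist_nonneg _ _
  calc (m : ℝ) / 32 * t ^ 2 ≤ ((m / 8 + 1 : ℕ) : ℝ) * (t / 2) ^ 2 := by
        have : (m : ℝ) / 8 ≤ ((m / 8 + 1 : ℕ) : ℝ) := by
          rw [div_le_iff₀ (by norm_num)]
          exact_mod_cast (by omega : m ≤ (m / 8 + 1) * 8)
        nlinarith [sq_nonneg t]
    _ = ∑ j ∈ Finset.range (m / 8 + 1), (t / 2) ^ 2 := by simp
    _ ≤ ∑ j ∈ Finset.range (m / 8 + 1), (geoDist (gridZ m b) (gridZ m (a - e * j)) -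
          geoDist (gridZ m a) (gridZ m (a - e * j))) ^ 2 := by
        refine Finset.sum_le_sum fun j hj => ?_
        have := hterm j hj
        gcongr
    _ = ∑ c ∈ (Finset.range (m / 8 + 1)).image (fun j : ℕ => a - e * (j : ZMod m)),
          (geoDist (gridZ m b) (gridZ m c) - geoDist (gridZ m a) (gridZ m c)) ^ 2 :=
        (Finset.sum_image (f := fun c => (geoDist (gridZ m b) (gridZ m c) -
          geoDist (gridZ m a) (gridZ m c)) ^ 2) hinj).symm
    _ ≤ _ := Finset.sum_le_sum_of_subset_of_nonneg (Finset.subset_univ _)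
        fun c _ _ => sq_nonneg _

/-- The signal in the refinement step: the population criterion grows quadratically. -/
lemma refinement_signal {n : ℕ} {cl cL ce : ℝ} {f : Circle → Circle → ℝ} (hcl : 0 ≤ cl)
    (hce : 0 ≤ ce) (hf : BiLipschitz n cl cL ce f) (hg : IsGeometric f) {m : ℕ} [NeZero m]
    (a b : ZMod m) :
    cl * m / 64 * geoDist (gridZ m b) (gridZ m a) ^ 2 -
        ce * √(Real.log n / n) * m / 2 * geoDist (gridZ m b) (gridZ m a) ≤
      ∑ c, f (gridZ m a) (gridZ m c) *
        (geoDist (gridZ m b) (gridZ m c) - geoDist (gridZ m a) (gridZ m c)) := by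
  obtain ⟨g, hg⟩ := hg
  set ε := ce * √(Real.log n / n) with hε
  have hε0 : 0 ≤ ε := by positivity
  set t := geoDist (gridZ m b) (gridZ m a) with ht
  set D : ZMod m → ℝ := fun c =>
    geoDist (gridZ m b) (gridZ m c) - geoDist (gridZ m a) (gridZ m c) with hD
  -- The reflection c ↦ a + b - c exchanges a and b and changes the sign of D. The sum is therefore
  -- half of the sum of (f(a, c) - f(b, c)) D(c), in which, up to ε, both factors have the same
  -- sign.
  have hrefl : ∀ c, geoDist (gridZ m a) (gridZ m (a + b - c)) = geoDist (gridZ m b) (gridZ m c) := by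
    intro c
    rw [geoDist_gridZ, geoDist_gridZ, show a - (a + b - c) = -(b - c) by ring,
      ZMod.natAbs_valMinAbs_neg]
  have hrefl' : ∀ c, geoDist (gridZ m b) (gridZ m (a + b - c)) = geoDist (gridZ m a) (gridZ m c) := by
    intro c
    rw [geoDist_gridZ, geoDist_gridZ, show b - (a + b - c) = -(a - c) by ring,
      ZMod.natAbs_valMinAbs_neg]
  have h1 : ∑ c, f (gridZ m a) (gridZ m c) * D c = - ∑ c, f (gridZ m b) (gridZ m c) * D c := by
    rw [← Equiv.sum_comp (Equiv.subLeft (a + b)), ← Finset.sum_neg_distrib]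
    refine Finset.sum_congr rfl fun c _ => ?_
    simp only [hD, Equiv.subLeft_apply, hg, hrefl, hrefl']
    ring
  have h2 : ∀ c, cl * D c ^ 2 - ε * t ≤
      (f (gridZ m a) (gridZ m c) - f (gridZ m b) (gridZ m c)) * D c := by
    intro c
    have hDt : |D c| ≤ t := abs_geoDist_sub_le _ _ _
    have hDc : D c = geoDist (gridZ m c) (gridZ m b) - geoDist (gridZ m c) (gridZ m a) := by
      simp only [hD, geoDist_comm _ (gridZ m c)]
    rw [hf.symm (gridZ m a), hf.symm (gridZ m b)]
    rw [abs_le] at hDt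
    rcases le_total 0 (D c) with h | h
    · have := hf.lower (gridZ m c) (gridZ m b) (gridZ m a) (by linarith)
      rw [← hDc, ← hε] at this
      nlinarith [mul_le_mul_of_nonneg_right this h]
    · have := hf.lower (gridZ m c) (gridZ m a) (gridZ m b) (by linarith)
      rw [show geoDist (gridZ m c) (gridZ m a) - geoDist (gridZ m c) (gridZ m b) = -D c by
        rw [hDc]; ring, ← hε] at this
      nlinarith [mul_le_mul_of_nonneg_right this (neg_nonneg.2 h)]
  have h3 := Finset.sum_le_sum fun c (_ : c ∈ Finset.univ) => h2 c
  simp only [sub_mul] at h3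
  rw [Finset.sum_sub_distrib, Finset.sum_sub_distrib, ← Finset.mul_sum, Finset.sum_const,
    Finset.card_univ, ZMod.card, nsmul_eq_mul] at h3
  have h4 := mul_le_mul_of_nonneg_left (sum_sq_geoDist_sub_ge a b) hcl
  linarith

/-- Deterministic analysis of the refinement of one point. -/
theorem refinement_close {n : ℕ} {cl cL ce : ℝ} {f : Circle → Circle → ℝ} (hcl : 0 < cl)
    (hcL : 0 ≤ cL) (hce : 0 ≤ ce) (hf : BiLipschitz n cl cL ce f) (hg : IsGeometric f)
    {m : ℕ} [NeZero m] {S : Finset (Fin n)} {A : Matrix (Fin n) (Fin n) ℝ} {x : Fin n → Circle}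
    {xt : S → Circle} (τ : S ≃ ZMod m) (hτ : ∀ j, xt j = gridZ m (τ j)) (Q : ℂ ≃ₗᵢ[ℝ] ℂ)
    {L s : ℝ} (hL : ∑ j, geoDist (xt j) (orthAct Q (x j)) ≤ L) (hs : 0 ≤ s) {i : Fin n}
    (hnoise : ∀ z ∈ regularGrid m, ∀ z' ∈ regularGrid m,
      -(s * √(∑ j, (geoDist z (xt j) - geoDist z' (xt j)) ^ 2)) ≤
        ∑ j : S, (A i j - f (x i) (x j)) * (geoDist z (xt j) - geoDist z' (xt j)))
    {y : Circle} (hy : y ∈ regularGrid m)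
    (hmin : IsMinOn (refineCost A S xt i) (regularGrid m) y) :
    geoDist y (orthAct Q (x i)) ≤ Real.pi / m + 64 / (cl * m) *
      (s * √m + cL * L + cL * Real.pi + 3 * (m * (ce * √(Real.log n / n)))) := by
  have hm0 : (0 : ℝ) < m := by exact_mod_cast Nat.pos_of_ne_zero (NeZero.ne m)
  have hpi := Real.pi_pos
  obtain ⟨b, rfl⟩ := exists_gridZ_of_mem hy
  obtain ⟨a, ha⟩ := exists_gridZ_near (N := m) (orthAct Q (x i))
  set ε := ce * √(Real.log n / n) with hε
  have hε0 : 0 ≤ ε := by positivity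
  have hL0 : 0 ≤ L := le_trans (Finset.sum_nonneg fun j _ => geoDist_nonneg _ _) hL
  set t := geoDist (gridZ m b) (gridZ m a) with ht
  have ht0 : 0 ≤ t := geoDist_nonneg _ _
  set B : S → ℝ := fun j => geoDist (gridZ m b) (xt j) - geoDist (gridZ m a) (xt j) with hB
  have hBt : ∀ j, |B j| ≤ t := fun j => abs_geoDist_sub_le _ _ _
  have hcardS : Fintype.card S = m := by rw [Fintype.card_congr τ, ZMod.card]
  -- The comparison point is a, the grid point nearest to the target. The criterion difference
  -- splits into noise, signal and bias, all but the quadratic signal being at most linear in t.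
  have h1 : ∑ j : S, A i j * B j ≤ 0 := by
    have := hmin (gridZ_mem_regularGrid a)
    simp only [Set.mem_ofPred_eq, refineCost] at this
    simp only [hB, mul_sub, Finset.sum_sub_distrib]
    linarith
  have h2 : -(s * (t * √m)) ≤ ∑ j : S, (A i j - f (x i) (x j)) * B j := by
    refine le_trans ?_ (hnoise _ hy _ (gridZ_mem_regularGrid a))
    rw [neg_le_neg_iff]
    gcongr
    rw [← Real.sqrt_sq ht0, ← Real.sqrt_mul (sq_nonneg t)]
    apply Real.sqrt_le_sqrt
    calc ∑ j, B j ^ 2 ≤ ∑ j : S, t ^ 2 := Finset.sum_le_sum fun j _ => sq_le_sq.2 (by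
          rw [abs_of_nonneg ht0]; exact hBt j)
      _ = t ^ 2 * m := by
          rw [Finset.sum_const, Finset.card_univ, hcardS, nsmul_eq_mul, mul_comm]
  have h3 : cl * m / 64 * t ^ 2 - ε * m / 2 * t ≤ ∑ j : S, f (gridZ m a) (xt j) * B j := by
    refine (refinement_signal hcl.le hce hf hg a b).trans (le_of_eq ?_)
    rw [← Equiv.sum_comp τ]
    refine Finset.sum_congr rfl fun j _ => ?_
    simp only [hB, hτ]
  -- The bias: by geometricity the isometry Q can be applied to both arguments of f at no cost.
  -- Replacing both by grid positions costs the localization error L plus one grid step per point.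
  have h4 : -(t * (cL * L + cL * Real.pi + 2 * (m * ε))) ≤
      ∑ j : S, (f (x i) (x j) - f (gridZ m a) (xt j)) * B j := by
    have hdiff : ∀ j : S, |f (x i) (x j) - f (gridZ m a) (xt j)| ≤
        cL * geoDist (xt j) (orthAct Q (x j)) + ε + (cL * (Real.pi / m) + ε) := by
      intro j
      obtain ⟨g, hg'⟩ := hg
      have e1 : f (x i) (x j) = f (orthAct Q (x i)) (orthAct Q (x j)) := by
        rw [hg', hg', geoDist_orthAct]
      have e2 := hf.upper (orthAct Q (x i)) (orthAct Q (x j)) (xt j)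
      have e3 := hf.upper (xt j) (orthAct Q (x i)) (gridZ m a)
      rw [hf.symm (xt j), hf.symm (xt j)] at e3
      have e4 : cL * geoDist (orthAct Q (x i)) (gridZ m a) ≤ cL * (Real.pi / m) := by gcongr
      rw [geoDist_comm (orthAct Q (x j))] at e2
      rw [e1]
      have := abs_sub_le (f (orthAct Q (x i)) (orthAct Q (x j))) (f (orthAct Q (x i)) (xt j))
        (f (gridZ m a) (xt j))
      linarith
    have h5 : ∑ j : S, |f (x i) (x j) - f (gridZ m a) (xt j)| ≤
        cL * L + cL * Real.pi + 2 * (m * ε) := by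
      refine (Finset.sum_le_sum fun j _ => hdiff j).trans ?_
      rw [Finset.sum_add_distrib, Finset.sum_add_distrib, ← Finset.mul_sum, Finset.sum_const,
        Finset.sum_const, Finset.card_univ, hcardS, nsmul_eq_mul, nsmul_eq_mul]
      have e1 : (m : ℝ) * (cL * (Real.pi / m) + ε) = cL * Real.pi + m * ε := by field_simp
      have e2 : cL * ∑ j, geoDist (xt j) (orthAct Q (x j)) ≤ cL * L := by gcongr
      linarith
    have h6 : |∑ j : S, (f (x i) (x j) - f (gridZ m a) (xt j)) * B j| ≤
        t * (cL * L + cL * Real.pi + 2 * (m * ε)) := by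
      refine (Finset.abs_sum_le_sum_abs _ _).trans ?_
      refine le_trans ?_ (mul_le_mul_of_nonneg_left h5 ht0)
      rw [Finset.mul_sum]
      refine Finset.sum_le_sum fun j _ => ?_
      rw [abs_mul, mul_comm]
      exact mul_le_mul_of_nonneg_right (hBt j) (abs_nonneg _)
    exact (abs_le.1 h6).1
  have h5 : ∑ j : S, A i j * B j = ∑ j : S, (A i j - f (x i) (x j)) * B j +
      ∑ j : S, f (gridZ m a) (xt j) * B j +
      ∑ j : S, (f (x i) (x j) - f (gridZ m a) (xt j)) * B j := by
    rw [← Finset.sum_add_distrib, ← Finset.sum_add_distrib]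
    exact Finset.sum_congr rfl fun j _ => by ring
  -- One factor t cancels against the quadratic signal. The coefficient 3 absorbs 2 from the bias
  -- and 1/2 from the signal.
  set R := s * √m + cL * L + cL * Real.pi + 3 * (m * ε) with hR
  have hR0 : 0 ≤ R := by positivity
  have h6 : t ≤ 64 / (cl * m) * R := by
    rcases ht0.eq_or_lt with h | h
    · rw [← h]; positivity
    · have h7 : cl * m / 64 * t * t ≤ R * t := by
        have : 0 ≤ m * ε * t := by positivity
        rw [hR]
        linarith
      have h8 := le_of_mul_le_mul_right h7 h
      rw [div_mul_eq_mul_div, le_div_iff₀ (by positivity)]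
      linarith
  have h7 := geoDist_triangle (gridZ m b) (gridZ m a) (orthAct Q (x i))
  rw [geoDist_comm (gridZ m a)] at h7
  linarith

/-! ### The merging step -/

/-- Two isometries that almost agree on two non-collinear points almost agree everywhere. -/
lemma geoDist_orthAct_le_of_two_points {Q R : ℂ ≃ₗᵢ[ℝ] ℂ} {p q : Circle} {δ : ℝ}
    (hp : geoDist (orthAct Q p) (orthAct R p) ≤ δ) (hq : geoDist (orthAct Q q) (orthAct R q) ≤ δ)
    (hpq : 1 / 5 ≤ |(starRingEnd ℂ (p : ℂ) * q).im|) (w : Circle) :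
    geoDist (orthAct Q w) (orthAct R w) ≤ 20 * δ := by
  -- Im(p̄q) is the determinant of (p, q), so this is Cramer's rule for w in the basis p, q.
  -- Dividing by |d| ≥ 1/5 and passing from chords to arcs gives 20 = 2 · 5 · 2.
  set d := (starRingEnd ℂ (p : ℂ) * q).im with hd
  set α := (starRingEnd ℂ (w : ℂ) * q).im with hα
  set β := (starRingEnd ℂ (p : ℂ) * w).im with hβ
  have hid : d • (w : ℂ) = α • (p : ℂ) + β • (q : ℂ) := by
    apply Complex.ext
    · simp only [hd, hα, hβ, Complex.add_re, Complex.smul_re, Complex.mul_im, Complex.conj_re,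
        Complex.conj_im, smul_eq_mul]
      ring
    · simp only [hd, hα, hβ, Complex.add_im, Complex.smul_im, Complex.mul_im, Complex.conj_re,
        Complex.conj_im, smul_eq_mul]
      ring
  have hα1 : |α| ≤ 1 := (Complex.abs_im_le_norm _).trans_eq
    (by rw [norm_mul, RCLike.norm_conj, Circle.norm_coe, Circle.norm_coe, one_mul])
  have hβ1 : |β| ≤ 1 := (Complex.abs_im_le_norm _).trans_eq
    (by rw [norm_mul, RCLike.norm_conj, Circle.norm_coe, Circle.norm_coe, one_mul])
  have hp' := (norm_sub_le_geoDist _ _).trans hp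
  have hq' := (norm_sub_le_geoDist _ _).trans hq
  simp only [coe_orthAct] at hp' hq'
  have h1 : d • (Q w - R w) = α • (Q p - R p) + β • (Q q - R q) := by
    have hQ := congrArg Q hid
    have hR := congrArg R hid
    simp only [map_add, map_smul] at hQ hR
    rw [smul_sub, hQ, hR, smul_sub, smul_sub]; abel
  have h2 : |d| * ‖Q w - R w‖ ≤ 2 * δ := by
    rw [← Real.norm_eq_abs, ← norm_smul, h1]
    refine (norm_add_le _ _).trans ?_
    rw [norm_smul, norm_smul, Real.norm_eq_abs, Real.norm_eq_abs]
    have e1 := mul_le_mul_of_nonneg_right hα1 (norm_nonneg (Q p - R p))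
    have e2 := mul_le_mul_of_nonneg_right hβ1 (norm_nonneg (Q q - R q))
    linarith
  have h3 := mul_le_mul_of_nonneg_right hpq (norm_nonneg (Q w - R w))
  have h4 := geoDist_le_two_mul_norm_sub (orthAct Q w) (orthAct R w)
  simp only [coe_orthAct] at h4
  linarith

/-- Deterministic analysis of the merging step. -/
theorem merging_close {n : ℕ} {S S' : Finset (Fin n)} (hdisj : Disjoint S S')
    {x y y' xhat : Fin n → Circle} {Q Q' Qhat : ℂ ≃ₗᵢ[ℝ] ℂ} {δ : ℝ} (hδ : 0 ≤ δ)
    (hy : ∀ i, i ∉ S → geoDist (y i) (orthAct Q (x i)) ≤ δ)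
    (hy' : ∀ i, i ∉ S' → geoDist (y' i) (orthAct Q' (x i)) ≤ δ)
    (hmin : ∀ Q : ℂ ≃ₗᵢ[ℝ] ℂ, mergeCost S S' y y' Qhat ≤ mergeCost S S' y y' Q)
    (hxhat : ∀ j, xhat j = if j ∈ S then orthAct Qhat (y' j) else y j)
    {i j : Fin n} (hi : i ∈ Sᶜ ∩ S'ᶜ) (hj : j ∈ Sᶜ ∩ S'ᶜ)
    (hij : 1 / 5 ≤ |(starRingEnd ℂ (x i : ℂ) * x j).im|) (k : Fin n) :
    geoDist (xhat k) (orthAct Q (x k)) ≤ 81 * δ := by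
  -- The competitor Q ∘ Q'⁻¹ carries the second reference frame to the first.
  have hcost : mergeCost S S' y y' Qhat ≤ 2 * δ := by
    refine (hmin (Q'.symm.trans Q)).trans ?_
    have : Nonempty (Sᶜ ∩ S'ᶜ : Finset (Fin n)) := ⟨⟨i, hi⟩⟩
    refine dInf_le fun l => ?_
    obtain ⟨l, hl⟩ := l
    rw [Finset.mem_inter, Finset.mem_compl, Finset.mem_compl] at hl
    have h1 := geoDist_triangle (y l) (orthAct Q (x l)) (orthAct (Q'.symm.trans Q) (y' l))
    have h2 : geoDist (orthAct Q (x l)) (orthAct (Q'.symm.trans Q) (y' l)) ≤ δ := by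
      rw [← orthAct_orthAct, geoDist_orthAct, ← geoDist_orthAct Q', orthAct_orthAct_symm,
        geoDist_comm]
      exact hy' l hl.2
    linarith [hy l hl.1]
  -- 4δ is the merging cost 2δ plus one refinement error from each half. The two-point stability
  -- turns it into 80δ everywhere, and a last refinement error gives 81δ.
  have hagree : ∀ l ∈ Sᶜ ∩ S'ᶜ,
      geoDist (orthAct Q (x l)) (orthAct (Q'.trans Qhat) (x l)) ≤ 4 * δ := by
    intro l hl
    have h0 := (geoDist_le_dInf (fun i : (Sᶜ ∩ S'ᶜ : Finset (Fin n)) => y i)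
      (fun i => orthAct Qhat (y' i)) ⟨l, hl⟩).trans hcost
    simp only at h0
    rw [Finset.mem_inter, Finset.mem_compl, Finset.mem_compl] at hl
    have h1 := geoDist_triangle (orthAct Q (x l)) (y l) (orthAct (Q'.trans Qhat) (x l))
    have h2 := geoDist_triangle (y l) (orthAct Qhat (y' l)) (orthAct (Q'.trans Qhat) (x l))
    rw [← orthAct_orthAct, geoDist_orthAct] at h2
    rw [← orthAct_orthAct, geoDist_comm _ (y l)] at h1
    rw [← orthAct_orthAct]
    linarith [hy l hl.1, hy' l hl.2]
  have hall := geoDist_orthAct_le_of_two_points (hagree i hi) (hagree j hj) hij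
  rw [hxhat]
  split_ifs with hk
  · have hk' : k ∉ S' := Finset.disjoint_left.1 hdisj hk
    have h1 := geoDist_triangle (orthAct Qhat (y' k)) (orthAct (Q'.trans Qhat) (x k))
      (orthAct Q (x k))
    have h2 := hall (x k)
    rw [← orthAct_orthAct, geoDist_orthAct] at h1
    rw [← orthAct_orthAct, geoDist_comm] at h2
    linarith [hy' k hk']
  · linarith [hy k hk]

/-! ### Existence of two non-collinear points -/

lemma two_fifths_le_sin {x : ℝ} (h1 : Real.pi / 5 ≤ x) (h2 : x ≤ 4 * Real.pi / 5) :
    2 / 5 ≤ Real.sin x := by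
  have hpi := Real.pi_pos
  wlog h : x ≤ Real.pi / 2 generalizing x
  · rw [← Real.sin_pi_sub]
    exact this (by linarith) (by linarith) (by linarith)
  refine le_trans ?_ (Real.mul_le_sin (by linarith) h)
  calc (2 : ℝ) / 5 = 2 / Real.pi * (Real.pi / 5) := by field_simp
    _ ≤ _ := by gcongr

lemma two_fifths_le_abs_im_gridZ {n : ℕ} [NeZero n] {a : ZMod n} (h1 : n ≤ 10 * a.valMinAbs.natAbs)
    (h2 : 5 * a.valMinAbs.natAbs ≤ 2 * n) : 2 / 5 ≤ |(gridZ n a : ℂ).im| := by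
  have hn : (0 : ℝ) < n := by exact_mod_cast Nat.pos_of_ne_zero (NeZero.ne n)
  have hpi := Real.pi_pos
  set v := a.valMinAbs with hv
  have e1 : (gridZ n a : ℂ).im = Real.sin (2 * Real.pi * v / n) := by
    rw [← ZMod.coe_valMinAbs a, gridZ_intCast, Circle.coe_exp, Complex.exp_ofReal_mul_I_im]
  have e2 : |Real.sin (2 * Real.pi * v / n)| = |Real.sin (2 * Real.pi * v.natAbs / n)| := by
    rcases Int.natAbs_eq v with h | h
    · rw [show (v : ℝ) = (v.natAbs : ℝ) by
        conv_lhs => rw [h]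
        simp]
    · rw [show (v : ℝ) = -(v.natAbs : ℝ) by
        conv_lhs => rw [h]
        simp, mul_neg, neg_div, Real.sin_neg, abs_neg]
  have h1' : (n : ℝ) ≤ 10 * v.natAbs := by exact_mod_cast h1
  have h2' : 5 * (v.natAbs : ℝ) ≤ 2 * n := by exact_mod_cast h2
  rw [e1, e2]
  refine le_trans (two_fifths_le_sin ?_ ?_) (le_abs_self _)
  · rw [div_le_div_iff₀ (by norm_num) hn]; nlinarith
  · rw [div_le_div_iff₀ hn (by norm_num)]; nlinarith

/-- Fix one point of U. A label almost collinear with it differs by less than n/10 or by more than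
2n/5, which leaves room for about 2n/5 labels only, fewer than U contains. On the grid the
determinant is at least 2/5, and moving both points by 1/10 costs at most 1/5. -/
lemma exists_not_collinear {n : ℕ} (hn : 40 ≤ n) {U : Finset (Fin n)} (hU : n ≤ 2 * U.card)
    (σ : Equiv.Perm (Fin n)) {x : Fin n → Circle}
    (hx : ∀ j, geoDist (x j) (gridPoint n (σ j)) ≤ 1 / 10) :
    ∃ i ∈ U, ∃ j ∈ U, 1 / 5 ≤ |(starRingEnd ℂ (x i : ℂ) * x j).im| := by
  have : NeZero n := ⟨by omega⟩
  obtain ⟨i, hi⟩ : U.Nonempty := Finset.card_pos.1 (by omega)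
  refine ⟨i, hi, ?_⟩
  by_contra hcon
  push Not at hcon
  set v : Fin n → ℤ := fun j => (((σ j : ℕ) : ZMod n) - ((σ i : ℕ) : ZMod n)).valMinAbs with hv
  have hinj : Set.InjOn v U := by
    intro a _ b _ hab
    have h1 := ZMod.valMinAbs_inj.1 hab
    have h2 : ((σ a : ℕ) : ZMod n) = ((σ b : ℕ) : ZMod n) := by linear_combination h1
    rw [ZMod.natCast_eq_natCast_iff', Nat.mod_eq_of_lt (σ a).2, Nat.mod_eq_of_lt (σ b).2] at h2
    exact σ.injective (Fin.ext h2)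
  have hbad : ∀ j ∈ U, 10 * (v j).natAbs < n ∨ 2 * n < 5 * (v j).natAbs := by
    intro j hj
    by_contra hc
    push Not at hc
    have h1 := two_fifths_le_abs_im_gridZ hc.1 hc.2
    rw [sub_eq_add_neg, gridZ_add, gridZ_neg, gridZ_natCast, gridZ_natCast, Circle.coe_mul,
      Circle.coe_inv_eq_conj, mul_comm] at h1
    have h2 := hcon j hj
    have e1 := (norm_sub_le_geoDist _ _).trans (hx i)
    have e2 := (norm_sub_le_geoDist _ _).trans (hx j)
    set p : ℂ := ((gridPoint n (σ i) : Circle) : ℂ)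
    set q : ℂ := ((gridPoint n (σ j) : Circle) : ℂ) with hq
    have e3 : starRingEnd ℂ p * q - starRingEnd ℂ (x i : ℂ) * x j =
        -(starRingEnd ℂ ((x i : ℂ) - p) * q) + -(starRingEnd ℂ (x i : ℂ) * (x j - q)) := by
      rw [map_sub]; ring
    have e4 : ‖starRingEnd ℂ p * q - starRingEnd ℂ (x i : ℂ) * x j‖ ≤ 1 / 10 + 1 / 10 := by
      rw [e3]
      refine (norm_add_le _ _).trans ?_
      rw [norm_neg, norm_neg, norm_mul, norm_mul, RCLike.norm_conj, RCLike.norm_conj,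
        Circle.norm_coe, hq, Circle.norm_coe, mul_one, one_mul]
      exact add_le_add e1 e2
    have e5 := (Complex.abs_im_le_norm _).trans e4
    rw [Complex.sub_im] at e5
    have e6 := abs_sub_abs_le_abs_sub (starRingEnd ℂ p * q).im (starRingEnd ℂ (x i : ℂ) * x j).im
    linarith
  have hsub : U.image v ⊆ Finset.Icc (-(n / 10 : ℕ) : ℤ) (n / 10 : ℕ) ∪
      (Finset.Icc ((2 * n / 5 + 1 : ℕ) : ℤ) (n / 2 : ℕ) ∪
        Finset.Icc (-(n / 2 : ℕ) : ℤ) (-(2 * n / 5 + 1 : ℕ) : ℤ)) := by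
    intro w hw
    rw [Finset.mem_image] at hw
    obtain ⟨j, hj, rfl⟩ := hw
    have h1 := hbad j hj
    have h2 : (v j).natAbs ≤ n / 2 := ZMod.natAbs_valMinAbs_le _
    simp only [Finset.mem_union, Finset.mem_Icc]
    omega
  have hcard := Finset.card_le_card hsub
  rw [Finset.card_image_of_injOn hinj] at hcard
  have h1 := hcard.trans (Finset.card_union_le _ _)
  have h2 := Finset.card_union_le (Finset.Icc ((2 * n / 5 + 1 : ℕ) : ℤ) (n / 2 : ℕ))
    (Finset.Icc (-(n / 2 : ℕ) : ℤ) (-(2 * n / 5 + 1 : ℕ) : ℤ))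
  simp only [Int.card_Icc] at h1 h2
  omega

/-! ### Sampling without replacement -/

/-- Up to normalization these are the weights of the binomial law with parameters 4m and 1/4. Ratios
of consecutive weights show that the mode is m. -/
lemma choose_mul_three_pow_le {m k : ℕ} (hk : k ≤ 4 * m) :
    (4 * m).choose k * 3 ^ (4 * m - k) ≤ (4 * m).choose m * 3 ^ (4 * m - m) := by
  have hrec : ∀ k < 4 * m, 3 * (k + 1) * ((4 * m).choose (k + 1) * 3 ^ (4 * m - (k + 1))) =
      (4 * m - k) * ((4 * m).choose k * 3 ^ (4 * m - k)) := by
    intro k hk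
    have h1 := Nat.choose_succ_right_eq (4 * m) k
    have h2 : 3 ^ (4 * m - k) = 3 * 3 ^ (4 * m - (k + 1)) := by
      rw [← pow_succ']; congr 1; omega
    rw [h2]
    calc _ = ((4 * m).choose (k + 1) * (k + 1)) * (3 * 3 ^ (4 * m - (k + 1))) := by ring
      _ = _ := by rw [h1]; ring
  rcases le_total k m with h | h
  · have hup : ∀ j, k ≤ j → j ≤ m → (4 * m).choose k * 3 ^ (4 * m - k) ≤
        (4 * m).choose j * 3 ^ (4 * m - j) := by
      intro j hj
      induction j, hj using Nat.le_induction with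
      | base => intro _; exact le_rfl
      | succ j hj ih =>
        intro hjm
        refine (ih (by omega)).trans ?_
        have h1 := hrec j (by omega)
        have h2 : 3 * (j + 1) ≤ 4 * m - j := by omega
        have h3 := Nat.mul_le_mul_right ((4 * m).choose j * 3 ^ (4 * m - j)) h2
        rw [← h1] at h3
        exact Nat.le_of_mul_le_mul_left h3 (by omega)
    exact hup m h le_rfl
  · induction k, h using Nat.le_induction with
    | base => exact le_rfl
    | succ j hj ih =>
      refine le_trans ?_ (ih (by omega))
      have h1 := hrec j (by omega)
      have h2 : 4 * m - j ≤ 3 * (j + 1) := by omega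
      have h3 := Nat.mul_le_mul_right ((4 * m).choose j * 3 ^ (4 * m - j)) h2
      rw [← h1] at h3
      exact Nat.le_of_mul_le_mul_left h3 (by omega)

/-- The mode carries at least the average mass of the 4m + 1 values. Conditioning independent
Bernoulli(1/4) choices on selecting exactly m elements thus costs only a factor 4m + 1. -/
lemma four_pow_le (m : ℕ) :
    (4 : ℝ) ^ (4 * m) ≤ ((4 * m : ℕ) + 1) * ((4 * m).choose m * 3 ^ (4 * m - m)) := by
  have h : (4 : ℕ) ^ (4 * m) ≤ (4 * m + 1) * ((4 * m).choose m * 3 ^ (4 * m - m)) := by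
    calc (4 : ℕ) ^ (4 * m) = (1 + 3) ^ (4 * m) := by norm_num
      _ = ∑ k ∈ Finset.range (4 * m + 1), (4 * m).choose k * 3 ^ (4 * m - k) := by
        rw [add_pow]
        refine Finset.sum_congr rfl fun k _ => ?_
        simp [mul_comm]
      _ ≤ ∑ k ∈ Finset.range (4 * m + 1), (4 * m).choose m * 3 ^ (4 * m - m) := by
        refine Finset.sum_le_sum fun k hk => choose_mul_three_pow_le ?_
        rw [Finset.mem_range] at hk; omega
      _ = _ := by simp
  exact_mod_cast h

/-- An exponential tail bound for the hypergeometric distribution, in counting form. -/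
lemma card_hypergeometric_tail_le {N m : ℕ} (hN : N = 4 * m) (I : Finset (Fin N)) {l T : ℝ}
    (hl0 : 0 ≤ l) (hl1 : l ≤ 1) :
    (((Finset.powersetCard m (Finset.univ : Finset (Fin N))).filter
      fun S => T < ((S ∩ I).card : ℝ) - I.card / 4).card : ℝ) ≤
      (N + 1) * N.choose m * Real.exp (-l * T + l ^ 2 * N / 4) := by
  classical
  set bad := (Finset.powersetCard m (Finset.univ : Finset (Fin N))).filter
      fun S => T < ((S ∩ I).card : ℝ) - I.card / 4 with hbad
  -- Extending the sum to all subsets with weight 3^(N - |S|) makes the exponential moment factorize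
  -- over the elements. The factor is bounded with e^l ≤ 1 + l + l², valid for 0 ≤ l ≤ 1.
  have hmgf : ∑ S ∈ bad, Real.exp (l * (S ∩ I).card) * 3 ^ (N - m) ≤
      4 ^ N * Real.exp (I.card * ((l + l ^ 2) / 4)) := by
    calc ∑ S ∈ bad, Real.exp (l * (S ∩ I).card) * 3 ^ (N - m)
        = ∑ S ∈ bad, (∏ i ∈ S, if i ∈ I then Real.exp l else 1) *
            ∏ i ∈ Finset.univ \ S, (3 : ℝ) := by
          refine Finset.sum_congr rfl fun S hS => ?_
          rw [hbad, Finset.mem_filter, Finset.mem_powersetCard] at hS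
          rw [Finset.prod_const, Finset.card_sdiff_of_subset (Finset.subset_univ _),
            Finset.card_univ, Fintype.card_fin, hS.1.2, Finset.prod_ite, Finset.prod_const,
            Finset.prod_const_one, mul_one, ← Real.exp_nat_mul, Finset.filter_mem_eq_inter,
            mul_comm l]
      _ ≤ ∑ S ∈ (Finset.univ : Finset (Fin N)).powerset,
            (∏ i ∈ S, if i ∈ I then Real.exp l else 1) * ∏ i ∈ Finset.univ \ S, (3 : ℝ) := by
          refine Finset.sum_le_sum_of_subset_of_nonneg (by simp) fun S _ _ => ?_
          refine mul_nonneg (Finset.prod_nonneg fun i _ => ?_) (Finset.prod_nonneg fun i _ => ?_)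
          · split_ifs <;> positivity
          · norm_num
      _ = ∏ i : Fin N, ((if i ∈ I then Real.exp l else 1) + 3) := (Finset.prod_add _ _ _).symm
      _ ≤ ∏ i : Fin N, (4 * if i ∈ I then Real.exp ((l + l ^ 2) / 4) else 1) := by
          refine Finset.prod_le_prod (fun i _ => ?_) fun i _ => ?_
          · split_ifs <;> positivity
          · split_ifs
            · have h1 := Real.abs_exp_sub_one_sub_id_le (x := l) (by rwa [abs_of_nonneg hl0])
              have h2 := (abs_le.1 h1).2
              have h3 := Real.add_one_le_exp ((l + l ^ 2) / 4)
              linarith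
            · norm_num
      _ = 4 ^ N * Real.exp (I.card * ((l + l ^ 2) / 4)) := by
          rw [Finset.prod_mul_distrib, Finset.prod_const, Finset.card_univ, Fintype.card_fin,
            Finset.prod_ite_mem, Finset.univ_inter, Finset.prod_const, ← Real.exp_nat_mul]
  have hlow : (bad.card : ℝ) * (Real.exp (l * (T + I.card / 4)) * 3 ^ (N - m)) ≤
      ∑ S ∈ bad, Real.exp (l * (S ∩ I).card) * 3 ^ (N - m) := by
    rw [← nsmul_eq_mul]
    refine Finset.card_nsmul_le_sum _ _ _ fun S hS => ?_
    rw [hbad, Finset.mem_filter] at hS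
    gcongr
    linarith [hS.2]
  have h0 := four_pow_le m
  rw [← hN] at h0
  have h4 := hlow.trans (hmgf.trans (mul_le_mul_of_nonneg_right h0 (Real.exp_pos _).le))
  have h3pos : (0 : ℝ) < 3 ^ (N - m) := by positivity
  have h5 : (bad.card : ℝ) * Real.exp (l * (T + I.card / 4)) ≤
      ((N : ℕ) + 1) * N.choose m * Real.exp (I.card * ((l + l ^ 2) / 4)) := by
    refine le_of_mul_le_mul_right ?_ h3pos
    linarith
  have h6 : (bad.card : ℝ) ≤ ((N : ℕ) + 1) * N.choose m *
      (Real.exp (I.card * ((l + l ^ 2) / 4)) * Real.exp (-(l * (T + I.card / 4)))) := by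
    rw [← mul_assoc, Real.exp_neg, ← div_eq_mul_inv, le_div_iff₀ (Real.exp_pos _)]
    exact h5
  refine h6.trans ?_
  rw [← Real.exp_add]
  refine mul_le_mul_of_nonneg_left (Real.exp_le_exp.2 ?_) (by positivity)
  have h7 : (I.card : ℝ) ≤ N := by
    have := Finset.card_le_univ I
    rw [Fintype.card_fin] at this
    exact_mod_cast this
  nlinarith [mul_le_mul_of_nonneg_right h7 (sq_nonneg l)]

/-- The initial segments of the labels in `S` have almost the expected sizes. -/
def WellSpread {n : ℕ} (σ : Equiv.Perm (Fin n)) (T : ℝ) (S : Finset (Fin n)) : Prop :=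
  ∀ k ≤ n, |((S.filter fun j => (σ j : ℕ) < k).card : ℝ) - k / 4| ≤ T

lemma card_filter_perm_lt {n : ℕ} (σ : Equiv.Perm (Fin n)) {k : ℕ} (hk : k ≤ n) :
    (Finset.univ.filter fun j => (σ j : ℕ) < k).card = k := by
  rw [← Finset.card_map σ.toEmbedding]
  have : (Finset.univ.filter fun j => (σ j : ℕ) < k).map σ.toEmbedding =
      Finset.univ.filter fun j : Fin n => (j : ℕ) < k := by
    ext j
    simp only [Finset.mem_map_equiv, Finset.mem_filter, Finset.mem_univ, true_and,
      Equiv.apply_symm_apply]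
  rw [this, Fin.card_filter_val_lt, min_eq_right hk]

open Classical in
/-- Most subsets of size `n / 4` are well spread. -/
lemma card_not_wellSpread_le {N : ℕ} (hn : 16 ≤ N) (h4 : 4 ∣ N) (σ : Equiv.Perm (Fin N))
    (hη : 6 * √(Real.log N / N) ≤ 1) :
    (((Finset.powersetCard (N / 4) (Finset.univ : Finset (Fin N))).filter
      fun S => ¬ WellSpread σ (3 * N * √(Real.log N / N)) S).card : ℝ) ≤
      N.choose (N / 4) / (N : ℝ) ^ 2 := by
  obtain ⟨m, hN⟩ := h4
  have hNR : (N : ℝ) = 4 * m := by rw [hN]; push_cast; ring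
  rw [show N / 4 = m by omega]
  have hN0 : (16 : ℝ) ≤ N := by exact_mod_cast hn
  have hlog : 0 ≤ Real.log N := Real.log_nonneg (by linarith)
  set η := √(Real.log N / N) with hηdef
  have hη0 : 0 ≤ η := Real.sqrt_nonneg _
  have hη2 : N * η ^ 2 = Real.log N := by
    rw [hηdef, Real.sq_sqrt (by positivity)]; field_simp
  set T := 3 * N * η with hT
  set I : ℕ → Finset (Fin N) := fun k => Finset.univ.filter fun j => (σ j : ℕ) < k with hI
  -- With l = 6η and T = 3Nη the exponent is -18Nη² + 9Nη² = -9 log N.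
  have hbound : ∀ J : Finset (Fin N), (((Finset.powersetCard m (Finset.univ : Finset (Fin N))).filter
      fun S => T < ((S ∩ J).card : ℝ) - J.card / 4).card : ℝ) ≤
      (N + 1) * N.choose m * ((N : ℝ) ^ 9)⁻¹ := by
    intro J
    refine (card_hypergeometric_tail_le hN J (by positivity : 0 ≤ 6 * η) hη).trans (le_of_eq ?_)
    congr 1
    rw [← Real.exp_log (by positivity : (0 : ℝ) < ((N : ℝ) ^ 9)⁻¹), Real.log_inv, Real.log_pow,
      ← hη2, hT]
    congr 1
    push_cast
    ring
  -- Since |S| = N/4 exactly, a deficit of S in an initial segment is an excess in its complement,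
  -- so upper tails suffice.
  have hsub : (Finset.powersetCard m (Finset.univ : Finset (Fin N))).filter
      (fun S => ¬ WellSpread σ T S) ⊆ (Finset.range (N + 1)).biUnion fun k =>
        ((Finset.powersetCard m (Finset.univ : Finset (Fin N))).filter
          fun S => T < ((S ∩ I k).card : ℝ) - (I k).card / 4) ∪
        ((Finset.powersetCard m (Finset.univ : Finset (Fin N))).filter
          fun S => T < ((S ∩ (I k)ᶜ).card : ℝ) - (I k)ᶜ.card / 4) := by
    intro S hS
    rw [Finset.mem_filter] at hS
    obtain ⟨hS1, hS2⟩ := hS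
    rw [WellSpread] at hS2
    push Not at hS2
    obtain ⟨k, hk, hkT⟩ := hS2
    rw [Finset.mem_biUnion]
    refine ⟨k, Finset.mem_range.2 (by omega), ?_⟩
    have e1 : S ∩ I k = S.filter fun j => (σ j : ℕ) < k := by
      ext j; simp [hI]
    have e2 : ((I k).card : ℝ) = k := by rw [hI]; exact_mod_cast card_filter_perm_lt σ hk
    have e3 : ((S ∩ (I k)ᶜ).card : ℝ) = m - (S ∩ I k).card := by
      have h1 := Finset.card_inter_add_card_sdiff S (I k)
      rw [(Finset.mem_powersetCard.1 hS1).2] at h1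
      rw [← Finset.sdiff_eq_inter_compl]
      rw [← h1]; push_cast; ring
    have e4 : ((I k)ᶜ.card : ℝ) = N - k := by
      have h1 := Finset.card_add_card_compl (I k)
      rw [Fintype.card_fin] at h1
      rw [← e2, eq_sub_iff_add_eq, add_comm]
      exact_mod_cast h1
    rw [Finset.mem_union, Finset.mem_filter, Finset.mem_filter, e2, e3, e4, e1]
    rcases lt_abs.1 hkT with h | h
    · exact Or.inl ⟨hS1, h⟩
    · exact Or.inr ⟨hS1, by rw [hNR]; linarith⟩
  have hcard : (((Finset.powersetCard m (Finset.univ : Finset (Fin N))).filter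
      (fun S => ¬ WellSpread σ T S)).card : ℝ) ≤
      ∑ k ∈ Finset.range (N + 1), 2 * ((N + 1) * N.choose m * ((N : ℝ) ^ 9)⁻¹) := by
    refine le_trans (Nat.cast_le.2 ((Finset.card_le_card hsub).trans Finset.card_biUnion_le)) ?_
    rw [Nat.cast_sum]
    refine Finset.sum_le_sum fun k _ => ?_
    refine le_trans (Nat.cast_le.2 (Finset.card_union_le _ _)) ?_
    rw [Nat.cast_add, two_mul]
    exact add_le_add (hbound _) (hbound _)
  refine hcard.trans ?_
  rw [Finset.sum_const, Finset.card_range, nsmul_eq_mul]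
  push_cast
  -- Of the factor N⁻⁹, seven powers pay for the N + 1 thresholds, the two sides and the prefactor N
  -- + 1.
  have h1 : ((N : ℝ) + 1) * (2 * (N + 1)) ≤ N ^ 7 := by
    have : (N : ℝ) ^ 7 = N ^ 2 * N ^ 5 := by ring
    rw [this]
    have h5 : (16 : ℝ) ^ 5 ≤ N ^ 5 := by gcongr
    nlinarith
  have h2 : ((N : ℝ) ^ 9)⁻¹ = ((N : ℝ) ^ 7)⁻¹ * ((N : ℝ) ^ 2)⁻¹ := by
    rw [← mul_inv]; congr 1; ring
  calc ((N : ℝ) + 1) * (2 * ((N + 1) * N.choose m * ((N : ℝ) ^ 9)⁻¹))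
      = ((N : ℝ) + 1) * (2 * (N + 1)) * (((N : ℝ) ^ 7)⁻¹ * (N.choose m * ((N : ℝ) ^ 2)⁻¹)) := by
        rw [h2]; ring
    _ ≤ N ^ 7 * (((N : ℝ) ^ 7)⁻¹ * (N.choose m * ((N : ℝ) ^ 2)⁻¹)) := by gcongr
    _ = N.choose m / (N : ℝ) ^ 2 := by field_simp

/-- A well-spread set can be labelled by its own grid, close to the labels of the full grid. -/
lemma WellSpread.exists_labelling {n : ℕ} {σ : Equiv.Perm (Fin n)} {T : ℝ} {S : Finset (Fin n)}
    (h : WellSpread σ T S) {m : ℕ} [NeZero m] (hn : n = 4 * m) (hS : S.card = m) :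
    ∃ τ : S ≃ ZMod m, ∀ j : S, geoDist (gridPoint n (σ j)) (gridZ m (τ j)) ≤
      8 * Real.pi * T / n := by
  have hm : (0 : ℝ) < m := by exact_mod_cast Nat.pos_of_ne_zero (NeZero.ne m)
  have hnR : (n : ℝ) = 4 * m := by rw [hn]; push_cast; ring
  -- The rank of j within S is the count of the initial segment ending at its label, so
  -- well-spreadness compares it directly with a quarter of the label.
  set r : S → ℕ := fun j => (S.filter fun i => (σ i : ℕ) < σ j).card with hr
  have hrlt : ∀ j, r j < m := by
    intro j
    rw [← hS]
    refine Finset.card_lt_card (Finset.filter_ssubset.2 ⟨j, j.2, lt_irrefl _⟩)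
  have hmono : ∀ i j : S, (σ i : ℕ) < σ j → r i < r j := by
    intro i j hij
    refine Finset.card_lt_card ?_
    rw [Finset.ssubset_iff_of_subset]
    · refine ⟨i, Finset.mem_filter.2 ⟨i.2, hij⟩, fun hmem => ?_⟩
      exact lt_irrefl _ (Finset.mem_filter.1 hmem).2
    · intro l hl
      rw [Finset.mem_filter] at hl ⊢
      exact ⟨hl.1, hl.2.trans hij⟩
  have hinj : Function.Injective fun j : S => ((r j : ℕ) : ZMod m) := by
    intro i j hij
    simp only at hij
    rw [ZMod.natCast_eq_natCast_iff', Nat.mod_eq_of_lt (hrlt i), Nat.mod_eq_of_lt (hrlt j)] at hij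
    rcases lt_trichotomy (σ i : ℕ) (σ j) with h1 | h1 | h1
    · exact absurd (hmono i j h1) (by omega)
    · exact Subtype.ext (σ.injective (Fin.ext h1))
    · exact absurd (hmono j i h1) (by omega)
  have hbij := (Fintype.bijective_iff_injective_and_card _).2
    ⟨hinj, by rw [Fintype.card_coe, hS, ZMod.card]⟩
  refine ⟨Equiv.ofBijective _ hbij, fun j => ?_⟩
  rw [Equiv.ofBijective_apply, gridZ_natCast]
  refine (geoDist_gridPoint_le _ _).trans ?_
  have h1 := h (σ j) (σ (j : Fin n)).2.le
  have e : |((σ j : ℕ) : ℝ) / n - (r j : ℝ) / m| = |(r j : ℝ) - (σ j : ℕ) / 4| / m := by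
    rw [abs_sub_comm, ← abs_of_pos hm, ← abs_div, abs_of_pos hm, hnR]
    congr 1
    field_simp
  rw [e]
  have hpi := Real.pi_pos
  calc 2 * Real.pi * (|(r j : ℝ) - (σ j : ℕ) / 4| / m) ≤ 2 * Real.pi * (T / m) := by gcongr
    _ = 8 * Real.pi * T / n := by rw [hnR]; field_simp; ring

/-! ### The law of the random subsets -/

section Sampling

lemma mem_splitPairs {n : ℕ} {p : Finset (Fin n) × Finset (Fin n)} :
    p ∈ splitPairs n ↔ p.1.card = n / 4 ∧ p.2.card = n / 4 ∧ Disjoint p.1 p.2 := Iff.rfl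

-- Each S admits the same number of companions S', which is why the first component of a uniform
-- pair is a uniform subset.
open Classical in
lemma card_splitPairs_filter_fst {n : ℕ} (q : Finset (Fin n) → Prop) :
    (Finset.univ.filter fun p : Finset (Fin n) × Finset (Fin n) =>
      p ∈ splitPairs n ∧ q p.1).card =
      ((Finset.powersetCard (n / 4) (Finset.univ : Finset (Fin n))).filter q).card *
        (n - n / 4).choose (n / 4) := by
  rw [Finset.card_eq_sum_card_fiberwise (f := Prod.fst)
    (t := (Finset.powersetCard (n / 4) (Finset.univ : Finset (Fin n))).filter q)]
  · rw [Finset.sum_const_nat (m := (n - n / 4).choose (n / 4))]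
    intro S hS
    rw [Finset.mem_filter, Finset.mem_powersetCard] at hS
    have : (Finset.filter (fun p : Finset (Fin n) × Finset (Fin n) => p.1 = S)
        (Finset.univ.filter fun p : Finset (Fin n) × Finset (Fin n) =>
          p ∈ splitPairs n ∧ q p.1)) =
        (Finset.powersetCard (n / 4) Sᶜ).map ⟨fun S' => (S, S'), fun _ _ h => (Prod.ext_iff.1 h).2⟩ := by
      ext ⟨a, b⟩
      simp only [Finset.mem_filter, Finset.mem_univ, true_and, mem_splitPairs,
        Finset.mem_map, Finset.mem_powersetCard,
        ← Finset.subset_compl_iff_disjoint_left]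
      constructor
      · rintro ⟨⟨⟨h1, h2, h3⟩, h4⟩, rfl⟩
        exact ⟨b, ⟨h3, h2⟩, rfl⟩
      · rintro ⟨b', ⟨h3, h2⟩, h⟩
        obtain ⟨rfl, rfl⟩ := Prod.mk.inj h
        exact ⟨⟨⟨hS.1.2, h2, h3⟩, hS.2⟩, rfl⟩
    rw [this, Finset.card_map, Finset.card_powersetCard, Finset.card_compl, Fintype.card_fin,
      hS.1.2]
  · intro p hp
    rw [Finset.mem_coe, Finset.mem_filter] at hp
    rw [Finset.mem_coe, Finset.mem_filter, Finset.mem_powersetCard]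
    exact ⟨⟨Finset.subset_univ _, hp.2.1.1⟩, hp.2.2⟩

-- Exchanging the components preserves the set of pairs, so S' has the same marginal law as S.
open Classical in
lemma card_splitPairs_filter_snd {n : ℕ} (q : Finset (Fin n) → Prop) :
    (Finset.univ.filter fun p : Finset (Fin n) × Finset (Fin n) =>
      p ∈ splitPairs n ∧ q p.2).card =
      (Finset.univ.filter fun p : Finset (Fin n) × Finset (Fin n) =>
      p ∈ splitPairs n ∧ q p.1).card := by
  refine Finset.card_bij (fun p _ => p.swap) ?_ (fun _ _ _ _ h => Prod.swap_injective h) ?_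
  · intro p hp
    simp only [Finset.mem_filter, Finset.mem_univ, true_and, mem_splitPairs,
      Prod.fst_swap, Prod.snd_swap] at hp ⊢
    exact ⟨⟨hp.1.2.1, hp.1.1, hp.1.2.2.symm⟩, hp.2⟩
  · intro p hp
    simp only [Finset.mem_filter, Finset.mem_univ, true_and, mem_splitPairs] at hp
    refine ⟨p.swap, ?_, Prod.swap_swap p⟩
    simp only [Finset.mem_filter, Finset.mem_univ, true_and, mem_splitPairs,
      Prod.fst_swap, Prod.snd_swap]
    exact ⟨⟨hp.1.2.1, hp.1.1, hp.1.2.2.symm⟩, hp.2⟩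

lemma uniformOn_splitPairs {n : ℕ} {B : Set (Finset (Fin n) × Finset (Fin n))}
    {D : Finset (Finset (Fin n) × Finset (Fin n))} (hD : ∀ p, p ∈ D ↔ p ∈ splitPairs n ∧ p ∈ B) :
    (uniformOn (splitPairs n)).real B =
      D.card / (n.choose (n / 4) * (n - n / 4).choose (n / 4)) := by
  classical
  have h1 : (splitPairs n) = ((Finset.univ.filter fun p => p ∈ splitPairs n : Finset _) : Set _) := by
    ext p; simp
  have h2 : B = ((Finset.univ.filter fun p => p ∈ B : Finset _) : Set _) := by
    ext p; simp
  have h3 := card_splitPairs_filter_fst (n := n) fun _ => True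
  simp only [and_true, Finset.filter_true, Finset.card_powersetCard, Finset.card_univ,
    Fintype.card_fin] at h3
  have h4 : D = (Finset.univ.filter fun p => p ∈ splitPairs n) ∩
      Finset.univ.filter fun p => p ∈ B := by
    ext p; simp [hD]
  rw [← Nat.cast_mul, ← h3, h4]
  conv_lhs => rw [h1, h2]
  rw [Measure.real, uniformOn_apply_finset, ENNReal.toReal_div, ENNReal.toReal_natCast,
    ENNReal.toReal_natCast]

/-- The two random subsets are well spread with high probability. -/
lemma measure_not_wellSpread_le {n : ℕ} (hn : 16 ≤ n) (h4 : 4 ∣ n) (σ : Equiv.Perm (Fin n))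
    (hη : 6 * √(Real.log n / n) ≤ 1) {Ω : Type*} [MeasurableSpace Ω] {P : Measure Ω}
    [IsProbabilityMeasure P] {X : Ω → Finset (Fin n) × Finset (Fin n)}
    (hX : HasLaw X (uniformOn (splitPairs n)) P) :
    P.real {ω | ¬ (X ω ∈ splitPairs n ∧ WellSpread σ (3 * n * √(Real.log n / n)) (X ω).1 ∧
      WellSpread σ (3 * n * √(Real.log n / n)) (X ω).2)} ≤ 2 / (n : ℝ) ^ 2 := by
  classical
  set T := 3 * n * √(Real.log n / n)
  set B : Set (Finset (Fin n) × Finset (Fin n)) :=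
    {p | ¬ (p ∈ splitPairs n ∧ WellSpread σ T p.1 ∧ WellSpread σ T p.2)} with hB
  have e1 : P.real {ω | ¬ (X ω ∈ splitPairs n ∧ WellSpread σ T (X ω).1 ∧
      WellSpread σ T (X ω).2)} = (uniformOn (splitPairs n)).real B := by
    rw [← hX.map_eq, Measure.real, Measure.real,
      Measure.map_apply_of_aemeasurable hX.aemeasurable (MeasurableSet.of_discrete (s := B))]
    rfl
  have hc1 : 0 < n.choose (n / 4) := Nat.choose_pos (by omega)
  have hc2 : 0 < (n - n / 4).choose (n / 4) := Nat.choose_pos (by omega)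
  set D : Finset (Finset (Fin n) × Finset (Fin n)) :=
    Finset.univ.filter fun p => p ∈ splitPairs n ∧ p ∈ B with hD
  rw [e1, uniformOn_splitPairs (D := D) fun p => by simp [hD]]
  obtain ⟨q, hq⟩ : ∃ q : Finset (Fin n) → Prop, q = fun S => ¬ WellSpread σ T S := ⟨_, rfl⟩
  have hsub : D ⊆
      (Finset.univ.filter fun p => p ∈ splitPairs n ∧ q p.1) ∪
      (Finset.univ.filter fun p => p ∈ splitPairs n ∧ q p.2) := by
    intro p hp
    simp only [hD, Finset.mem_filter, Finset.mem_univ, true_and, Finset.mem_union, hB,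
      Set.mem_ofPred_eq, hq] at hp ⊢
    tauto
  have hcard := (Finset.card_le_card hsub).trans (Finset.card_union_le _ _)
  rw [card_splitPairs_filter_snd q, card_splitPairs_filter_fst q] at hcard
  have hle : (((Finset.powersetCard (n / 4) (Finset.univ : Finset (Fin n))).filter q).card : ℝ) ≤
      n.choose (n / 4) / (n : ℝ) ^ 2 := by
    subst hq
    convert card_not_wellSpread_le hn h4 σ hη
  have hn0 : (0 : ℝ) < n := by positivity
  rw [div_le_div_iff₀ (by positivity) (by positivity)]
  have hcard' : (D.card : ℝ) ≤
      2 * ((n.choose (n / 4) / (n : ℝ) ^ 2) * (n - n / 4).choose (n / 4)) := by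
    refine le_trans (Nat.cast_le.2 hcard) ?_
    push_cast
    rw [← two_mul]
    gcongr
  calc _ ≤ 2 * ((n.choose (n / 4) / (n : ℝ) ^ 2) * (n - n / 4).choose (n / 4)) * (n : ℝ) ^ 2 :=
        mul_le_mul_of_nonneg_right hcard' (by positivity)
    _ = _ := by field_simp

end Sampling

/-- If `A` is independent of a discrete variable `X` and `A ∈ bad b` is unlikely for every `b ∈ D`,
then so is `A ∈ bad X`. -/
lemma IndepFun.measureReal_le {Ω α β : Type*} [MeasurableSpace Ω] [MeasurableSpace α]
    [MeasurableSpace β] [Fintype β] [DiscreteMeasurableSpace β] {P : Measure Ω}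
    [IsProbabilityMeasure P] {A : Ω → α} {X : Ω → β} (h : A ⟂ᵢ[P] X) (hX : AEMeasurable X P)
    {bad : β → Set α} {D : Set β} (hbad : ∀ b ∈ D, MeasurableSet (bad b)) {c : ℝ} (hc : 0 ≤ c)
    (hle : ∀ b ∈ D, P.real (A ⁻¹' bad b) ≤ c) :
    P.real {ω | X ω ∈ D ∧ A ω ∈ bad (X ω)} ≤ c := by
  classical
  have hsub : {ω | X ω ∈ D ∧ A ω ∈ bad (X ω)} ⊆
      ⋃ b ∈ Finset.univ.filter (· ∈ D), (A ⁻¹' bad b ∩ X ⁻¹' {b}) := by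
    intro ω hω
    simp only [Set.mem_iUnion, Finset.mem_filter, Finset.mem_univ, true_and]
    exact ⟨X ω, hω.1, hω.2, rfl⟩
  refine (measureReal_mono hsub (measure_ne_top _ _)).trans ?_
  refine (measureReal_biUnion_finset_le _ _).trans ?_
  calc ∑ b ∈ Finset.univ.filter (· ∈ D), P.real (A ⁻¹' bad b ∩ X ⁻¹' {b})
      ≤ ∑ b ∈ Finset.univ.filter (· ∈ D), c * (P.map X).real {b} := by
        refine Finset.sum_le_sum fun b hb => ?_
        have hb' := (Finset.mem_filter.1 hb).2
        rw [Measure.real, h.measure_inter_preimage_eq_mul _ _ (hbad b hb') (measurableSet_singleton b),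
          ENNReal.toReal_mul, Measure.real, Measure.map_apply_of_aemeasurable hX
            (measurableSet_singleton b)]
        exact mul_le_mul_of_nonneg_right (hle b hb') ENNReal.toReal_nonneg
    _ ≤ ∑ b, c * (P.map X).real {b} :=
        Finset.sum_le_sum_of_subset_of_nonneg (Finset.filter_subset _ _) fun b _ _ => by positivity
    _ = c := by
        have := Measure.isProbabilityMeasure_map (μ := P) hX
        rw [← Finset.mul_sum, sum_measureReal_singleton, Finset.coe_univ, probReal_univ, mul_one]

/-! ### Concentration of linear forms in the noise -/

section Noise

variable {n : ℕ} {Ω : Type*} [MeasurableSpace Ω] {P : Measure Ω}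
  {A : Ω → Matrix (Fin n) (Fin n) ℝ} {F : Matrix (Fin n) (Fin n) ℝ}

lemma sum_sum_eq_sum_Ioi (C : Fin n → Fin n → ℝ) (h : ∀ i, C i i = 0) :
    ∑ i, ∑ j, C i j = ∑ i, ∑ j ∈ Finset.Ioi i, (C i j + C j i) := by
  have h1 : ∀ i, ∑ j, C i j = ∑ j ∈ Finset.Ioi i, C i j + ∑ j ∈ Finset.Iio i, C i j := by
    intro i
    have hu : (Finset.univ : Finset (Fin n)) = insert i (Finset.Ioi i ∪ Finset.Iio i) := by
      ext j; simp [lt_or_lt_iff_ne, eq_comm, em]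
    rw [hu, Finset.sum_insert (by simp), h, zero_add, Finset.sum_union]
    rw [Finset.disjoint_left]
    intro j hj hj'
    rw [Finset.mem_Ioi] at hj
    rw [Finset.mem_Iio] at hj'
    exact lt_asymm hj hj'
  have h2 : ∑ i, ∑ j ∈ Finset.Iio i, C i j = ∑ i, ∑ j ∈ Finset.Ioi i, C j i := by
    rw [Finset.sum_comm' (t' := Finset.univ) (s' := fun j => Finset.Ioi j)]
    intro i j; simp
  rw [Finset.sum_congr rfl fun i _ => h1 i, Finset.sum_add_distrib, h2, ← Finset.sum_add_distrib]
  exact Finset.sum_congr rfl fun i _ => Finset.sum_add_distrib.symm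

lemma IsObservation.mean_symm (h : IsObservation P A F) (i j : Fin n) : F i j = F j i := by
  rw [← h.mean, ← h.mean]
  congr 1
  ext ω
  exact (h.symm ω).apply j i

lemma IsObservation.mean_diag (h : IsObservation P A F) (i : Fin n) : F i i = 0 := by
  rw [← h.mean]
  simp [h.diag]

/-- Symmetry of the noise folds a form over all ordered pairs into one over i < j with coefficients
C i j + C j i. The factor 2 in the variance is (a + b)² ≤ 2(a² + b²). -/
lemma IsObservation.measure_lt_le [IsProbabilityMeasure P] (h : IsObservation P A F)
    (C : Fin n → Fin n → ℝ) {t : ℝ} (ht : 0 ≤ t) :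
    P.real {ω | t * √(2 * ∑ i, ∑ j, C i j ^ 2) < ∑ i, ∑ j, C i j * (A ω i j - F i j)} ≤
      Real.exp (-t ^ 2 / 2) := by
  refine le_trans (measureReal_mono ?_ (measure_ne_top _ _))
    (h.subGaussian (Matrix.of fun i j => C i j + C j i) t ht)
  intro ω hω
  simp only [Set.mem_ofPred_eq, Matrix.of_apply] at hω ⊢
  have e1 : ∑ i, ∑ j, C i j * (A ω i j - F i j) =
      ∑ i, ∑ j ∈ Finset.Ioi i, (C i j + C j i) * (A ω i j - F i j) := by
    rw [sum_sum_eq_sum_Ioi _ fun i => by rw [h.diag, h.mean_diag]; ring]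
    refine Finset.sum_congr rfl fun i _ => Finset.sum_congr rfl fun j _ => ?_
    rw [h.mean_symm j i, (h.symm ω).apply i j]
    ring
  rw [e1] at hω
  refine lt_of_le_of_lt (mul_le_mul_of_nonneg_left (Real.sqrt_le_sqrt ?_) ht) hω
  have e2 : ∑ i, ∑ j, (if i = j then 0 else C i j ^ 2) ≤ ∑ i, ∑ j, C i j ^ 2 := by
    refine Finset.sum_le_sum fun i _ => Finset.sum_le_sum fun j _ => ?_
    split_ifs
    exacts [sq_nonneg _, le_rfl]
  refine le_trans ?_ (mul_le_mul_of_nonneg_left e2 zero_le_two)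
  rw [sum_sum_eq_sum_Ioi _ fun i => if_pos rfl, Finset.mul_sum]
  refine Finset.sum_le_sum fun i _ => ?_
  rw [Finset.mul_sum]
  refine Finset.sum_le_sum fun j hj => ?_
  rw [if_neg (Finset.mem_Ioi.1 hj).ne, if_neg (Finset.mem_Ioi.1 hj).ne']
  nlinarith [sq_nonneg (C i j - C j i)]

end Noise

/-! ### From integer vectors to the operator norm -/

section Net

variable {ι : Type*} [Fintype ι] {W : Matrix ι ι ℝ}

lemma opBound_of_unit {c : ℝ} (h : ∀ u v : ι → ℝ, u ⬝ᵥ u = 1 → v ⬝ᵥ v = 1 → u ⬝ᵥ W *ᵥ v ≤ c) :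
    OpBound W c := by
  intro u v
  rcases (dotProduct_self_nonneg' u).eq_or_lt with hu | hu
  · have := dotProduct_self_eq_zero.1 hu.symm
    simp [this]
  rcases (dotProduct_self_nonneg' v).eq_or_lt with hv | hv
  · have := dotProduct_self_eq_zero.1 hv.symm
    simp [this]
  have hunit : ∀ w : ι → ℝ, 0 < w ⬝ᵥ w → ((√(w ⬝ᵥ w))⁻¹ • w) ⬝ᵥ ((√(w ⬝ᵥ w))⁻¹ • w) = 1 := by
    intro w hw
    rw [smul_dotProduct, dotProduct_smul, smul_eq_mul, smul_eq_mul, ← mul_assoc, ← mul_inv,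
      Real.mul_self_sqrt hw.le, inv_mul_cancel₀ hw.ne']
  have key : ∀ w : ι → ℝ, 0 < w ⬝ᵥ w → w ⬝ᵥ W *ᵥ v ≤ c * (√(w ⬝ᵥ w) * √(v ⬝ᵥ v)) := by
    intro w hw
    have h1 := h _ _ (hunit w hw) (hunit v hv)
    rw [Matrix.mulVec_smul, smul_dotProduct, dotProduct_smul, smul_eq_mul, smul_eq_mul,
      ← mul_assoc, ← mul_inv, inv_mul_le_iff₀ (by positivity)] at h1
    linarith
  rw [abs_le]
  have h1 := key (-u) (by simpa using hu)
  simp only [neg_dotProduct, dotProduct_neg, neg_neg] at h1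
  exact ⟨by linarith, key u hu⟩

/-- Rounding n u to integers errs by at most 1/(2n) per coordinate of u, hence by at most 1/(2√n) ≤
1/4 in norm. Integer vectors thus form an explicit finite net. -/
lemma exists_int_near_unit {n : ℕ} (hn : 4 ≤ n) (hcard : Fintype.card ι ≤ n) {u : ι → ℝ}
    (hu : u ⬝ᵥ u = 1) : ∃ k : ι → ℤ, (∀ i, k i ∈ Set.Icc (-n : ℤ) n) ∧
      √((u - (n : ℝ)⁻¹ • fun i => (k i : ℝ)) ⬝ᵥ (u - (n : ℝ)⁻¹ • fun i => (k i : ℝ))) ≤ 1 / 4 ∧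
      √((fun i => (k i : ℝ)) ⬝ᵥ (fun i => (k i : ℝ))) ≤ 5 / 4 * n := by
  have hn' : (4 : ℝ) ≤ n := by exact_mod_cast hn
  have hround : ∀ i, |(n : ℝ) * u i - round ((n : ℝ) * u i)| ≤ 1 / 2 := fun i => abs_sub_round _
  set k : ι → ℤ := fun i => round ((n : ℝ) * u i) with hk
  set p : ι → ℝ := fun i => (k i : ℝ) with hp
  set d := u - (n : ℝ)⁻¹ • p with hd
  have hdd : d ⬝ᵥ d ≤ (1 / 4) ^ 2 := by
    have h1 : ∀ i, d i * d i ≤ (2 * (n : ℝ))⁻¹ ^ 2 := by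
      intro i
      have e : d i = (n : ℝ)⁻¹ * (n * u i - k i) := by
        simp only [hd, hp, Pi.sub_apply, Pi.smul_apply, smul_eq_mul]
        field_simp
      have h2 : |d i| ≤ (2 * (n : ℝ))⁻¹ := by
        rw [e, abs_mul, abs_of_pos (by positivity), mul_inv, mul_comm, ← one_div (2 : ℝ)]
        exact mul_le_mul_of_nonneg_right (hround i) (by positivity)
      rw [← abs_mul_abs_self, ← sq]
      gcongr
    calc d ⬝ᵥ d ≤ ∑ _i : ι, (2 * (n : ℝ))⁻¹ ^ 2 := Finset.sum_le_sum fun i _ => h1 i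
      _ = Fintype.card ι * (2 * (n : ℝ))⁻¹ ^ 2 := by
        rw [Finset.sum_const, Finset.card_univ, nsmul_eq_mul]
      _ ≤ n * (2 * (n : ℝ))⁻¹ ^ 2 := by gcongr
      _ = 1 / (4 * n) := by field_simp; norm_num
      _ ≤ (1 / 4) ^ 2 := by
        rw [div_le_iff₀ (by positivity)]; linarith
  have hds : √(d ⬝ᵥ d) ≤ 1 / 4 := Real.sqrt_le_iff.2 ⟨by norm_num, hdd⟩
  refine ⟨k, fun i => ?_, hds, ?_⟩
  · have hui : |u i| ≤ 1 := by
      rw [← sq_le_one_iff_abs_le_one, ← hu, sq]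
      exact Finset.single_le_sum (f := fun i => u i * u i) (fun j _ => mul_self_nonneg _)
        (Finset.mem_univ i)
    have h1 := abs_le.1 (hround i)
    have h2 := abs_le.1 hui
    have h3 : (k i : ℝ) < n + 1 := by nlinarith
    have h4 : -((n : ℝ) + 1) < k i := by nlinarith
    have h3' : k i < n + 1 := by exact_mod_cast h3
    have h4' : -((n : ℤ) + 1) < k i := by exact_mod_cast h4
    constructor <;> omega
  · have e : p = (n : ℝ) • (u - d) := by
      rw [hd, sub_sub_cancel, smul_inv_smul₀ (by positivity)]
    refine Real.sqrt_le_iff.2 ⟨by positivity, ?_⟩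
    have h2 := dotProduct_sq_le u d
    rw [hu, one_mul] at h2
    have h3 : |u ⬝ᵥ d| ≤ 1 / 4 := abs_le_of_sq_le_sq (h2.trans hdd) (by norm_num)
    change p ⬝ᵥ p ≤ _
    clear_value d
    rw [e, smul_dotProduct, dotProduct_smul, smul_eq_mul, smul_eq_mul, sub_dotProduct,
      dotProduct_sub, dotProduct_sub, hu, dotProduct_comm d u, mul_pow, ← mul_assoc, ← sq, mul_comm]
    gcongr
    linarith [(abs_le.1 h3).1]

/-- Replacing u and v in turn by net points leaves errors K/4 and (5/4)(K/4), in total 9K/16, and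
the net values contribute (5/4)² T. Since 9/16 < 1, the map on bounds is a contraction. -/
lemma OpBound.improve {K T : ℝ} (hK : 0 ≤ K) (hW : OpBound W K) {n : ℕ}
    (hn : 4 ≤ n) (hcard : Fintype.card ι ≤ n) (hT : 0 ≤ T)
    (h : ∀ k k' : ι → ℤ, (∀ i, k i ∈ Set.Icc (-n : ℤ) n) → (∀ i, k' i ∈ Set.Icc (-n : ℤ) n) →
      (fun i => (k i : ℝ)) ⬝ᵥ W *ᵥ (fun i => (k' i : ℝ)) ≤
        T * (√((fun i => (k i : ℝ)) ⬝ᵥ (fun i => (k i : ℝ))) *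
          √((fun i => (k' i : ℝ)) ⬝ᵥ (fun i => (k' i : ℝ))))) :
    OpBound W (9 / 16 * K + 25 / 16 * T) := by
  have hn0 : (0 : ℝ) < n := by positivity
  refine opBound_of_unit fun u v hu hv => ?_
  obtain ⟨k, hk, hd, hp⟩ := exists_int_near_unit hn hcard hu
  obtain ⟨k', hk', he, hq⟩ := exists_int_near_unit hn hcard hv
  have hh := h k k' hk hk'
  set p : ι → ℝ := fun i => (k i : ℝ)
  set q : ι → ℝ := fun i => (k' i : ℝ)
  set d := u - (n : ℝ)⁻¹ • p with hd'
  set e := v - (n : ℝ)⁻¹ • q with he'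
  have e1 : u ⬝ᵥ W *ᵥ v = d ⬝ᵥ W *ᵥ v + (n : ℝ)⁻¹ * (p ⬝ᵥ W *ᵥ e) +
      (n : ℝ)⁻¹ * (n : ℝ)⁻¹ * (p ⬝ᵥ W *ᵥ q) := by
    rw [hd', he', sub_dotProduct, Matrix.mulVec_sub, dotProduct_sub, Matrix.mulVec_smul,
      smul_dotProduct, dotProduct_smul, smul_eq_mul, smul_eq_mul]
    ring
  have h1 : d ⬝ᵥ W *ᵥ v ≤ K * (1 / 4 * 1) := by
    refine (le_abs_self _).trans ((hW d v).trans ?_)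
    rw [hv, Real.sqrt_one]
    gcongr
  have h2 : p ⬝ᵥ W *ᵥ e ≤ K * (5 / 4 * n * (1 / 4)) := by
    refine (le_abs_self _).trans ((hW p e).trans ?_)
    gcongr
  have h3 : p ⬝ᵥ W *ᵥ q ≤ T * (5 / 4 * n * (5 / 4 * n)) := by
    refine hh.trans ?_
    gcongr
  rw [e1]
  calc _ ≤ K * (1 / 4 * 1) + (n : ℝ)⁻¹ * (K * (5 / 4 * n * (1 / 4))) +
        (n : ℝ)⁻¹ * (n : ℝ)⁻¹ * (T * (5 / 4 * n * (5 / 4 * n))) := by gcongr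
    _ = _ := by field_simp; ring

/-- The operator norm is controlled by the bilinear form on integer vectors. -/
lemma opBound_of_int {n : ℕ}
    (hn : 4 ≤ n) (hcard : Fintype.card ι ≤ n) {T : ℝ} (hT : 0 ≤ T)
    (h : ∀ k k' : ι → ℤ, (∀ i, k i ∈ Set.Icc (-n : ℤ) n) → (∀ i, k' i ∈ Set.Icc (-n : ℤ) n) →
      (fun i => (k i : ℝ)) ⬝ᵥ W *ᵥ (fun i => (k' i : ℝ)) ≤
        T * (√((fun i => (k i : ℝ)) ⬝ᵥ (fun i => (k i : ℝ))) *
          √((fun i => (k' i : ℝ)) ⬝ᵥ (fun i => (k' i : ℝ))))) :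
    OpBound W (4 * T) := by
  -- The infimum of the valid bounds is itself valid, so the contraction applies to it and gives K ≤
  -- 9K/16 + 25T/16, that is K ≤ 25T/7 ≤ 4T.
  set B : Set ℝ := {K | 0 ≤ K ∧ OpBound W K} with hB
  have hbdd : BddBelow B := ⟨0, fun K hK => hK.1⟩
  have hne : B.Nonempty := by
    refine ⟨∑ i, ∑ j, |W i j|, Finset.sum_nonneg fun i _ => Finset.sum_nonneg fun j _ =>
      abs_nonneg _, opBound_of_unit fun u v hu hv => ?_⟩
    have hle : ∀ w : ι → ℝ, w ⬝ᵥ w = 1 → ∀ i, |w i| ≤ 1 := by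
      intro w hw i
      rw [← sq_le_one_iff_abs_le_one, ← hw, sq]
      exact Finset.single_le_sum (f := fun i => w i * w i) (fun j _ => mul_self_nonneg _)
        (Finset.mem_univ i)
    simp only [dotProduct, Matrix.mulVec, Finset.mul_sum]
    refine Finset.sum_le_sum fun i _ => Finset.sum_le_sum fun j _ => ?_
    refine (le_abs_self _).trans ?_
    rw [abs_mul, abs_mul]
    calc |u i| * (|W i j| * |v j|) ≤ 1 * (|W i j| * 1) := by
          gcongr
          exacts [hle u hu i, hle v hv j]
      _ = _ := by ring
  have h0 : 0 ≤ sInf B := le_csInf hne fun K hK => hK.1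
  have hinf : OpBound W (sInf B) := by
    refine opBound_of_unit fun u v hu hv => le_csInf hne fun K hK => ?_
    have := (le_abs_self _).trans (hK.2 u v)
    rwa [hu, hv, Real.sqrt_one, mul_one, mul_one] at this
  have h1 := csInf_le hbdd (show 9 / 16 * sInf B + 25 / 16 * T ∈ B from
    ⟨by positivity, hinf.improve h0 hn hcard hT h⟩)
  intro u v
  refine (hinf u v).trans ?_
  gcongr
  linarith

end Net

/-! ### The exceptional noise events -/

section ExtendZero

variable {n : ℕ} {S : Finset (Fin n)}

/-- Extension of a vector by zero. -/
def extendZero (S : Finset (Fin n)) (u : S → ℝ) (i : Fin n) : ℝ :=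
  if h : i ∈ S then u ⟨i, h⟩ else 0

lemma extendZero_dotProduct (u : S → ℝ) (v : Fin n → ℝ) :
    extendZero S u ⬝ᵥ v = u ⬝ᵥ fun i => v i := by
  have h : ∑ i : S, extendZero S u i * v i = ∑ i, extendZero S u i * v i := by
    rw [Finset.sum_coe_sort S fun i => extendZero S u i * v i]
    refine Finset.sum_subset (Finset.subset_univ _) fun i _ hi => ?_
    rw [extendZero, dif_neg hi, zero_mul]
  rw [dotProduct, ← h]
  exact Finset.sum_congr rfl fun i _ => by rw [extendZero, dif_pos i.2]

lemma extendZero_dotProduct_self (u : S → ℝ) : extendZero S u ⬝ᵥ extendZero S u = u ⬝ᵥ u := by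
  rw [extendZero_dotProduct]
  congr 1
  funext i
  rw [extendZero, dif_pos i.2]

lemma mulVec_extendZero (M : Matrix (Fin n) (Fin n) ℝ) (u : S → ℝ) (i : Fin n) :
    (M *ᵥ extendZero S u) i = ∑ j : S, u j * M i j := by
  rw [Matrix.mulVec, dotProduct_comm, extendZero_dotProduct]
  rfl

lemma extendZero_mulVec (M F : Matrix (Fin n) (Fin n) ℝ) (u v : S → ℝ) :
    extendZero S u ⬝ᵥ (M - F) *ᵥ extendZero S v =
      u ⬝ᵥ (subMatrix M S - subMatrix F S) *ᵥ v := by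
  rw [extendZero_dotProduct]
  congr 1
  funext i
  rw [mulVec_extendZero, Matrix.mulVec, dotProduct]
  exact Finset.sum_congr rfl fun j _ => mul_comm _ _

end ExtendZero

section Events

variable {n : ℕ} {F : Matrix (Fin n) (Fin n) ℝ} {S : Finset (Fin n)}

/-- The event that a rank one linear form of the noise exceeds `t` standard deviations. -/
def tailEvent (F : Matrix (Fin n) (Fin n) ℝ) (p q : Fin n → ℝ) (t : ℝ) :
    Set (Matrix (Fin n) (Fin n) ℝ) :=
  {M | t * √(2 * ((p ⬝ᵥ p) * (q ⬝ᵥ q))) < p ⬝ᵥ (M - F) *ᵥ q}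

lemma measurable_entry {ι κ : Type*} (i : ι) (j : κ) : Measurable fun M : Matrix ι κ ℝ => M i j :=
  (measurable_pi_apply j).comp (measurable_pi_apply (X := fun _ : ι => κ → ℝ) i)

lemma measurable_bilinear (p q : Fin n → ℝ) :
    Measurable fun M : Matrix (Fin n) (Fin n) ℝ => p ⬝ᵥ (M - F) *ᵥ q := by
  simp only [dotProduct, Matrix.mulVec, Matrix.sub_apply]
  exact Finset.measurable_sum _ fun i _ => (Finset.measurable_sum _ fun j _ =>
    ((measurable_entry i j).sub_const _).mul_const _).const_mul _

lemma measurableSet_tailEvent (p q : Fin n → ℝ) (t : ℝ) : MeasurableSet (tailEvent F p q t) :=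
  measurableSet_lt measurable_const (measurable_bilinear p q)

lemma IsObservation.measure_tailEvent_le {Ω : Type*} [MeasurableSpace Ω] {P : Measure Ω}
    [IsProbabilityMeasure P] {A : Ω → Matrix (Fin n) (Fin n) ℝ} (h : IsObservation P A F)
    (p q : Fin n → ℝ) {t : ℝ} (ht : 0 ≤ t) :
    P.real (A ⁻¹' tailEvent F p q t) ≤ Real.exp (-t ^ 2 / 2) := by
  convert h.measure_lt_le (fun i j => p i * q j) ht using 2
  ext ω
  have e1 : ∑ i, ∑ j, (p i * q j) ^ 2 = (p ⬝ᵥ p) * (q ⬝ᵥ q) := by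
    rw [dotProduct, dotProduct, Finset.sum_mul_sum]
    exact Finset.sum_congr rfl fun i _ => Finset.sum_congr rfl fun j _ => by ring
  have e2 : ∑ i, ∑ j, p i * q j * (A ω i j - F i j) = p ⬝ᵥ (A ω - F) *ᵥ q := by
    simp only [dotProduct, Matrix.mulVec, Finset.mul_sum, Matrix.sub_apply]
    exact Finset.sum_congr rfl fun i _ => Finset.sum_congr rfl fun j _ => by ring
  simp only [Set.mem_preimage, tailEvent, Set.mem_ofPred_eq, e1, e2]

/-- Integer vectors with entries in `[-n, n]`. -/
def intVectors (n : ℕ) (S : Finset (Fin n)) : Finset (S → ℤ) :=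
  Fintype.piFinset fun _ => Finset.Icc (-n : ℤ) n

/-- The event that the noise on the block of `S` has a large operator norm. -/
def operatorEvent (F : Matrix (Fin n) (Fin n) ℝ) (S : Finset (Fin n)) :
    Set (Matrix (Fin n) (Fin n) ℝ) :=
  ⋃ k ∈ intVectors n S, ⋃ k' ∈ intVectors n S,
    tailEvent F (extendZero S fun i => k i) (extendZero S fun i => k' i)
      (2 * √(n * Real.log n))

lemma measurableSet_operatorEvent : MeasurableSet (operatorEvent F S) :=
  Finset.measurableSet_biUnion _ fun _ _ => Finset.measurableSet_biUnion _ fun _ _ =>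
    measurableSet_tailEvent _ _ _

lemma opBound_of_notMem_operatorEvent (hn : 4 ≤ n) {M : Matrix (Fin n) (Fin n) ℝ}
    (hM : M ∉ operatorEvent F S) :
    OpBound (subMatrix M S - subMatrix F S) (12 * √(n * Real.log n)) := by
  have hcard : Fintype.card S ≤ n := by
    rw [Fintype.card_coe]
    simpa using Finset.card_le_univ S
  have h := opBound_of_int (W := subMatrix M S - subMatrix F S) hn hcard
    (T := 3 * √(n * Real.log n)) (by positivity) fun k k' hk hk' => ?_
  · rwa [← mul_assoc, show (4 : ℝ) * 3 = 12 by norm_num] at h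
  · simp only [operatorEvent, Set.mem_iUnion, not_exists] at hM
    have h1 := hM k (Fintype.mem_piFinset.2 fun i => Finset.mem_Icc.2 (hk i)) k'
      (Fintype.mem_piFinset.2 fun i => Finset.mem_Icc.2 (hk' i))
    rw [tailEvent, Set.mem_ofPred_eq, not_lt, extendZero_mulVec, extendZero_dotProduct_self,
      extendZero_dotProduct_self] at h1
    refine h1.trans ?_
    rw [Real.sqrt_mul zero_le_two, Real.sqrt_mul (dotProduct_self_nonneg' _)]
    -- The threshold 2√(n log n) times √2 is at most 3√(n log n), and the net argument multiplies it
    -- by 4.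
    have h2 : √(2 : ℝ) ≤ 3 / 2 := Real.sqrt_le_iff.2 ⟨by norm_num, by norm_num⟩
    set a := √(n * Real.log n)
    set b := √((fun i => (k i : ℝ)) ⬝ᵥ fun i => (k i : ℝ)) *
      √((fun i => (k' i : ℝ)) ⬝ᵥ fun i => (k' i : ℝ))
    have ha : 0 ≤ a := Real.sqrt_nonneg _
    have hb : 0 ≤ b := by positivity
    nlinarith [mul_le_mul_of_nonneg_right h2 (mul_nonneg ha hb)]

/-- Each pair of integer vectors fails with probability n^(-2n). There are (2n+1)^(2|S|) ≤ n^(4|S|)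
= n^n pairs, so the union bound leaves n^(-n). -/
lemma IsObservation.measure_operatorEvent_le {Ω : Type*} [MeasurableSpace Ω] {P : Measure Ω}
    [IsProbabilityMeasure P] {A : Ω → Matrix (Fin n) (Fin n) ℝ} (h : IsObservation P A F)
    (hn : 16 ≤ n) (hS : 4 * S.card = n) :
    P.real (A ⁻¹' operatorEvent F S) ≤ 1 / (n : ℝ) ^ 2 := by
  have hn0 : (16 : ℝ) ≤ n := by exact_mod_cast hn
  have hlog : 0 ≤ Real.log n := Real.log_nonneg (by linarith)
  have hcardK : (intVectors n S).card = (2 * n + 1) ^ S.card := by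
    rw [intVectors, Fintype.card_piFinset, Finset.prod_const, Int.card_Icc, Finset.card_univ,
      Fintype.card_coe]
    congr 1
    omega
  have hexp : Real.exp (-(2 * √(n * Real.log n)) ^ 2 / 2) = ((n : ℝ) ^ (2 * n))⁻¹ := by
    rw [mul_pow, Real.sq_sqrt (by positivity), ← Real.exp_log (by positivity : (0 : ℝ) <
      ((n : ℝ) ^ (2 * n))⁻¹), Real.log_inv, Real.log_pow]
    congr 1
    push_cast
    ring
  have hK : ((intVectors n S).card : ℝ) * (intVectors n S).card ≤ (n : ℝ) ^ n := by
    have h1 : (intVectors n S).card * (intVectors n S).card ≤ n ^ n := by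
      rw [hcardK, ← pow_add]
      calc (2 * n + 1) ^ (S.card + S.card) ≤ (n ^ 2) ^ (S.card + S.card) := by
            gcongr
            nlinarith
        _ = n ^ n := by rw [← pow_mul]; congr 1; omega
    exact_mod_cast h1
  have hpre : A ⁻¹' operatorEvent F S = ⋃ k ∈ intVectors n S, ⋃ k' ∈ intVectors n S,
      A ⁻¹' tailEvent F (extendZero S fun i => k i) (extendZero S fun i => k' i)
        (2 * √(n * Real.log n)) := by
    simp only [operatorEvent, Set.preimage_iUnion]
  rw [hpre]
  refine (measureReal_biUnion_finset_le _ _).trans ?_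
  calc _ ≤ ∑ k ∈ intVectors n S, ∑ k' ∈ intVectors n S, ((n : ℝ) ^ (2 * n))⁻¹ := by
        refine Finset.sum_le_sum fun k _ => (measureReal_biUnion_finset_le _ _).trans ?_
        refine Finset.sum_le_sum fun k' _ => ?_
        rw [← hexp]
        exact h.measure_tailEvent_le _ _ (by positivity)
    _ = (intVectors n S).card * (intVectors n S).card * ((n : ℝ) ^ (2 * n))⁻¹ := by
        rw [Finset.sum_const, Finset.sum_const, nsmul_eq_mul, nsmul_eq_mul, mul_assoc]
    _ ≤ (n : ℝ) ^ n * ((n : ℝ) ^ (2 * n))⁻¹ := by gcongr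
    _ = 1 / (n : ℝ) ^ n := by
        rw [two_mul, pow_add]; field_simp
    _ ≤ 1 / (n : ℝ) ^ 2 := by
        gcongr
        · linarith
        · omega

/-- The block of `S` is independent of the noise between `S` and a point outside `S`. -/
lemma IsObservation.indepFun_block {Ω : Type*} [MeasurableSpace Ω] {P : Measure Ω}
    [IsProbabilityMeasure P] {A : Ω → Matrix (Fin n) (Fin n) ℝ} (h : IsObservation P A F)
    {i : Fin n} (hi : i ∉ S) (w : S → ℝ) :
    (fun ω => subMatrix (A ω) S) ⟂ᵢ[P]
      fun ω => (Pi.single i 1 : Fin n → ℝ) ⬝ᵥ (A ω - F) *ᵥ extendZero S w := by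
  classical
  -- The independent entries are split into those with both indices in S and the others. By symmetry
  -- and the zero diagonal the block is a function φ of the first family, and a form in row i ∉ S is
  -- a function ψ of the second.
  set T₁ : Finset {p : Fin n × Fin n // p.1 < p.2} :=
    Finset.univ.filter fun p => p.1.1 ∈ S ∧ p.1.2 ∈ S with hT₁
  set T₂ : Finset {p : Fin n × Fin n // p.1 < p.2} :=
    Finset.univ.filter fun p => ¬(p.1.1 ∈ S ∧ p.1.2 ∈ S) with hT₂
  have hE : ∀ p : {p : Fin n × Fin n // p.1 < p.2},
      Measurable fun ω => A ω p.1.1 p.1.2 - F p.1.1 p.1.2 := fun p =>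
    ((measurable_entry _ _).comp h.measurable).sub_const _
  have hind := h.indep.indepFun_finset T₁ T₂ (Finset.disjoint_filter_filter_not _ _ _) hE
  set φ : (T₁ → ℝ) → Matrix S S ℝ := fun e i j =>
    if hij : (i : Fin n) < j then
      e ⟨⟨(i, j), hij⟩, Finset.mem_filter.2 ⟨Finset.mem_univ _, i.2, j.2⟩⟩ + F i j
    else if hji : (j : Fin n) < i then
      e ⟨⟨(j, i), hji⟩, Finset.mem_filter.2 ⟨Finset.mem_univ _, j.2, i.2⟩⟩ + F i j
    else 0 with hφ
  set ψ : (T₂ → ℝ) → ℝ := fun e => ∑ j : S, w j *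
    if hij : i < j then
      e ⟨⟨(i, j), hij⟩, Finset.mem_filter.2 ⟨Finset.mem_univ _, fun hp => hi hp.1⟩⟩
    else if hji : (j : Fin n) < i then
      e ⟨⟨(j, i), hji⟩, Finset.mem_filter.2 ⟨Finset.mem_univ _, fun hp => hi hp.2⟩⟩
    else 0 with hψ
  have hφm : Measurable φ := by
    refine measurable_pi_lambda _ fun a => measurable_pi_lambda _ fun b => ?_
    simp only [hφ]
    split_ifs
    · exact (measurable_pi_apply _).add_const _
    · exact (measurable_pi_apply _).add_const _
    · exact measurable_const
  have hψm : Measurable ψ := by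
    refine Finset.measurable_sum _ fun j _ => Measurable.const_mul ?_ _
    split_ifs
    · exact measurable_pi_apply _
    · exact measurable_pi_apply _
    · exact measurable_const
  convert hind.comp hφm hψm using 1
  · funext ω
    ext a b
    change A ω a b = if (a : Fin n) < b then A ω a b - F a b + F a b else
      if (b : Fin n) < a then A ω b a - F b a + F a b else 0
    split_ifs with h1 h2
    · ring
    · rw [h.mean_symm a b, (h.symm ω).apply b a]; ring
    · rw [show (a : Fin n) = b by omega, h.diag]
  · funext ω
    rw [single_one_dotProduct, mulVec_extendZero]
    simp only [Function.comp_apply, hψ]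
    refine Finset.sum_congr rfl fun j _ => ?_
    have hne : i ≠ j := fun he => hi (he ▸ j.2)
    rw [Matrix.sub_apply]
    split_ifs with h1 h2
    · rfl
    · rw [h.mean_symm i j, (h.symm ω).apply j i]
    · omega

/-- Tuples of points of the regular grid. -/
def gridTuples (m : ℕ) [NeZero m] (S : Finset (Fin n)) : Finset (S → Circle) :=
  open Classical in Finset.univ.image fun (b : S → ZMod m) j => gridZ m (b j)

/-- Differences of distances from two grid points to the tuple `x`. -/
def gridContrast (m : ℕ) [NeZero m] (x : S → Circle) (a a' : ZMod m) (j : S) : ℝ :=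
  geoDist (gridZ m a') (x j) - geoDist (gridZ m a) (x j)

/-- The event that, the initial positions being `x`, the noise between the point `i` and the
points of `S` changes the refinement criterion a lot. -/
def refinementEvent (m : ℕ) [NeZero m] (loc : SpectralLocalizer n)
    (F : Matrix (Fin n) (Fin n) ℝ) (S : Finset (Fin n)) : Set (Matrix (Fin n) (Fin n) ℝ) :=
  ⋃ i ∈ Sᶜ, ⋃ a ∈ (Finset.univ : Finset (ZMod m)), ⋃ a' ∈ (Finset.univ : Finset (ZMod m)),
    ⋃ x ∈ gridTuples m S, ({M | loc.toFun S (subMatrix M S) = x} ∩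
      tailEvent F (Pi.single i 1) (extendZero S (gridContrast m x a a')) √(10 * Real.log n))

lemma SpectralLocalizer.measurableSet_eq (loc : SpectralLocalizer n) (hS : S.card = n / 4)
    (x : S → Circle) : MeasurableSet {M | loc.toFun S M = x} := by
  convert loc.measurable S hS (measurableSet_singleton fun i => (x i : ℂ)) using 1
  ext M
  simp only [Set.mem_ofPred_eq, Set.mem_preimage, Set.mem_singleton_iff, funext_iff, Circle.ext_iff]

lemma measurable_subMatrix :
    Measurable fun M : Matrix (Fin n) (Fin n) ℝ => subMatrix M S :=
  measurable_pi_lambda _ fun i => measurable_pi_lambda _ fun j =>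
    measurable_entry (i : Fin n) (j : Fin n)

lemma measurableSet_refinementEvent {m : ℕ} [NeZero m] (loc : SpectralLocalizer n)
    (hS : S.card = n / 4) : MeasurableSet (refinementEvent m loc F S) :=
  Finset.measurableSet_biUnion _ fun _ _ => Finset.measurableSet_biUnion _ fun _ _ =>
    Finset.measurableSet_biUnion _ fun _ _ => Finset.measurableSet_biUnion _ fun x _ =>
      (measurable_subMatrix (loc.measurableSet_eq hS x)).inter (measurableSet_tailEvent _ _ _)

lemma noise_le_of_notMem_refinementEvent {m : ℕ} [NeZero m] {loc : SpectralLocalizer n}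
    {M : Matrix (Fin n) (Fin n) ℝ} (hM : M ∉ refinementEvent m loc F S) (τ : S ≃ ZMod m)
    (hτ : ∀ j, loc.toFun S (subMatrix M S) j = gridZ m (τ j)) {i : Fin n} (hi : i ∉ S)
    {z z' : Circle} (hz : z ∈ regularGrid m) (hz' : z' ∈ regularGrid m) :
    -(√(20 * Real.log n) * √(∑ j, (geoDist z (loc.toFun S (subMatrix M S) j) -
        geoDist z' (loc.toFun S (subMatrix M S) j)) ^ 2)) ≤
      ∑ j : S, (M i j - F i j) * (geoDist z (loc.toFun S (subMatrix M S) j) -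
        geoDist z' (loc.toFun S (subMatrix M S) j)) := by
  obtain ⟨a, rfl⟩ := exists_gridZ_of_mem hz
  obtain ⟨a', rfl⟩ := exists_gridZ_of_mem hz'
  set x := loc.toFun S (subMatrix M S) with hx
  simp only [refinementEvent, Set.mem_iUnion, not_exists, Set.mem_inter_iff, not_and] at hM
  have hmem : x ∈ gridTuples m S := by
    classical
    rw [gridTuples, Finset.mem_image]
    exact ⟨τ, Finset.mem_univ _, funext fun j => (hτ j).symm⟩
  have h1 := hM i (Finset.mem_compl.2 hi) a (Finset.mem_univ _) a' (Finset.mem_univ _) x hmem rfl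
  rw [tailEvent, Set.mem_ofPred_eq, not_lt, extendZero_dotProduct_self, single_one_dotProduct,
    single_one_dotProduct, Pi.single_eq_same, one_mul, mulVec_extendZero] at h1
  have e1 : ∑ j : S, gridContrast m x a a' j * (M - F) i j =
      -∑ j : S, (M i j - F i j) * (geoDist (gridZ m a) (x j) - geoDist (gridZ m a') (x j)) := by
    rw [← Finset.sum_neg_distrib]
    refine Finset.sum_congr rfl fun j _ => ?_
    rw [gridContrast, Matrix.sub_apply]
    ring
  have e2 : gridContrast m x a a' ⬝ᵥ gridContrast m x a a' =
      ∑ j, (geoDist (gridZ m a) (x j) - geoDist (gridZ m a') (x j)) ^ 2 :=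
    Finset.sum_congr rfl fun j _ => by rw [gridContrast]; ring
  have e3 : √(20 * Real.log n) = √(10 * Real.log n) * √2 := by
    rw [← Real.sqrt_mul' _ zero_le_two]; congr 1; ring
  rw [e1, e2, Real.sqrt_mul zero_le_two, ← mul_assoc, ← e3] at h1
  linarith

/-- A union bound over all grid tuples x would be too costly. The events that the localization
equals x are disjoint and independent of the noise in row i, so the sum over x is an average and
costs nothing. Only the n m² choices of i, a, a' remain, each with probability at most n⁻⁵. -/
lemma IsObservation.measure_refinementEvent_le {Ω : Type*} [MeasurableSpace Ω] {P : Measure Ω}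
    [IsProbabilityMeasure P] {A : Ω → Matrix (Fin n) (Fin n) ℝ} (h : IsObservation P A F)
    (hn : 16 ≤ n) {m : ℕ} [NeZero m] (hm : m ≤ n) (loc : SpectralLocalizer n)
    (hS : S.card = n / 4) :
    P.real (A ⁻¹' refinementEvent m loc F S) ≤ 1 / (n : ℝ) ^ 2 := by
  have hn0 : (16 : ℝ) ≤ n := by exact_mod_cast hn
  have hlog : 0 ≤ Real.log n := Real.log_nonneg (by linarith)
  have hexp : Real.exp (-(√(10 * Real.log n)) ^ 2 / 2) = ((n : ℝ) ^ 5)⁻¹ := by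
    rw [Real.sq_sqrt (by positivity), ← Real.exp_log (by positivity : (0 : ℝ) <
      ((n : ℝ) ^ 5)⁻¹), Real.log_inv, Real.log_pow]
    congr 1
    push_cast
    ring
  set L : (S → Circle) → Set Ω := fun x => {ω | loc.toFun S (subMatrix (A ω) S) = x} with hL
  have hLm : ∀ x, MeasurableSet (L x) := fun x =>
    h.measurable (measurable_subMatrix (loc.measurableSet_eq hS x))
  have hsumL : ∑ x ∈ gridTuples m S, P.real (L x) ≤ 1 := by
    rw [← measureReal_biUnion_finset (fun x _ y _ hxy => ?_) fun x _ => hLm x]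
    · exact measureReal_le_one
    · rw [Function.onFun, Set.disjoint_left]
      intro ω hω hω'
      exact hxy (hω.symm.trans hω')
  have hpre : A ⁻¹' refinementEvent m loc F S = ⋃ i ∈ Sᶜ,
      ⋃ a ∈ (Finset.univ : Finset (ZMod m)), ⋃ a' ∈ (Finset.univ : Finset (ZMod m)),
      ⋃ x ∈ gridTuples m S, (L x ∩ A ⁻¹'
        tailEvent F (Pi.single i 1) (extendZero S (gridContrast m x a a'))
          √(10 * Real.log n)) := by
    simp only [refinementEvent, Set.preimage_iUnion, Set.preimage_inter]
    rfl
  have hone : ∀ i ∈ Sᶜ, ∀ a a' : ZMod m, P.real (⋃ x ∈ gridTuples m S, (L x ∩ A ⁻¹'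
        tailEvent F (Pi.single i 1) (extendZero S (gridContrast m x a a'))
          √(10 * Real.log n))) ≤ ((n : ℝ) ^ 5)⁻¹ := by
    intro i hi a a'
    refine (measureReal_biUnion_finset_le _ _).trans ?_
    calc _ ≤ ∑ x ∈ gridTuples m S, P.real (L x) * ((n : ℝ) ^ 5)⁻¹ := by
          refine Finset.sum_le_sum fun x _ => ?_
          have h1 := (h.indepFun_block (Finset.mem_compl.1 hi)
            (gridContrast m x a a')).measure_inter_preimage_eq_mul
            {M | loc.toFun S M = x} (Set.Ioi (√(10 * Real.log n) *
              √(2 * (((Pi.single i 1 : Fin n → ℝ) ⬝ᵥ Pi.single i 1) *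
                (extendZero S (gridContrast m x a a') ⬝ᵥ
                  extendZero S (gridContrast m x a a'))))))
            (loc.measurableSet_eq hS x) measurableSet_Ioi
          have h2 : P.real (L x ∩ A ⁻¹' tailEvent F (Pi.single i 1)
              (extendZero S (gridContrast m x a a')) √(10 * Real.log n)) =
              P.real (L x) * P.real (A ⁻¹' tailEvent F (Pi.single i 1)
              (extendZero S (gridContrast m x a a')) √(10 * Real.log n)) := by
            rw [Measure.real, Measure.real, Measure.real, ← ENNReal.toReal_mul]
            exact congrArg ENNReal.toReal h1
          rw [h2, ← hexp]
          exact mul_le_mul_of_nonneg_left (h.measure_tailEvent_le _ _ (by positivity))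
            measureReal_nonneg
      _ = (∑ x ∈ gridTuples m S, P.real (L x)) * ((n : ℝ) ^ 5)⁻¹ := by rw [Finset.sum_mul]
      _ ≤ 1 * ((n : ℝ) ^ 5)⁻¹ := by gcongr
      _ = _ := one_mul _
  rw [hpre]
  refine (measureReal_biUnion_finset_le _ _).trans ?_
  calc _ ≤ ∑ i ∈ Sᶜ, ∑ a : ZMod m, ∑ a' : ZMod m, ((n : ℝ) ^ 5)⁻¹ := by
        refine Finset.sum_le_sum fun i hi => (measureReal_biUnion_finset_le _ _).trans ?_
        refine Finset.sum_le_sum fun a _ => (measureReal_biUnion_finset_le _ _).trans ?_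
        exact Finset.sum_le_sum fun a' _ => hone i hi a a'
    _ = Sᶜ.card * (m * (m * ((n : ℝ) ^ 5)⁻¹)) := by
        simp only [Finset.sum_const, Finset.card_univ, ZMod.card, nsmul_eq_mul]
    _ ≤ n * (n * (n * ((n : ℝ) ^ 5)⁻¹)) := by
        have h1 : Sᶜ.card ≤ n := by simpa using Finset.card_le_univ Sᶜ
        gcongr
    _ = 1 / (n : ℝ) ^ 2 := by field_simp

end Events

/-! ### Localization and refinement from one subset -/

/-- A uniform entry bound a costs a times the dimension by Cauchy–Schwarz. The diagonal may be off
by an extra 1 because F vanishes there while a circulant symbol need not; this costs only 1 in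
operator norm. -/
lemma opBound_of_entries {ι : Type*} [Fintype ι] [DecidableEq ι] {W : Matrix ι ι ℝ} {a : ℝ}
    (ha : 0 ≤ a) (hW : ∀ i j, |W i j| ≤ a + if i = j then 1 else 0) :
    OpBound W (a * Fintype.card ι + 1) := by
  refine opBound_of_unit fun u v hu hv => ?_
  have hle : u ⬝ᵥ W *ᵥ v ≤ a * ((∑ i, |u i|) * ∑ j, |v j|) + ∑ i, |u i| * |v i| := by
    have e : ∑ i, |u i| * |v i| = ∑ i, ∑ j, |u i| * |v j| * (if i = j then 1 else 0) := by
      simp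
    rw [e, Finset.sum_mul_sum, Finset.mul_sum, ← Finset.sum_add_distrib]
    simp only [dotProduct, Matrix.mulVec, Finset.mul_sum]
    refine Finset.sum_le_sum fun i _ => ?_
    rw [← Finset.sum_add_distrib]
    refine Finset.sum_le_sum fun j _ => ?_
    refine (le_abs_self _).trans ?_
    rw [abs_mul, abs_mul]
    calc |u i| * (|W i j| * |v j|) = |u i| * |v j| * |W i j| := by ring
      _ ≤ |u i| * |v j| * (a + if i = j then 1 else 0) := by
        gcongr
        exact hW i j
      _ = _ := by ring
  have hsq : ∀ w : ι → ℝ, w ⬝ᵥ w = 1 → (∑ i, |w i|) ^ 2 ≤ Fintype.card ι := by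
    intro w hw
    have h1 := sq_sum_le_card_mul_sum_sq (s := Finset.univ) (f := fun i => |w i|)
    have h2 : ∑ i, |w i| ^ 2 = 1 := by
      rw [← hw]
      exact Finset.sum_congr rfl fun i _ => by rw [sq_abs, sq]
    rwa [h2, mul_one, Finset.card_univ] at h1
  have hprod : (∑ i, |u i|) * ∑ j, |v j| ≤ Fintype.card ι := by
    nlinarith [hsq u hu, hsq v hv, sq_nonneg ((∑ i, |u i|) - ∑ j, |v j|)]
  have hdiag : ∑ i, |u i| * |v i| ≤ 1 := by
    have h1 : ∑ i, |u i| * |v i| ≤ ∑ i, (u i * u i + v i * v i) / 2 := by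
      refine Finset.sum_le_sum fun i _ => ?_
      nlinarith [sq_nonneg (|u i| - |v i|), abs_mul_abs_self (u i), abs_mul_abs_self (v i)]
    rw [← Finset.sum_div, Finset.sum_add_distrib] at h1
    change _ ≤ (u ⬝ᵥ u + v ⬝ᵥ v) / 2 at h1
    linarith
  exact hle.trans (add_le_add (mul_le_mul_of_nonneg_left hprod ha) hdiag)

lemma OpBound.add {ι : Type*} [Fintype ι] {V W : Matrix ι ι ℝ} {a b : ℝ} (hV : OpBound V a)
    (hW : OpBound W b) : OpBound (V + W) (a + b) := by
  intro u v
  rw [Matrix.add_mulVec, dotProduct_add, add_mul]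
  exact (abs_add_le _ _).trans (add_le_add (hV u v) (hW u v))

lemma OpBound.mono {ι : Type*} [Fintype ι] {W : Matrix ι ι ℝ} {a b : ℝ} (hW : OpBound W a)
    (hab : a ≤ b) : OpBound W b := fun u v =>
  (hW u v).trans (mul_le_mul_of_nonneg_right hab (by positivity))

section Single

variable {n m : ℕ} [NeZero m] {ca ce cl cL : ℝ} {x : Fin n → Circle} {f : Circle → Circle → ℝ}
  {F : Matrix (Fin n) (Fin n) ℝ} {S : Finset (Fin n)}

/-- The mean matrix is close to a circulant matrix. -/
lemma opBound_mean_sub_circulant (hcL : 0 ≤ cL) (hce : 0 ≤ ce) (hf : BiLipschitz n cl cL ce f)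
    (hF : ∀ i j, i ≠ j → F i j = f (x i) (x j)) (hF0 : ∀ i, F i i = 0) (τ : S ≃ ZMod m) {c : ℝ}
    (hc : 0 ≤ c) (hτ : ∀ j : S, geoDist (x j) (gridZ m (τ j)) ≤ c * √(Real.log n / n))
    {w : ℕ → ℝ} (hw : ∀ a b : ZMod m, |f (gridZ m a) (gridZ m b) - arcSum m w (a - b)| ≤
        ce * √(Real.log n / n)) :
    OpBound (subMatrix F S - circulantMatrix τ w)
      ((2 * cL * c + 3 * ce) * √(Real.log n / n) * m + 1) := by
  have hcard : Fintype.card S = m := by rw [Fintype.card_congr τ, ZMod.card]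
  set η := √(Real.log n / n)
  have hη : 0 ≤ η := Real.sqrt_nonneg _
  have h := opBound_of_entries (W := subMatrix F S - circulantMatrix τ w)
    (a := (2 * cL * c + 3 * ce) * η) (by positivity) fun i j => ?_
  · rwa [hcard] at h
  rw [Matrix.sub_apply, circulantMatrix, Matrix.of_apply, subMatrix, Matrix.submatrix_apply]
  have h1 := hw (τ i) (τ j)
  split_ifs with hij
  · subst hij
    rw [hF0, zero_sub, abs_neg]
    have h2 := hf.mem_Icc (gridZ m (τ i)) (gridZ m (τ i))
    have h3 : 0 ≤ (2 * cL * c + 2 * ce) * η := by positivity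
    rw [abs_le] at h1 ⊢
    constructor <;> linarith [h2.1, h2.2, h1.1, h1.2]
  · rw [hF _ _ fun h => hij (Subtype.ext h), add_zero]
    have h2 := hf.upper (x i) (x j) (gridZ m (τ j))
    have h3 := hf.upper (gridZ m (τ j)) (x i) (gridZ m (τ i))
    rw [hf.symm _ (x i), hf.symm _ (gridZ m (τ i))] at h3
    have h4 := mul_le_mul_of_nonneg_left (hτ i) hcL
    have h5 := mul_le_mul_of_nonneg_left (hτ j) hcL
    calc |f (x i) (x j) - arcSum m w (τ i - τ j)|
        ≤ |f (x i) (x j) - f (x i) (gridZ m (τ j))| +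
          (|f (x i) (gridZ m (τ j)) - f (gridZ m (τ i)) (gridZ m (τ j))| +
          |f (gridZ m (τ i)) (gridZ m (τ j)) - arcSum m w (τ i - τ j)|) := by
          refine le_trans (le_of_eq ?_) ((abs_add_le _ _).trans
            (add_le_add le_rfl (abs_add_le _ _)))
          congr 1
          ring
      _ ≤ (cL * (c * η) + ce * η) + ((cL * (c * η) + ce * η) + ce * η) :=
          add_le_add (h2.trans (by linarith)) (add_le_add (h3.trans (by linarith)) h1)
      _ = _ := by ring

/-- The initial positions are `ℓ¹`-close to the true ones. -/
lemma localization_close (hcl : 0 < cl) (hcL : 0 ≤ cL) (hce : 0 ≤ ce)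
    (hf : BiLipschitz n cl cL ce f) (hg : IsGeometric f)
    (hF : ∀ i j, i ≠ j → F i j = f (x i) (x j)) (hF0 : ∀ i, F i i = 0) (τ : S ≃ ZMod m) {c : ℝ}
    (hc : 0 ≤ c) (hτ : ∀ j : S, geoDist (x j) (gridZ m (τ j)) ≤ c * √(Real.log n / n))
    (hn : n = 4 * m) (hm : 100 ≤ m) (hη1 : √(Real.log n / n) ≤ 1)
    (hη : 320000 * (13 + 2 * cL * c + 3 * ce) * √(Real.log n / n) ≤ cl)
    {M : Matrix (Fin n) (Fin n) ℝ} (hM : M.IsSymm) (hME : M ∉ operatorEvent F S)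
    {xt : S → Circle} (hxt : IsSpectralLocalization (subMatrix M S) xt) :
    ∃ Q : ℂ ≃ₗᵢ[ℝ] ℂ, ∑ j, geoDist (xt j) (orthAct Q (x j)) ≤
      (4000000 / cl * (13 + 2 * cL * c + 3 * ce) + 60 + c) * (n * √(Real.log n / n)) := by
  obtain ⟨w, hw, hw', hwf⟩ := exists_arcSum_approx hf hg (m := m)
  obtain ⟨y, hy, z, σ, k, hz, hσ, -, hmin, hx⟩ := hxt
  have hOp1 := opBound_of_notMem_operatorEvent (by omega) hME
  have hOp2 := opBound_mean_sub_circulant hcL hce hf hF hF0 τ hc hτ hwf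
  have hn0 : (400 : ℝ) ≤ n := by exact_mod_cast (by omega : 400 ≤ n)
  have hnR : (n : ℝ) = 4 * m := by rw [hn]; push_cast; ring
  have hmn : (m : ℝ) ≤ n := by rw [hnR]; linarith [(Nat.cast_nonneg m : (0 : ℝ) ≤ m)]
  have hlog : 1 ≤ Real.log n := by
    rw [Real.le_log_iff_exp_le (by linarith)]
    linarith [Real.exp_one_lt_d9]
  have hroot : √(n * Real.log n) = n * √(Real.log n / n) := by
    rw [show n * Real.log n = (n : ℝ) ^ 2 * (Real.log n / n) by field_simp,
      Real.sqrt_mul (by positivity), Real.sqrt_sq (by positivity)]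
  have hsq : n * √(Real.log n / n) ^ 2 = Real.log n := by
    rw [Real.sq_sqrt (by positivity)]; field_simp
  rw [hroot] at hOp1
  set η := √(Real.log n / n) with hηdef
  have hη0 : 0 ≤ η := Real.sqrt_nonneg _
  -- This absorbs additive constants, such as the diagonal 1 and the 60 of the uniform
  -- approximation, into multiples of nη.
  have hone : 1 ≤ n * η := by
    calc (1 : ℝ) ≤ n * η ^ 2 := by rw [hsq]; exact hlog
      _ ≤ n * η := by
        gcongr
        rw [sq]
        exact mul_le_of_le_one_left hη0 hη1
  -- 13 is 12 from the noise plus 1 from the diagonal; the other terms bound the distance from the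
  -- mean to the circulant matrix.
  set c' := 13 + 2 * cL * c + 3 * ce with hc'
  have hc'0 : 0 ≤ c' := by positivity
  have hOp : OpBound (subMatrix M S - circulantMatrix τ w) (c' * (n * η)) := by
    have h1 := hOp1.add hOp2
    rw [sub_add_sub_cancel] at h1
    refine h1.mono ?_
    have h2 : (2 * cL * c + 3 * ce) * η * m ≤ (2 * cL * c + 3 * ce) * η * n := by gcongr
    rw [hc']
    linarith
  -- With n = 4m this is exactly the assumption on η, since 320000 = 4 · 4 · 20000.
  have hρ : 4 * (c' * (n * η)) ≤ cl * m / 20000 := by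
    rw [le_div_iff₀ (by norm_num), hnR]
    have := mul_le_mul_of_nonneg_right hη (Nat.cast_nonneg m : (0 : ℝ) ≤ m)
    linarith
  have hMS : (subMatrix M S).IsSymm := by
    ext i j
    exact hM.apply i j
  obtain ⟨Q, hQ⟩ := vanilla_normalized_close hm τ hcl hw hw' hMS (by positivity) hρ hOp hy hz
  have hU := uniformApproximation_close τ Q hσ hmin hx
  refine ⟨Q, ?_⟩
  have hcard : Fintype.card S = m := by rw [Fintype.card_congr τ, ZMod.card]
  have hsum : ∑ j : S, geoDist (x j) (gridZ m (τ j)) ≤ c * (n * η) := by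
    calc _ ≤ ∑ _j : S, c * η := Finset.sum_le_sum fun j _ => hτ j
      _ = m * (c * η) := by rw [Finset.sum_const, Finset.card_univ, hcard, nsmul_eq_mul]
      _ ≤ n * (c * η) := by gcongr
      _ = _ := by ring
  have htri : ∑ j, geoDist (xt j) (orthAct Q (x j)) ≤
      ∑ j, geoDist (xt j) (orthAct Q (gridZ m (τ j))) +
        ∑ j : S, geoDist (x j) (gridZ m (τ j)) := by
    rw [← Finset.sum_add_distrib]
    refine Finset.sum_le_sum fun j _ => (geoDist_triangle _ (orthAct Q (gridZ m (τ j))) _).trans ?_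
    rw [geoDist_orthAct, geoDist_comm (gridZ m (τ j))]
  have h60 : 20 * ∑ i, ‖(z i : ℂ) - Q (gridZ m (τ i))‖ ≤ 4000000 / cl * (c' * (n * η)) := by
    calc _ ≤ 20 * (200000 / cl * (c' * (n * η))) := by gcongr
      _ = _ := by ring
  calc _ ≤ (4000000 / cl * (c' * (n * η)) + 60 * (n * η)) + c * (n * η) := by linarith
    _ = _ := by ring

/-- The refined positions are uniformly close to the true ones. -/
lemma exists_refinement_close (hcl : 0 < cl) (hcL : 0 ≤ cL) (hce : 0 ≤ ce)
    (hf : BiLipschitz n cl cL ce f) (hg : IsGeometric f)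
    (hF : ∀ i j, i ≠ j → F i j = f (x i) (x j)) (hF0 : ∀ i, F i i = 0) (τ : S ≃ ZMod m) {c : ℝ}
    (hc : 0 ≤ c) (hτ : ∀ j : S, geoDist (x j) (gridZ m (τ j)) ≤ c * √(Real.log n / n))
    (hn : n = 4 * m) (hm : 100 ≤ m) (hη1 : √(Real.log n / n) ≤ 1)
    (hη : 320000 * (13 + 2 * cL * c + 3 * ce) * √(Real.log n / n) ≤ cl)
    {M : Matrix (Fin n) (Fin n) ℝ} (hM : M.IsSymm) (hME : M ∉ operatorEvent F S)
    {loc : SpectralLocalizer n} (hMR : M ∉ refinementEvent m loc F S) {y : Fin n → Circle}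
    (hy : IsRefinement M S (loc.toFun S (subMatrix M S)) y) :
    ∃ Q : ℂ ≃ₗᵢ[ℝ] ℂ, ∀ i ∉ S, geoDist (y i) (orthAct Q (x i)) ≤
      (16 + 256 / cl * (5 + cL * (4000000 / cl * (13 + 2 * cL * c + 3 * ce) + 60 + c) +
        4 * cL + 3 * ce)) * √(Real.log n / n) := by
  have hcard : Fintype.card S = m := by rw [Fintype.card_congr τ, ZMod.card]
  have hS : S.card = n / 4 := by rw [← Fintype.card_coe, hcard]; omega
  have hMS : (subMatrix M S).IsSymm := by
    ext i j
    exact hM.apply i j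
  have hspec := loc.spec S hS _ hMS
  obtain ⟨Q, hQ⟩ := localization_close hcl hcL hce hf hg hF hF0 τ hc hτ hn hm hη1 hη hM hME hspec
  obtain ⟨yv, -, hyx⟩ := hspec
  obtain ⟨τ', hτ'⟩ := exists_grid_labelling hcard hyx
  refine ⟨Q, fun i hi => ?_⟩
  have hyi := hy i hi
  rw [show n / 4 = m by omega] at hyi
  have hn0 : (400 : ℝ) ≤ n := by exact_mod_cast (by omega : 400 ≤ n)
  have hnR : (n : ℝ) = 4 * m := by rw [hn]; push_cast; ring
  have hm0 : (0 : ℝ) < m := by exact_mod_cast (by omega : 0 < m)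
  have hmn : (m : ℝ) ≤ n := by rw [hnR]; linarith
  have hlog : 1 ≤ Real.log n := by
    rw [Real.le_log_iff_exp_le (by linarith)]
    linarith [Real.exp_one_lt_d9]
  have hmain := refinement_close hcl hcL hce hf hg τ' hτ' Q hQ
    (Real.sqrt_nonneg (20 * Real.log n)) (i := i) (fun z hz z' hz' => by
      refine (noise_le_of_notMem_refinementEvent hMR τ' hτ' hi hz hz').trans (le_of_eq ?_)
      refine Finset.sum_congr rfl fun j _ => ?_
      rw [hF i j fun h => hi (h ▸ j.2)]) hyi.1 hyi.2
  refine hmain.trans ?_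
  have hroot : √(n * Real.log n) = n * √(Real.log n / n) := by
    rw [show n * Real.log n = (n : ℝ) ^ 2 * (Real.log n / n) by field_simp,
      Real.sqrt_mul (by positivity), Real.sqrt_sq (by positivity)]
  have hsq : n * √(Real.log n / n) ^ 2 = Real.log n := by
    rw [Real.sq_sqrt (by positivity)]; field_simp
  set η := √(Real.log n / n) with hηdef
  have hη0 : 0 ≤ η := Real.sqrt_nonneg _
  have hone : 1 ≤ n * η := by
    calc (1 : ℝ) ≤ n * η ^ 2 := by rw [hsq]; exact hlog
      _ ≤ n * η := by
        gcongr
        rw [sq]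
        exact mul_le_of_le_one_left hη0 hη1
  -- The stronger bound nη² = log n ≥ 1 makes the grid step π/m itself O(η).
  have hnη : 1 ≤ n * η * η := by
    calc (1 : ℝ) ≤ n * η ^ 2 := by rw [hsq]; exact hlog
      _ = _ := by ring
  have hnoise : √(20 * Real.log n) * √m ≤ 5 * (n * η) := by
    rw [← hroot, ← Real.sqrt_mul (by positivity), show (5 : ℝ) = √(5 ^ 2) by
      rw [Real.sqrt_sq (by norm_num)], ← Real.sqrt_mul (by positivity)]
    refine Real.sqrt_le_sqrt ?_
    nlinarith [mul_le_mul_of_nonneg_right hmn (by linarith : 0 ≤ Real.log n)]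
  have hpi : Real.pi / m ≤ 16 * η := by
    rw [div_le_iff₀ hm0]
    calc Real.pi ≤ 4 * (n * η) := by linarith [Real.pi_le_four]
      _ = 16 * η * m := by rw [hnR]; ring
  set K := 4000000 / cl * (13 + 2 * cL * c + 3 * ce) + 60 + c with hK
  have hin : √(20 * Real.log n) * √m + cL * (K * (n * η)) + cL * Real.pi + 3 * (m * (ce * η)) ≤
      (5 + cL * K + 4 * cL + 3 * ce) * (n * η) := by
    have h1 : cL * Real.pi ≤ 4 * cL * (n * η) := by
      calc cL * Real.pi ≤ cL * (4 * (n * η)) := by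
            gcongr
            linarith [Real.pi_le_four]
        _ = _ := by ring
    have h2 : 3 * (m * (ce * η)) ≤ 3 * (n * (ce * η)) := by gcongr
    linarith
  calc Real.pi / m + 64 / (cl * m) * (√(20 * Real.log n) * √m + cL * (K * (n * η)) +
        cL * Real.pi + 3 * (m * (ce * η)))
      ≤ 16 * η + 64 / (cl * m) * ((5 + cL * K + 4 * cL + 3 * ce) * (n * η)) := by gcongr
    _ = _ := by rw [hnR]; field_simp; ring

end Single

/-! ### The full procedure -/

/-- The event that the noise misbehaves for one of the two subsets. -/
def noiseEvent {n : ℕ} (m : ℕ) [NeZero m] (loc loc' : SpectralLocalizer n)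
    (F : Matrix (Fin n) (Fin n) ℝ) (p : Finset (Fin n) × Finset (Fin n)) :
    Set (Matrix (Fin n) (Fin n) ℝ) :=
  (operatorEvent F p.1 ∪ refinementEvent m loc F p.1) ∪
    (operatorEvent F p.2 ∪ refinementEvent m loc' F p.2)

lemma IsObservation.measure_noiseEvent_le {n : ℕ} {F : Matrix (Fin n) (Fin n) ℝ} {Ω : Type*}
    [MeasurableSpace Ω] {P : Measure Ω} [IsProbabilityMeasure P]
    {A : Ω → Matrix (Fin n) (Fin n) ℝ} (h : IsObservation P A F) (hn : 16 ≤ n) {m : ℕ} [NeZero m]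
    (hm : n = 4 * m) (loc loc' : SpectralLocalizer n) {p : Finset (Fin n) × Finset (Fin n)}
    (hp : p ∈ splitPairs n) : P.real (A ⁻¹' noiseEvent m loc loc' F p) ≤ 4 / (n : ℝ) ^ 2 := by
  obtain ⟨h1, h2, -⟩ := hp
  have e : A ⁻¹' noiseEvent m loc loc' F p =
      (A ⁻¹' operatorEvent F p.1 ∪ A ⁻¹' refinementEvent m loc F p.1) ∪
      (A ⁻¹' operatorEvent F p.2 ∪ A ⁻¹' refinementEvent m loc' F p.2) := rfl
  rw [e]
  have h3 := h.measure_operatorEvent_le hn (S := p.1) (by omega)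
  have h4 := h.measure_operatorEvent_le hn (S := p.2) (by omega)
  have h5 := h.measure_refinementEvent_le hn (m := m) (by omega) loc h1
  have h6 := h.measure_refinementEvent_le hn (m := m) (by omega) loc' h2
  have h7 := measureReal_union_le (μ := P) (A ⁻¹' operatorEvent F p.1 ∪
    A ⁻¹' refinementEvent m loc F p.1)
    (A ⁻¹' operatorEvent F p.2 ∪ A ⁻¹' refinementEvent m loc' F p.2)
  have h8 := measureReal_union_le (μ := P) (A ⁻¹' operatorEvent F p.1)
    (A ⁻¹' refinementEvent m loc F p.1)
  have h9 := measureReal_union_le (μ := P) (A ⁻¹' operatorEvent F p.2)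
    (A ⁻¹' refinementEvent m loc' F p.2)
  have e4 : (4 : ℝ) / (n : ℝ) ^ 2 = 1 / (n : ℝ) ^ 2 + 1 / (n : ℝ) ^ 2 +
    (1 / (n : ℝ) ^ 2 + 1 / (n : ℝ) ^ 2) := by ring
  linarith

/-- Deterministic analysis of the procedure, outside of the exceptional events. -/
lemma dInf_le_of_isLocalizeAndRefine {n m : ℕ} [NeZero m] {ca ce cl cL : ℝ} {x : Fin n → Circle}
    {f : Circle → Circle → ℝ} {F : Matrix (Fin n) (Fin n) ℝ} (hca : 0 ≤ ca) (hcl : 0 < cl)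
    (hcL : 0 ≤ cL) (hce : 0 ≤ ce) (hf : BiLipschitz n cl cL ce f) (hg : IsGeometric f)
    (hF : ∀ i j, i ≠ j → F i j = f (x i) (x j)) (hF0 : ∀ i, F i i = 0)
    {σ : Equiv.Perm (Fin n)}
    (hσ : ∀ j, geoDist (x j) (gridPoint n (σ j)) ≤ ca * √(Real.log n / n)) {c K : ℝ}
    (hc : c = ca + 24 * Real.pi)
    (hK : K = 16 + 256 / cl * (5 + cL * (4000000 / cl * (13 + 2 * cL * c + 3 * ce) + 60 + c) +
        4 * cL + 3 * ce))
    (hn : n = 4 * m) (hm : 100 ≤ m) (hη1 : √(Real.log n / n) ≤ 1)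
    (hηa : ca * √(Real.log n / n) ≤ 1 / 10)
    (hη : 320000 * (13 + 2 * cL * c + 3 * ce) * √(Real.log n / n) ≤ cl)
    {M : Matrix (Fin n) (Fin n) ℝ} (hM : M.IsSymm) {loc loc' : SpectralLocalizer n}
    {S S' : Finset (Fin n)} (hS : (S, S') ∈ splitPairs n)
    (hWS : WellSpread σ (3 * n * √(Real.log n / n)) S)
    (hWS' : WellSpread σ (3 * n * √(Real.log n / n)) S')
    (hME : M ∉ noiseEvent m loc loc' F (S, S')) {xhat : Fin n → Circle}
    (hx : IsLocalizeAndRefine loc loc' M S S' xhat) :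
    ∃ Q : ℂ ≃ₗᵢ[ℝ] ℂ, dInf xhat (fun i => orthAct Q (x i)) ≤
      81 * K * √(Real.log n / n) := by
  obtain ⟨hS1, hS2, hdisj⟩ := hS
  simp only at hS1 hS2 hdisj
  obtain ⟨y, y', Qhat, hy, hy', hmin, hxhat⟩ := hx
  simp only [noiseEvent, Set.mem_union, not_or] at hME
  have hpi := Real.pi_pos
  have hn0 : (0 : ℝ) < n := by exact_mod_cast (by omega : 0 < n)
  have hc0 : 0 ≤ c := by rw [hc]; positivity
  -- The labelling error 8πT/n with T = 3nη is 24πη, to which the assumed ca η is added.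
  have hlabel : ∀ T : Finset (Fin n), T.card = n / 4 →
      WellSpread σ (3 * n * √(Real.log n / n)) T → ∃ τ : T ≃ ZMod m,
        ∀ j : T, geoDist (x j) (gridZ m (τ j)) ≤ c * √(Real.log n / n) := by
    intro T hT hWT
    obtain ⟨τ, hτ⟩ := hWT.exists_labelling hn (by omega)
    refine ⟨τ, fun j => (geoDist_triangle _ (gridPoint n (σ j)) _).trans ?_⟩
    refine (add_le_add (hσ j) (hτ j)).trans (le_of_eq ?_)
    rw [hc]
    field_simp
    ring
  obtain ⟨τ, hτ⟩ := hlabel S hS1 hWS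
  obtain ⟨τ', hτ'⟩ := hlabel S' hS2 hWS'
  obtain ⟨Q, hQ⟩ := exists_refinement_close hcl hcL hce hf hg hF hF0 τ hc0 hτ hn hm hη1 hη hM
    hME.1.1 hME.1.2 hy
  obtain ⟨Q', hQ'⟩ := exists_refinement_close hcl hcL hce hf hg hF hF0 τ' hc0 hτ' hn hm hη1 hη hM
    hME.2.1 hME.2.2 hy'
  rw [← hK] at hQ hQ'
  have hU : n ≤ 2 * (Sᶜ ∩ S'ᶜ).card := by
    have h1 := Finset.card_compl (S ∪ S')
    rw [Finset.compl_union, Finset.card_union_of_disjoint hdisj, Fintype.card_fin] at h1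
    omega
  obtain ⟨i, hi, j, hj, hij⟩ := exists_not_collinear (by omega) hU σ fun j => (hσ j).trans hηa
  have : Nonempty (Fin n) := ⟨i⟩
  have hK0 : 0 ≤ K := by rw [hK]; positivity
  refine ⟨Q, dInf_le fun k => ?_⟩
  have h1 := merging_close hdisj (by positivity) hQ hQ' hmin hxhat hi hj hij k
  linarith

end SpectralSeriation

end

/-! ### Choice of constants and probability budget -/

open SpectralSeriation in
theorem theorem4p1 (ca cb ce cl cL : ℝ) (hca : 0 < ca) (hcb : 0 < cb) (hce : 0 < ce)
    (hcl : 0 < cl) (hclL : cl ≤ cL) :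
    ∃ C : ℝ, 0 < C ∧
      ∀ (n : ℕ), 16 ≤ n → 4 ∣ n →
      -- the data and the two random subsets
      ∀ {Ω : Type*} [MeasurableSpace Ω] (P : Measure Ω) [IsProbabilityMeasure P]
        (A : Ω → Matrix (Fin n) (Fin n) ℝ) (F : Matrix (Fin n) (Fin n) ℝ)
        (S S' : Ω → Finset (Fin n)),
        IsObservation P A F →
        HasLaw (fun ω => (S ω, S' ω)) (uniformOn (splitPairs n)) P →
        IndepFun A (fun ω => (S ω, S' ω)) P →
      -- the assumptions on the latent positions and on the affinity function
      ∀ (x : Fin n → Circle) (f : Circle → Circle → ℝ),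
        (x, f) ∈ representations F cl cL ce →
        IsGeometric f →
        distToRegular x ≤ ca * √(Real.log n / n) →
        cb * n ≤ min (nthEigenvalue F 0 - nthEigenvalue F 1)
          (nthEigenvalue F 2 - nthEigenvalue F 3) →
      -- the error bound, for all possible outputs of the procedure
      ∀ (loc loc' : SpectralLocalizer n),
        ∃ G : Set Ω, MeasurableSet G ∧ 1 - 9 / (n : ℝ) ^ 2 ≤ P.real G ∧
          ∀ ω ∈ G, ∀ xhat : Fin n → Circle,
            IsLocalizeAndRefine loc loc' (A ω) (S ω) (S' ω) xhat →
            ∃ Q : ℂ ≃ₗᵢ[ℝ] ℂ,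
              dInf xhat (fun i => orthAct Q (x i)) ≤ C * √(Real.log n / n) := by
  have hcL : 0 < cL := hcl.trans_le hclL
  have hpi := Real.pi_pos
  obtain ⟨c, hc⟩ : ∃ c, c = ca + 24 * Real.pi := ⟨_, rfl⟩
  have hc0 : 0 < c := by rw [hc]; positivity
  obtain ⟨K, hK⟩ : ∃ K, K = 16 + 256 / cl * (5 + cL * (4000000 / cl *
    (13 + 2 * cL * c + 3 * ce) + 60 + c) + 4 * cL + 3 * ce) := ⟨_, rfl⟩
  -- Below κ all smallness conditions hold: 1/20 gives n ≥ 400 and 6η ≤ 1, the second term serves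
  -- non-collinearity, and the third the spectral perturbation. Above κ the trivial bound π on the
  -- distance suffices, whence π/κ in the final constant.
  set κ := min (1 / 20) (min (1 / (10 * ca)) (cl / (320000 * (13 + 2 * cL * c + 3 * ce)))) with hκ
  have hκ0 : 0 < κ := by
    refine lt_min (by norm_num) (lt_min (by positivity) (by positivity))
  refine ⟨max (81 * K) (Real.pi / κ), lt_max_of_lt_right (by positivity), ?_⟩
  intro n hn h4 Ω _ P _ A F S S' hObs hLaw hInd x f hrep hg hdist _ loc loc'
  have hn0 : (16 : ℝ) ≤ n := by exact_mod_cast hn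
  have : Nonempty (Fin n) := ⟨⟨0, by omega⟩⟩
  rcases lt_or_ge κ √(Real.log n / n) with hbig | hsmall
  · refine ⟨Set.univ, MeasurableSet.univ, ?_, fun ω _ xhat _ =>
      ⟨LinearIsometryEquiv.refl ℝ ℂ, dInf_le fun i => (geoDist_le_pi _ _).trans ?_⟩⟩
    · rw [probReal_univ, sub_le_self_iff]
      positivity
    · calc Real.pi = Real.pi / κ * κ := by field_simp
        _ ≤ max (81 * K) (Real.pi / κ) * √(Real.log n / n) := by
          gcongr
          exact le_max_right _ _
  obtain ⟨m, hm⟩ := h4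
  have hη0 := Real.sqrt_nonneg (Real.log n / n)
  have h1 : √(Real.log n / n) ≤ 1 / 20 := hsmall.trans (min_le_left _ _)
  have h2 : ca * √(Real.log n / n) ≤ 1 / 10 := by
    have := hsmall.trans ((min_le_right _ _).trans (min_le_left _ _))
    rw [le_div_iff₀ (by positivity)] at this
    linarith
  have h3 : 320000 * (13 + 2 * cL * c + 3 * ce) * √(Real.log n / n) ≤ cl := by
    have := hsmall.trans ((min_le_right _ _).trans (min_le_right _ _))
    rw [le_div_iff₀ (by positivity)] at this
    linarith
  have hlog : 1 ≤ Real.log n := by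
    rw [Real.le_log_iff_exp_le (by linarith)]
    linarith [Real.exp_one_lt_d9]
  -- η ≤ 1/20 reads 400 log n ≤ n, and log n ≥ 1. This gives m ≥ 100, as the gap estimates need.
  have hn400 : 400 ≤ n := by
    rw [Real.sqrt_le_iff, div_le_iff₀ (by linarith)] at h1
    have : (400 : ℝ) ≤ n := by linarith [h1.2]
    exact_mod_cast this
  have : NeZero m := ⟨by omega⟩
  obtain ⟨σ, hσ⟩ : ∃ σ : Equiv.Perm (Fin n),
      ∀ j, geoDist (x j) (gridPoint n (σ j)) ≤ ca * √(Real.log n / n) := by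
    obtain ⟨σ, hσ⟩ := exists_eq_ciInf_of_finite
      (f := fun σ : Equiv.Perm (Fin n) => dInf x fun j => gridPoint n (σ j))
    refine ⟨σ, fun j => (geoDist_le_dInf x (fun j => gridPoint n (σ j)) j).trans ?_⟩
    rw [hσ]
    exact hdist
  have hF : ∀ i j, i ≠ j → F i j = f (x i) (x j) := by
    intro i j hij
    rcases lt_or_gt_of_ne hij with h | h
    · exact (hrep.2 i j h).symm
    · rw [hObs.mean_symm, (show BiLipschitz n cl cL ce f from hrep.1).symm]
      exact (hrep.2 j i h).symm
  set X : Ω → Finset (Fin n) × Finset (Fin n) := fun ω => (S ω, S' ω) with hX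
  set T := 3 * n * √(Real.log n / n) with hT
  -- E₁ is the failure of the sampling, E₂ that of the noise for an admissible pair. Independence of
  -- A and (S, S') lets the bound for fixed subsets pass to the random ones.
  set E₁ := {ω | ¬ (X ω ∈ splitPairs n ∧ WellSpread σ T (X ω).1 ∧ WellSpread σ T (X ω).2)}
  set E₂ := {ω | X ω ∈ splitPairs n ∧ A ω ∈ noiseEvent m loc loc' F (X ω)}
  have hE₁ : P.real E₁ ≤ 2 / (n : ℝ) ^ 2 :=
    measure_not_wellSpread_le hn ⟨m, hm⟩ σ (by linarith) hLaw
  have hE₂ : P.real E₂ ≤ 4 / (n : ℝ) ^ 2 := by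
    refine IndepFun.measureReal_le hInd hLaw.aemeasurable (fun p hp => ?_) (by positivity)
      fun p hp => hObs.measure_noiseEvent_le hn hm loc loc' hp
    exact (measurableSet_operatorEvent.union (measurableSet_refinementEvent loc hp.1)).union
      (measurableSet_operatorEvent.union (measurableSet_refinementEvent loc' hp.2.1))
  -- The random subsets have a law and so are only almost everywhere measurable; a measurable hull
  -- of the exceptional set replaces it without changing its measure.
  refine ⟨(toMeasurable P (E₁ ∪ E₂))ᶜ, (measurableSet_toMeasurable _ _).compl, ?_, ?_⟩
  · rw [probReal_compl_eq_one_sub (measurableSet_toMeasurable _ _)]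
    have e : P.real (toMeasurable P (E₁ ∪ E₂)) = P.real (E₁ ∪ E₂) := by
      rw [Measure.real, measure_toMeasurable, Measure.real]
    have h5 := measureReal_union_le (μ := P) E₁ E₂
    have h6 : 2 / (n : ℝ) ^ 2 + 4 / (n : ℝ) ^ 2 ≤ 9 / (n : ℝ) ^ 2 := by
      rw [← add_div]
      gcongr
      norm_num
    rw [e]
    linarith
  · intro ω hω xhat hxhat
    have hω' : ω ∉ E₁ ∪ E₂ := fun h => hω (subset_toMeasurable _ _ h)
    rw [Set.mem_union, not_or] at hω'
    obtain ⟨hp, hW, hW'⟩ := not_not.1 hω'.1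
    have hME : A ω ∉ noiseEvent m loc loc' F (S ω, S' ω) := fun h => hω'.2 ⟨hp, h⟩
    obtain ⟨Q, hQ⟩ := dInf_le_of_isLocalizeAndRefine hca.le hcl hcL.le hce.le hrep.1 hg hF
      hObs.mean_diag hσ hc hK hm (by omega) (by linarith) h2 h3 (hObs.symm ω) hp hW hW' hME hxhat
    refine ⟨Q, hQ.trans ?_⟩
    gcongr
    exact le_max_left _ _
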